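/- **Setup.** Let $N\ge 1$ and $q\in\mathbb C$. Let $L$ be the free abelian group on $A^i,B^i$ ($1\le i\le N$) with the symmetric form $(A^i,B^j)=\delta_{ij}$, $(A^i,A^j)=(B^i,B^j)=0$, let $L_A=\bigoplus_i\mathbb Z A^i$ and $\mathfrak h=L\otimes\mathbb C$. Let $S$ be the symmetric algebra of $\mathfrak h\otimes t^{-1}\mathbb C[t^{-1}]$, and $\Lambda$ the exterior algebra on odd variables $\Phi^i_{-n}$ ($n\ge0$) and $\Psi^i_{-n}$ ($n\ge1$). Put $V_L=\Lambda\otimes S\otimes\mathbb C[L]$. It carries the modes $x_n=x\otimes t^n$ ($x\in\mathfrak h$) and $\Phi^i_n,\Psi^i_n$ with the relations $$[x_m,y_n]=m(x,y)\delta_{m+n,0},\quad [\Phi^i_m,\Psi^j_n]_+=\delta_{ij}\delta_{m+n,0},\quad [\Phi^i_m,\Phi^j_n]_+=[\Psi^i_m,\Psi^j_n]_+=0,$$ all bosonic modes commuting with all fermionic ones, $x_0e^\alpha=(x,\alpha)e^\alpha$ and $x_ne^\alpha=\Phi^i_ne^\alpha=\Psi^i_{n-1}e^\alpha=0$ for $n\ge1$.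 The fields are $x(z)=\sum_j x_jz^{-j-1}$, $\Phi^i(z)=\sum_j\Phi^i_jz^{-j}$, $\Psi^i(z)=\sum_j\Psi^i_jz^{-j-1}$, $$e^\alpha(z)=e^\alpha\exp\Big(-\sum_{n<0}\frac{\alpha_n}{n}z^{-n}\Big)\exp\Big(-\sum_{n>0}\frac{\alpha_n}{n}z^{-n}\Big)z^{\alpha_0},$$ and a monomial state times $e^\alpha$ has as its field the normally ordered product of $e^\alpha(z)$ with the fields $\frac1{n!}\partial^nx(z)$, $\frac1{n!}\partial^n\Phi^i(z)$, $\frac1{n!}\partial^n\Psi^i(z)$ of its factors $x_{-n-1}$, $\Phi^i_{-n}$, $\Psi^i_{-n-1}$. The product $x_{(n)}y$ is the coefficient of $z^{-n-1}$ in $x(z)y$. Here $e^\alpha$ acts on $\mathbb C[L]$ by $e^\alpha e^\beta=\varepsilon(\alpha,\beta)e^{\alpha+\beta}$, where $\varepsilon:L\times L\to\{\pm1\}$ is any bimultiplicative map with $\varepsilon(\alpha,\beta)=1$ for $\alpha\in L_A$; for instance $\varepsilon=1$, or the cocycle $\varepsilon(\alpha,\beta)=(-1)^{m}$, $m=\sum_ib_ia'_i$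 for $\alpha=\sum_i(a_iA^i+b_iB^i)$ and $\beta=\sum_i(a'_iA^i+b'_iB^i)$, which gives the usual locality signs of a lattice vertex algebra. Let $\xi_i=A^i$ ($i\le N$) and $\xi_{N+1}=-A^1-\cdots-A^N$; the maximal cones of the fan of $\mathbb P^N$ are generated by $N$ of these $N+1$ vectors. Every $a\in L_A$ is uniquely $\sum_{i=1}^{N+1}n_i\xi_i$ with all $n_i\ge0$ and at most $N$ of them positive; put $\mathrm{ht}(a)=\sum_{i=1}^{N+1} n_i$, and let $\mathrm{ht}(\alpha)$, $\alpha\in L$, be the height of the $L_A$-component of $\alpha$. Then $V_{L,q}$ is the space $V_L$ with the products $$(x\otimes e^\alpha)_{(n),q}(y\otimes e^\beta)=q^{\mathrm{ht}(\alpha)+\mathrm{ht}(\beta)-\mathrm{ht}(\alpha+\beta)}\,(x\otimes e^\alpha)_{(n)}(y\otimes e^\beta)\qquad(x,y\in\Lambda\otimes S),$$ where the exponent is always $\ge0$ and $0^0=1$. Let $Q_0$ and $D$ be the operators $u\mapsto v_{(0),q}u$ on $V_{L,q}$ for $$v=\sum_iA^i_{-1}\Phi^i_0e^0\quad\text{and}\quad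 v=\sum_i\Psi^i_{-1}\big(e^{A^i}-e^{-A^1-\cdots-A^N}\big)$$ respectively, i.e. $Q_0=\int\sum_iA^i(z)\Phi^i(z)$ and $D=\int\sum_i\Psi^i(z)(e^{A^i}-e^{-\sum_jA^j})(z)$. **Theorem 2.3.** One has $Q_0^2=D^2=0$ and $DQ_0=-Q_0D$, so that $D$ induces a differential on $H_{Q_0}(V_{L,q})=\operatorname{Ker}Q_0/\operatorname{Im}Q_0$. The $(-1)$-st product $_{(-1),q}$ of $V_{L,q}$ induces a well-defined product on the iterated cohomology $H_D(H_{Q_0}(V_{L,q}))$, with unit the class of $e^0$, and there is an isomorphism of algebras $$H_D(H_{Q_0}(V_{L,q}))\cong\mathbb C[T]/(T^{N+1}-q^{N+1})$$ under which $T$ corresponds to the class of $e^{-A^1-\cdots-A^N}$. -/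

import Mathlib

noncomputable section

open scoped Polynomial

namespace LatticeVA

/-! ### The lattice and the fan of projective space -/

/-- The lattice `L`: the pair `(a, b)` is `∑ aᵢ Aⁱ + ∑ bᵢ Bⁱ`. -/
abbrev Lat (N : ℕ) : Type := (Fin N → ℤ) × (Fin N → ℤ)

/-- The bilinear form with `(Aⁱ, Bʲ) = δᵢⱼ`, `(Aⁱ, Aʲ) = (Bⁱ, Bʲ) = 0`. -/
def form {N : ℕ} (α β : Lat N) : ℤ := ∑ i, (α.1 i * β.2 i + α.2 i * β.1 i)

/-- `Aⁱ = ξᵢ`, for `i = 1, …, N`. -/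
def genA {N : ℕ} (i : Fin N) : Lat N := (Pi.single i 1, 0)

/-- `ξ_{N+1} = - A¹ - ⋯ - Aᴺ`. -/
def xiLast (N : ℕ) : Lat N := (fun _ => -1, 0)

/-- The coefficient `n_{N+1}` of `ξ_{N+1}` in the representation `a = ∑ nⱼ ξⱼ` with all `nⱼ ≥ 0`
and at most `N` of the `N + 1` numbers `nⱼ` positive. The others are `nᵢ = aᵢ + n_{N+1}`. -/
def lastCoord {N : ℕ} (a : Fin N → ℤ) : ℕ := Finset.univ.sup fun i => (-a i).toNat

/-- The height `n₁ + ⋯ + n_{N+1}`. -/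
def ht {N : ℕ} (a : Fin N → ℤ) : ℤ := (∑ i, (a i + lastCoord a)) + lastCoord a

theorem neg_le_lastCoord {N : ℕ} (a : Fin N → ℤ) (i : Fin N) : -a i ≤ lastCoord a := by
  have h : (-a i).toNat ≤ lastCoord a :=
    Finset.le_sup (f := fun i => (-a i).toNat) (Finset.mem_univ i)
  omega

theorem lastCoord_le {N : ℕ} (a : Fin N → ℤ) (t : ℕ) (h : ∀ i, -a i ≤ t) : lastCoord a ≤ t :=
  Finset.sup_le fun i _ => by have := h i; omega

/-- `ht` is the height: it can be computed from any representation `a = ∑ nᵢ ξᵢ + t ξ_{N+1}` with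
nonnegative coefficients not all of which are positive. -/
theorem ht_eq {N : ℕ} (a : Fin N → ℤ) (n : Fin N → ℕ) (t : ℕ) (ha : ∀ i, a i = n i - t)
    (h : t = 0 ∨ ∃ i, n i = 0) : ht a = (∑ i, (n i : ℤ)) + t := by
  have h1 : lastCoord a = t := by
    apply le_antisymm
    · exact lastCoord_le a t fun i => by have := ha i; omega
    · rcases h with h | ⟨i, hi⟩
      · omega
      · have := neg_le_lastCoord a i
        have := ha i
        omega
  unfold ht
  rw [h1]
  congr 1
  exact Finset.sum_congr rfl fun i _ => by have := ha i; omega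

theorem ht_add_le {N : ℕ} (a b : Fin N → ℤ) : ht (a + b) ≤ ht a + ht b := by
  have h : lastCoord (a + b) ≤ lastCoord a + lastCoord b :=
    lastCoord_le _ _ fun i => by
      have := neg_le_lastCoord a i
      have := neg_le_lastCoord b i
      simp only [Pi.add_apply]
      push_cast
      omega
  have h' : (lastCoord (a + b) : ℤ) ≤ lastCoord a + lastCoord b := by exact_mod_cast h
  simp only [ht, Finset.sum_add_distrib, Pi.add_apply, Finset.sum_const, Finset.card_univ,
    Fintype.card_fin, nsmul_eq_mul]
  nlinarith [Int.natCast_nonneg N]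

/-- The exponent `ht α + ht β - ht (α + β) ≥ 0` (heights of the `A`-components) of `q` in the
deformed products; it vanishes exactly when the `A`-components lie in a common cone of the fan. -/
def defect {N : ℕ} (α β : Lat N) : ℕ := (ht α.1 + ht β.1 - ht (α + β).1).toNat

/-- Sign twists `e^α e^β = ε(α, β) e^{α+β}` of the group algebra of `L` that are trivial on
`L_A × L`. The untwisted group algebra is `ε = 1`; the bilinear cocycle
`ε(α, β) = (-1)^{∑ α_{Bⁱ} β_{Aⁱ}}` gives the usual locality signs of a lattice vertex algebra. -/
structure IsTwist {N : ℕ} (ε : Lat N → Lat N → ℤˣ) : Prop where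
  add_left : ∀ α α' β, ε (α + α') β = ε α β * ε α' β
  add_right : ∀ α β β', ε α (β + β') = ε α β * ε α β'
  trivial_left : ∀ α β, α.2 = 0 → ε α β = 1

/-! ### The Fock space -/

/-- Bosonic creation modes: `(inl i, n)` is `Aⁱ_{-n-1}` and `(inr i, n)` is `Bⁱ_{-n-1}`. -/
abbrev BMode (N : ℕ) : Type := (Fin N ⊕ Fin N) × ℕ

/-- Fermionic creation modes, with an auxiliary linear order used to write down ordered
monomials. -/
abbrev FMode (N : ℕ) : Type := (Fin N ⊕ₗ Fin N) ×ₗ ℕ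

/-- `Φⁱ_{-n}`, `n ≥ 0`. -/
def phiMode {N : ℕ} (i : Fin N) (n : ℕ) : FMode N := toLex (toLex (Sum.inl i), n)

/-- `Ψⁱ_{-n-1}`, `n ≥ 0`. -/
def psiMode {N : ℕ} (i : Fin N) (n : ℕ) : FMode N := toLex (toLex (Sum.inr i), n)

/-- The symmetric algebra of `𝔥 ⊗ t⁻¹ℂ[t⁻¹]`. -/
abbrev Sym (N : ℕ) : Type := MvPolynomial (BMode N) ℂ

/-- The space `V_L = Λ ⊗ S ⊗ ℂ[L]`: the basis vector at `(α, s)` with coefficient `p` is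
`f₁ ⋯ f_r · p · e^α`, where `f₁ < ⋯ < f_r` are the elements of `s`. -/
abbrev V (N : ℕ) : Type := (Lat N × Finset (FMode N)) →₀ Sym N

/-- The vector `e^α`. -/
def expVec {N : ℕ} (α : Lat N) : V N := Finsupp.single (α, ∅) 1

/-- Multiplication by the bosonic variable `k`. -/
def bCreate {N : ℕ} (k : BMode N) : Module.End ℂ (V N) :=
  Finsupp.mapRange.linearMap (LinearMap.mulLeft ℂ (MvPolynomial.X k : Sym N))

/-- Differentiation with respect to the bosonic variable `k`. -/
def bDeriv {N : ℕ} (k : BMode N) : Module.End ℂ (V N) :=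
  Finsupp.mapRange.linearMap (MvPolynomial.pderiv (R := ℂ) k).toLinearMap

/-- The operator that acts on `Λ ⊗ S ⊗ e^β` as the scalar `c β`. -/
def onSector {N : ℕ} (c : Lat N → ℂ) : Module.End ℂ (V N) :=
  Finsupp.lsum ℂ fun x => c x.1 • Finsupp.lsingle x

/-- The sign `(-1)^{#{g ∈ s : g < f}}`. -/
def fSign {N : ℕ} (f : FMode N) (s : Finset (FMode N)) : ℂ := (-1) ^ (s.filter (· < f)).card

/-- Left exterior multiplication by the fermionic variable `f`. -/
def fCreate {N : ℕ} (f : FMode N) : Module.End ℂ (V N) :=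
  Finsupp.lsum ℂ fun x =>
    if f ∈ x.2 then 0 else fSign f x.2 • Finsupp.lsingle (x.1, insert f x.2)

/-- The odd (left) derivative with respect to the fermionic variable `f`. -/
def fDeriv {N : ℕ} (f : FMode N) : Module.End ℂ (V N) :=
  Finsupp.lsum ℂ fun x =>
    if f ∈ x.2 then fSign f x.2 • Finsupp.lsingle (x.1, x.2.erase f) else 0

/-- The generating fields. -/
inductive Gen (N : ℕ) : Type
  | A (i : Fin N)
  | B (i : Fin N)
  | Phi (i : Fin N)
  | Psi (i : Fin N)

/-- Parity of the generating fields. -/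
def Gen.odd {N : ℕ} : Gen N → Bool
  | .A _ => false
  | .B _ => false
  | .Phi _ => true
  | .Psi _ => true

/-- The action on `V_L` of `x_n = x ⊗ tⁿ`, with `[Aⁱ_m, Bʲ_n] = m δᵢⱼ δ_{m+n,0}` and
`[Φⁱ_m, Ψʲ_n]₊ = δᵢⱼ δ_{m+n,0}`. -/
def Gen.mode {N : ℕ} : Gen N → ℤ → Module.End ℂ (V N)
  | .A i, Int.negSucc n => bCreate (Sum.inl i, n)
  | .A i, Int.ofNat 0 => onSector fun β => (β.2 i : ℂ)
  | .A i, Int.ofNat (n + 1) => ((n : ℂ) + 1) • bDeriv (Sum.inr i, n)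
  | .B i, Int.negSucc n => bCreate (Sum.inr i, n)
  | .B i, Int.ofNat 0 => onSector fun β => (β.1 i : ℂ)
  | .B i, Int.ofNat (n + 1) => ((n : ℂ) + 1) • bDeriv (Sum.inl i, n)
  | .Phi i, Int.negSucc n => fCreate (phiMode i (n + 1))
  | .Phi i, Int.ofNat 0 => fCreate (phiMode i 0)
  | .Phi i, Int.ofNat (n + 1) => fDeriv (psiMode i n)
  | .Psi i, Int.negSucc n => fCreate (psiMode i n)
  | .Psi i, Int.ofNat n => fDeriv (phiMode i n)

/-- The coefficient of `z^e` in `g(z)`, where `x(z) = ∑ x_j z^{-j-1}` for `x = Aⁱ, Bⁱ, Ψⁱ` and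
`Φⁱ(z) = ∑ Φⁱ_j z^{-j}`. For `e ≥ 0` this is a creation operator, for `e < 0` an annihilation
operator (or a zero mode `Aⁱ_0`, `Bⁱ_0`). -/
def Gen.coeff {N : ℕ} : Gen N → ℤ → Module.End ℂ (V N)
  | .A i, e => Gen.mode (.A i) (-e - 1)
  | .B i, e => Gen.mode (.B i) (-e - 1)
  | .Phi i, e => Gen.mode (.Phi i) (-e)
  | .Psi i, e => Gen.mode (.Psi i) (-e - 1)

/-- `α_n` for `α ∈ L`. -/
def heis {N : ℕ} (α : Lat N) (n : ℤ) : Module.End ℂ (V N) :=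
  ∑ i, ((α.1 i : ℂ) • Gen.mode (.A i) n + (α.2 i : ℂ) • Gen.mode (.B i) n)

theorem bDeriv_eq_zero {N : ℕ} (v : V N) :
    ∃ m : ℕ, ∀ n, m ≤ n → ∀ x, bDeriv (x, n) v = 0 := by
  induction v using Finsupp.induction_linear with
  | zero => exact ⟨0, fun n _ x => map_zero _⟩
  | add f g hf hg =>
    obtain ⟨a, ha⟩ := hf
    obtain ⟨b, hb⟩ := hg
    refine ⟨max a b, fun n hn x => ?_⟩
    rw [map_add, ha n (le_trans (le_max_left a b) hn), hb n (le_trans (le_max_right a b) hn),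
      add_zero]
  | single y p =>
    refine ⟨p.vars.sup (fun k => k.2 + 1), fun n hn x => ?_⟩
    have hx : (x, n) ∉ p.vars := fun h => by
      have := Finset.le_sup (f := fun k : BMode N => k.2 + 1) h
      simp only at this
      omega
    simp [bDeriv, Finsupp.mapRange.linearMap_apply,
      MvPolynomial.pderiv_eq_zero_of_notMem_vars hx]

theorem fDeriv_eq_zero {N : ℕ} (v : V N) :
    ∃ m : ℕ, ∀ n, m ≤ n → ∀ i, fDeriv (phiMode i n) v = 0 ∧ fDeriv (psiMode i n) v = 0 := by
  induction v using Finsupp.induction_linear with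
  | zero => exact ⟨0, fun n _ i => ⟨map_zero _, map_zero _⟩⟩
  | add f g hf hg =>
    obtain ⟨a, ha⟩ := hf
    obtain ⟨b, hb⟩ := hg
    refine ⟨max a b, fun n hn i => ?_⟩
    have h1 := ha n (le_trans (le_max_left a b) hn) i
    have h2 := hb n (le_trans (le_max_right a b) hn) i
    rw [map_add, map_add, h1.1, h1.2, h2.1, h2.2, add_zero]
    exact ⟨rfl, rfl⟩
  | single y p =>
    refine ⟨y.2.sup (fun k => (ofLex k).2 + 1), fun n hn i => ?_⟩
    have h1 : ∀ f : FMode N, (ofLex f).2 = n → f ∉ y.2 := fun f hf h => by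
      have h2 : (ofLex f).2 + 1 ≤ n :=
        le_trans (Finset.le_sup (f := fun k : FMode N => (ofLex k).2 + 1) h) hn
      omega
    have h2 : phiMode i n ∉ y.2 := h1 _ rfl
    have h3 : psiMode i n ∉ y.2 := h1 _ rfl
    constructor <;> simp [fDeriv, h2, h3]

/-- On every vector, only finitely many negative powers of `z` occur in `g(z)`. -/
theorem Gen.coeff_finite {N : ℕ} (g : Gen N) (c : ℤ → ℂ) (v : V N) :
    (Function.support fun e : ℤ => if e < 0 then c e • g.coeff e v else 0).Finite := by
  obtain ⟨a, ha⟩ := bDeriv_eq_zero v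
  obtain ⟨b, hb⟩ := fDeriv_eq_zero v
  refine (Set.finite_Icc (-((a : ℤ) + b + 2)) 0).subset fun e he => ?_
  simp only [Function.mem_support, ne_eq, ite_eq_right_iff, not_forall] at he
  obtain ⟨he0, he⟩ := he
  by_contra hmem
  apply he
  have hlt : e < -((a : ℤ) + b + 2) := by
    by_contra h
    exact hmem ⟨by omega, by omega⟩
  obtain ⟨n, rfl⟩ : ∃ n : ℕ, e = -((n : ℤ) + 2) := ⟨(-e - 2).toNat, by omega⟩
  have e1 : -(-((n : ℤ) + 2)) - 1 = Int.ofNat (n + 1) := by simp; ring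
  have e2 : -(-((n : ℤ) + 2)) = Int.ofNat (n + 1 + 1) := by simp; ring
  cases g with
  | A i => simp only [Gen.coeff, e1, Gen.mode]; simp [ha n (by omega)]
  | B i => simp only [Gen.coeff, e1, Gen.mode]; simp [ha n (by omega)]
  | Phi i => simp only [Gen.coeff, e2, Gen.mode]; simp [hb (n + 1) (by omega)]
  | Psi i => simp only [Gen.coeff, e1, Gen.mode]; simp [hb (n + 1) (by omega)]

/-! ### Fields -/

/-- Laurent polynomials `V[z, z⁻¹]`; the value at `d` is the coefficient of `z^d`. -/
abbrev LPoly (N : ℕ) : Type := ℤ →₀ V N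

/-- The creation part `∑_{e ≥ n} (e choose n) g_e z^{e-n}` of `∂ⁿg(z) / n!`, where
`g(z) = ∑ g_e z^e`. -/
def creationPart {N : ℕ} (g : Gen N) (n : ℕ) : PowerSeries (Module.End ℂ (V N)) :=
  PowerSeries.mk fun j => ((j + n).choose n : ℂ) • g.coeff ((j + n : ℕ) : ℤ)

/-- The operators `∑_{e < 0} (e choose n) g_e z^e` from `V` to `V[z⁻¹]`. -/
def annihilationAux {N : ℕ} (g : Gen N) (n : ℕ) : V N →ₗ[ℂ] LPoly N where
  toFun v := Finsupp.ofSupportFinite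
    (fun e => if e < 0 then ((Ring.choose e n : ℤ) : ℂ) • g.coeff e v else 0)
    (g.coeff_finite (fun e => ((Ring.choose e n : ℤ) : ℂ)) v)
  map_add' v w := by
    ext1 e
    simp only [Finsupp.ofSupportFinite_coe, Finsupp.add_apply]
    split_ifs <;> simp
  map_smul' c v := by
    ext1 e
    simp only [Finsupp.ofSupportFinite_coe, Finsupp.smul_apply, RingHom.id_apply]
    split_ifs
    · rw [map_smul, smul_comm]
    · simp

/-- The annihilation part `∑_{e < 0} (e choose n) g_e z^{e-n}` of `∂ⁿg(z) / n!`, extended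
`ℂ[z, z⁻¹]`-linearly to `V[z, z⁻¹]`. -/
def annihilationPart {N : ℕ} (g : Gen N) (n : ℕ) : Module.End ℂ (LPoly N) :=
  Finsupp.lsum ℂ fun d => Finsupp.lmapDomain (V N) ℂ (fun e => d + e - n) ∘ₗ annihilationAux g n

/-- The exponential of a power series without constant term. -/
def psExp {E : Type*} [Ring E] [Algebra ℂ E] (f : PowerSeries E) : PowerSeries E :=
  PowerSeries.mk fun k =>
    ∑ r ∈ Finset.range (k + 1), ((r.factorial : ℂ)⁻¹) • PowerSeries.coeff k (f ^ r)

/-- `exp (-∑_{n<0} (α_n / n) z^{-n}) = exp (∑_{m>0} (α_{-m} / m) z^m)`. -/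
def expCreation {N : ℕ} (α : Lat N) : PowerSeries (Module.End ℂ (V N)) :=
  psExp (PowerSeries.mk fun m => if m = 0 then 0 else ((m : ℂ)⁻¹) • heis α (-(m : ℤ)))

/-- `exp (-∑_{n>0} (α_n / n) w^n)`, `w = z⁻¹`, on the symmetric algebra. Since `α_n / n` acts as
the derivation `∑ᵢ (α, Aⁱ) ∂/∂Aⁱ_{-n} + (α, Bⁱ) ∂/∂Bⁱ_{-n}`, this exponential is the algebra
homomorphism that maps `x_{-n}` to `x_{-n} - (α, x) w^n`, for `x = Aⁱ, Bⁱ`. -/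
def expShift {N : ℕ} (α : Lat N) : Sym N →ₐ[ℂ] (Sym N)[X] :=
  MvPolynomial.aeval fun k : BMode N =>
    Polynomial.C (MvPolynomial.X k) -
      Polynomial.monomial (k.2 + 1)
        (MvPolynomial.C (Sum.elim (fun i => (α.2 i : ℂ)) (fun i => (α.1 i : ℂ)) k.1) : Sym N)

/-- `e^α · exp (-∑_{n>0} (α_n / n) z^{-n}) · z^{α_0}` on `V[z, z⁻¹]`. -/
def expAnnihilation {N : ℕ} (ε : Lat N → Lat N → ℤˣ) (α : Lat N) : Module.End ℂ (LPoly N) :=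
  Finsupp.lsum ℂ fun d => Finsupp.lsum ℂ fun x =>
    (((ε α x.1 : ℤ) : ℂ) •
      Polynomial.lsum fun k : ℕ =>
        (Finsupp.lsingle (d + form α x.1 - k) : V N →ₗ[ℂ] LPoly N) ∘ₗ
          (Finsupp.lsingle (α + x.1, x.2) : Sym N →ₗ[ℂ] V N)) ∘ₗ (expShift α).toLinearMap

/-- The Cauchy product of a power series of operators with a Laurent polynomial of vectors; the
value at `e` is the coefficient of `z^e`. -/
def cauchy {N : ℕ} (C : PowerSeries (Module.End ℂ (V N))) : LPoly N →ₗ[ℂ] (ℤ → V N) :=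
  Finsupp.lsum ℂ fun d => LinearMap.pi fun e =>
    if d ≤ e then PowerSeries.coeff (e - d).toNat C else 0

/-- The sign that arises when `g` is moved past the fields in `l`. -/
def moveSign {N : ℕ} (g : Gen N) (l : List (Gen N × ℕ)) : ℂ :=
  if g.odd then (-1) ^ (l.filter fun x => x.1.odd).length else 1

/-- Normally ordered products. A pair `(g, n)` in the list stands for the field `∂ⁿg(z) / n!`, `R`
is the rightmost factor, and `C` collects the creation parts that have already been moved to the
left:  `: g h ⋯ R : = g_- : h ⋯ R : ± : h ⋯ R : g_+`. -/
def normalOrdered {N : ℕ} (R : Module.End ℂ (LPoly N)) :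
    List (Gen N × ℕ) → PowerSeries (Module.End ℂ (V N)) → (LPoly N →ₗ[ℂ] (ℤ → V N))
  | [], C => cauchy C ∘ₗ R
  | (g, n) :: l, C => normalOrdered R l (C * creationPart g n) +
      moveSign g l • (normalOrdered R l C ∘ₗ annihilationPart g n)

/-- The generating field and the order of its derivative attached to a bosonic mode. -/
def bLetter {N : ℕ} (k : BMode N) : Gen N × ℕ := (Sum.elim Gen.A Gen.B k.1, k.2)

/-- The generating field and the order of its derivative attached to a fermionic mode. -/
def fLetter {N : ℕ} (f : FMode N) : Gen N × ℕ :=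
  (Sum.elim Gen.Phi Gen.Psi (ofLex (ofLex f).1), (ofLex f).2)

/-- The factors of the state `f₁ ⋯ f_r · m`, with `f₁ < ⋯ < f_r` the elements of `s` and `m` a
monomial. The order of the bosonic factors is immaterial. -/
def word {N : ℕ} (s : Finset (FMode N)) (m : BMode N →₀ ℕ) : List (Gen N × ℕ) :=
  (s.sort).map fLetter ++ (Finsupp.toMultiset m).toList.map bLetter

/-- The state-field correspondence of `V_L`: `field ε x y e` is the coefficient of `z^e` in
`x(z) y`, and the field of `x⁽¹⁾ ⋯ x⁽ᵏ⁾ e^α` is the normally ordered product of the fields of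
`x⁽¹⁾, …, x⁽ᵏ⁾, e^α`. -/
def field {N : ℕ} (ε : Lat N → Lat N → ℤˣ) : V N →ₗ[ℂ] V N →ₗ[ℂ] (ℤ → V N) :=
  Finsupp.lsum ℂ fun x =>
    (MvPolynomial.basisMonomials (BMode N) ℂ).constr ℂ fun m =>
      normalOrdered (expAnnihilation ε x.1) (word x.2 m) (expCreation x.1) ∘ₗ Finsupp.lsingle 0

/-- The product `x₍ₙ₎ y` of `V_L`: the coefficient of `z^{-n-1}` in `x(z) y`. -/
def nProd {N : ℕ} (ε : Lat N → Lat N → ℤˣ) (n : ℤ) : V N →ₗ[ℂ] V N →ₗ[ℂ] V N :=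
  (field ε).compr₂ (LinearMap.proj (-n - 1))

/-- The product `₍ₙ₎,q` of `V_{L,q}`: the bilinear operation with
`(x e^α)₍ₙ₎,q (y e^β) = q^{ht α + ht β - ht (α+β)} (x e^α)₍ₙ₎ (y e^β)`. For `q ≠ 0` this is
`t_q⁻¹ (t_q (x e^α)₍ₙ₎ t_q (y e^β))` with `t_q = q^{ht α}` on the sector of `α`. For `q = 0` it is
the limit as `q → 0`: the undeformed product if the `A`-components of `α`, `β` lie in a common
cone of the fan, and zero otherwise. -/
def qProd {N : ℕ} (ε : Lat N → Lat N → ℤˣ) (q : ℂ) (n : ℤ) : V N →ₗ[ℂ] V N →ₗ[ℂ] V N :=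
  Finsupp.lsum ℂ fun x =>
    (nProd ε n ∘ₗ Finsupp.lsingle x).compl₂ (onSector fun β => q ^ defect x.1 β)

/-- `Q₀ = ∫ ∑ᵢ Aⁱ(z) Φⁱ(z)` on `V_{L,q}`. -/
def Q0 {N : ℕ} (ε : Lat N → Lat N → ℤˣ) (q : ℂ) : Module.End ℂ (V N) :=
  qProd ε q 0 (∑ i, Gen.mode (.A i) (-1) (Gen.mode (.Phi i) 0 (expVec 0)))

/-- `D = ∫ ∑ᵢ Ψⁱ(z) (e^{Aⁱ} - e^{-∑ⱼ Aʲ})(z)` on `V_{L,q}`. -/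
def D {N : ℕ} (ε : Lat N → Lat N → ℤˣ) (q : ℂ) : Module.End ℂ (V N) :=
  qProd ε q 0 (∑ i, Gen.mode (.Psi i) (-1) (expVec (genA i) - expVec (xiLast N)))

/-! ### Cohomology -/

/-- `H_d(W) = Ker d / Im d`, for `d` with `d² = 0`. -/
abbrev Cohomology {W : Type*} [AddCommGroup W] [Module ℂ W] (d : Module.End ℂ W) : Type _ :=
  LinearMap.ker d ⧸ (LinearMap.range d).submoduleOf (LinearMap.ker d)

/-- The cohomology class of a cocycle. -/
def Cohomology.mk {W : Type*} [AddCommGroup W] [Module ℂ W] (d : Module.End ℂ W) (w : W)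
    (hw : d w = 0) : Cohomology d :=
  Submodule.Quotient.mk ⟨w, hw⟩

theorem Cohomology.mapsTo {W : Type*} [AddCommGroup W] [Module ℂ W] {d δ : Module.End ℂ W}
    (h : δ * d = -(d * δ)) (w : W) (hw : w ∈ LinearMap.ker d) : δ w ∈ LinearMap.ker d := by
  have h1 := LinearMap.congr_fun h w
  simp only [Module.End.mul_apply, LinearMap.neg_apply, LinearMap.mem_ker.mp hw, map_zero] at h1
  exact LinearMap.mem_ker.mpr (neg_eq_zero.mp h1.symm)

/-- The operator induced on `H_d(W)` by an operator that anticommutes with `d`. -/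
def Cohomology.induced {W : Type*} [AddCommGroup W] [Module ℂ W] (d δ : Module.End ℂ W)
    (h : δ * d = -(d * δ)) : Module.End ℂ (Cohomology d) :=
  Submodule.mapQ _ _ (δ.restrict (Cohomology.mapsTo h)) (by
    rintro ⟨w, hw⟩ ⟨u, hu⟩
    refine ⟨-δ u, ?_⟩
    have h1 := LinearMap.congr_fun h u
    simp only [Module.End.mul_apply, LinearMap.neg_apply] at h1
    simp only [Submodule.subtype_apply] at hu
    subst hu
    rw [map_neg, ← h1]
    rfl)

/-- `a` represents the class `c` in the iterated cohomology `H_δ(H_d(W))`. -/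
def Represents {W : Type*} [AddCommGroup W] [Module ℂ W] {d δ : Module.End ℂ W}
    (h : δ * d = -(d * δ)) (a : W) (c : Cohomology (Cohomology.induced d δ h)) : Prop :=
  ∃ (ha : d a = 0) (ha' : Cohomology.induced d δ h (Cohomology.mk d a ha) = 0),
    Cohomology.mk (Cohomology.induced d δ h) (Cohomology.mk d a ha) ha' = c

end LatticeVA

end

/-!
The proof computes the two cohomologies by explicit homotopies.

On the Fock space `V_L` the operator `Q₀` is the locally finite sum of the quadratic terms
`:Aⁱ_j Φⁱ_{-j}:` (`evLim_Q0`). So it kills the modes of `Aⁱ` and `Φⁱ` and sends `Ψⁱ` to `Aⁱ` and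
`Bⁱ` to `∂Φⁱ`, and it is an odd derivation of all the products of `V_{L,q}` (`Q0_qProd`): this is
checked factor by factor on a normally ordered product, the case of `e^α(z)` being the only one with
exponentials (`bracketField_expVec`). Contracting along `Aⁱ ↦ Ψⁱ`, `∂Φⁱ ↦ Bⁱ`, and outside `L_A`
along a zero mode of `Φ`, gives an operator whose anticommutator with `Q₀` is diagonal with natural
numbers as eigenvalues (`Q0_anticomm_homotopy`). The contraction is truncated to finitely many
modes; as more modes are included, the kernel shrinks to the span of the zero modes
`Φ^{i₁}_0 ⋯ Φ^{iᵣ}_0 e^a`, `a ∈ L_A`, which therefore represent the cohomology of `Q₀` uniquely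
(`exists_zeroModes_add`, `eq_zero_of_mem_zeroModes`).

`D` is a sum of residues of the fields of `Ψⁱ e^α` with `α ∈ L_A`. As `L_A` is isotropic and the
`Ψⁱ` anticommute, no contractions occur between two such fields, and `D² = 0` (`D_mul_D`). As
`Q₀ (Ψⁱ e^α) = Aⁱ e^α`, and the combinations of the `Aⁱ e^α` that occur are derivatives `∂e^α`,
whose fields have no residue (`nProd_heis_expVec`), `D` anticommutes with `Q₀` (`Q0_D`).

On the zero modes `D` is the Koszul differential of the operators `e^{Aⁱ} - e^{-A¹-⋯-Aᴺ}` over the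
group ring of `L_A` deformed by the powers of `q` (`D_zeroModes`). Put `T = e^{-A¹-⋯-Aᴺ}` and
`yᵢ = e^{Aⁱ} - T`. The deformed group ring is `ℂ[y₁, …, y_N][T]` modulo the relation
`T (T + y₁) ⋯ (T + y_N) = q^{N+1}`, which is monic in `T` (`fanRelation_dvd`,
`polyAction_fanRelation`). Hence it is free over `ℂ[y₁, …, y_N]` on `1, T, …, T^N`. Division by the
relation identifies the zero modes with a direct summand of a Koszul complex of polynomials in the
`yᵢ` (`toKoszul`, `ofKoszul`), and there the de Rham differential is a homotopy
(`koszulD_anticomm_deRham`): only the part with all `yᵢ = 0` and no `Φⁱ_0` survives. So every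
`D`-cocycle is cohomologous to a polynomial in `T` (`exists_powVec_add`), and such a polynomial is a
coboundary exactly if it is a multiple of `T^{N+1} - q^{N+1}` (`mem_quantumIdeal_of_D`,
`exists_D_eq_of_mem_quantumIdeal`).

The product is compatible with all this because `Q₀` is a derivation of it and `D` is one on the
zero modes (`D_qProd`), where the product with `e^a` is the action of the deformed group ring
(`qProd_polyAction`, `isPowVec_qProd`).
-/

noncomputable section

namespace LatticeVA

open MvPolynomial

variable {N : ℕ}

/-! ### Fock spaces -/

namespace Fock

/-- The direct sum of copies of `ℂ[K] ⊗ Λ(F)` indexed by `I`: the basis vector at `(x, s)` with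
coefficient `p` is `f₁ ⋯ f_r · p` in the copy `x`, where `f₁ < ⋯ < f_r` are the elements of `s`.
The space `V N` is the case `I = Lat N`, `F = FMode N`, `K = BMode N`. -/
abbrev Space (I F K : Type*) : Type _ := (I × Finset F) →₀ MvPolynomial K ℂ

variable {I F K : Type*}

theorem ext_single {W : Type*} [AddCommMonoid W] [Module ℂ W] {S T : Space I F K →ₗ[ℂ] W}
    (h : ∀ x s p, S (Finsupp.single (x, s) p) = T (Finsupp.single (x, s) p)) : S = T :=
  Finsupp.lhom_ext fun y p => h y.1 y.2 p

theorem ext_monomial {W : Type*} [AddCommMonoid W] [Module ℂ W] {S T : Space I F K →ₗ[ℂ] W}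
    (h : ∀ x s m, S (Finsupp.single (x, s) (monomial m 1)) =
      T (Finsupp.single (x, s) (monomial m 1))) : S = T := by
  refine Finsupp.lhom_ext' fun y => (basisMonomials K ℂ).ext fun m => ?_
  simpa using h y.1 y.2 m

/-- Multiplication by a polynomial variable. -/
def bC (k : K) : Module.End ℂ (Space I F K) :=
  Finsupp.mapRange.linearMap (LinearMap.mulLeft ℂ (X k : MvPolynomial K ℂ))

/-- Differentiation with respect to a polynomial variable. -/
def bD (k : K) : Module.End ℂ (Space I F K) :=
  Finsupp.mapRange.linearMap (pderiv (R := ℂ) k).toLinearMap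

/-- The operator acting on the copy `x` as the scalar `c x`. -/
def onIdx (c : I → ℂ) : Module.End ℂ (Space I F K) :=
  Finsupp.lsum ℂ fun x => c x.1 • Finsupp.lsingle x

/-- The operator acting as the scalar `c x s m` on the monomial `m` in the exterior degree `s` of
the copy `x`. -/
def diag (c : I → Finset F → (K →₀ ℕ) → ℂ) : Module.End ℂ (Space I F K) :=
  Finsupp.lsum ℂ fun x =>
    Finsupp.lsingle x ∘ₗ (basisMonomials K ℂ).constr ℂ fun m => monomial m (c x.1 x.2 m)

@[simp] theorem bC_single (k : K) (x : I × Finset F) (p : MvPolynomial K ℂ) :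
    bC k (Finsupp.single x p) = Finsupp.single x (X k * p) := by
  simp [bC, Finsupp.mapRange.linearMap_apply]

@[simp] theorem bD_single (k : K) (x : I × Finset F) (p : MvPolynomial K ℂ) :
    bD k (Finsupp.single x p) = Finsupp.single x (pderiv k p) := by
  simp [bD, Finsupp.mapRange.linearMap_apply]

@[simp] theorem onIdx_single (c : I → ℂ) (x : I × Finset F) (p : MvPolynomial K ℂ) :
    onIdx c (Finsupp.single x p) = Finsupp.single x (c x.1 • p) := by
  simp [onIdx]

@[simp] theorem diag_single (c : I → Finset F → (K →₀ ℕ) → ℂ) (x : I) (s : Finset F) (m : K →₀ ℕ) :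
    diag c (Finsupp.single (x, s) (monomial m 1)) =
      c x s m • Finsupp.single (x, s) (monomial m 1) := by
  have h := (basisMonomials K ℂ).constr_basis ℂ
    (fun m => monomial m (c x s m) : (K →₀ ℕ) → MvPolynomial K ℂ) m
  simp only [coe_basisMonomials] at h
  simp [diag, h, smul_monomial]

theorem bC_mul_bC (k l : K) : (bC k * bC l : Module.End ℂ (Space I F K)) = bC l * bC k :=
  ext_single fun x s p => by
    simp only [Module.End.mul_apply, bC_single, mul_left_comm]

theorem pderiv_comm (k l : K) (p : MvPolynomial K ℂ) :
    pderiv k (pderiv l p) = pderiv l (pderiv k p) := by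
  classical
  have h : ⁅pderiv (R := ℂ) k, pderiv (R := ℂ) l⁆ = 0 := by
    refine MvPolynomial.derivation_ext fun i => ?_
    simp only [Derivation.commutator_apply, pderiv_X, Pi.single_apply, Derivation.zero_apply]
    split_ifs <;> simp
  have h1 := congrArg (fun d : Derivation ℂ (MvPolynomial K ℂ) (MvPolynomial K ℂ) => d p) h
  simpa [Derivation.commutator_apply, sub_eq_zero] using h1

theorem bD_mul_bD (k l : K) : (bD k * bD l : Module.End ℂ (Space I F K)) = bD l * bD k :=
  ext_single fun x s p => by
    simp only [Module.End.mul_apply, bD_single, pderiv_comm k l]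

theorem bD_mul_bC [DecidableEq K] (k l : K) :
    (bD k * bC l : Module.End ℂ (Space I F K)) = bC l * bD k + if k = l then 1 else 0 :=
  ext_single fun x s p => by
    simp only [Module.End.mul_apply, bC_single, bD_single, LinearMap.add_apply,
      Derivation.leibniz, smul_eq_mul, pderiv_X, Finsupp.single_add]
    by_cases h : k = l
    · subst h; simp
    · simp [h, Ne.symm h]

theorem onIdx_mul (c d : I → ℂ) :
    (onIdx c * onIdx d : Module.End ℂ (Space I F K)) = onIdx fun x => c x * d x :=
  ext_single fun x s p => by simp [mul_smul]

theorem onIdx_mul_bC (c : I → ℂ) (k : K) :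
    (onIdx c * bC k : Module.End ℂ (Space I F K)) = bC k * onIdx c :=
  ext_single fun x s p => by simp [-Finsupp.single_mul]

theorem onIdx_mul_bD (c : I → ℂ) (k : K) :
    (onIdx c * bD k : Module.End ℂ (Space I F K)) = bD k * onIdx c :=
  ext_single fun x s p => by simp

theorem diag_mul_diag (c d : I → Finset F → (K →₀ ℕ) → ℂ) :
    (diag c * diag d : Module.End ℂ (Space I F K)) = diag fun x s m => c x s m * d x s m :=
  ext_monomial fun x s m => by
    rw [Module.End.mul_apply, diag_single, map_smul, diag_single, diag_single, smul_smul, mul_comm]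

theorem diag_add (c d : I → Finset F → (K →₀ ℕ) → ℂ) :
    (diag c + diag d : Module.End ℂ (Space I F K)) = diag fun x s m => c x s m + d x s m :=
  ext_monomial fun x s m => by simp [add_smul]

theorem sum_diag {ι : Type*} (t : Finset ι) (c : ι → I → Finset F → (K →₀ ℕ) → ℂ) :
    (∑ j ∈ t, diag (c j) : Module.End ℂ (Space I F K)) = diag fun x s m => ∑ j ∈ t, c j x s m :=
  ext_monomial fun x s m => by simp [Finset.sum_smul]

theorem diag_one : (diag (fun _ _ _ => 1) : Module.End ℂ (Space I F K)) = 1 :=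
  ext_monomial fun x s m => by simp

theorem diag_apply (c : I → Finset F → (K →₀ ℕ) → ℂ) (v : Space I F K) (x : I) (s : Finset F)
    (m : K →₀ ℕ) : coeff m (diag c v (x, s)) = c x s m * coeff m (v (x, s)) := by
  classical
  suffices h : (lcoeff ℂ m ∘ₗ Finsupp.lapply (x, s)) ∘ₗ diag c =
      c x s m • (lcoeff ℂ m ∘ₗ Finsupp.lapply (x, s)) from LinearMap.congr_fun h v
  refine ext_monomial fun y t n => ?_
  simp only [LinearMap.comp_apply, diag_single, map_smul, LinearMap.smul_apply,
    Finsupp.lapply_apply, lcoeff_apply, Finsupp.single_apply, smul_eq_mul]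
  by_cases h1 : (y, t) = (x, s)
  · by_cases h2 : n = m
    · cases h1; subst h2; rfl
    · simp [h1, h2]
  · simp [h1]

/-- An operator preserving the eigenspaces of a diagonal operator commutes with every function of
that operator. -/
theorem comp_diag_of_comm (T : Module.End ℂ (Space I F K)) (d : I → Finset F → (K →₀ ℕ) → ℂ)
    (h : T * diag d = diag d * T) (g : ℂ → ℂ) :
    T * diag (fun x s m => g (d x s m)) = diag (fun x s m => g (d x s m)) * T := by
  refine ext_monomial fun x s m => Finsupp.ext fun ⟨y, t⟩ => MvPolynomial.ext _ _ fun n => ?_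
  have h1 := LinearMap.congr_fun h (Finsupp.single (x, s) (monomial m 1))
  have h2 := congrArg (fun v => coeff n (v (y, t))) h1
  simp only [Module.End.mul_apply, diag_single, map_smul, diag_apply, Finsupp.smul_apply,
    coeff_smul, smul_eq_mul] at h2 ⊢
  by_cases h3 : coeff n ((T (Finsupp.single (x, s) (monomial m 1))) (y, t)) = 0
  · simp [h3]
  · rw [mul_right_cancel₀ h3 h2]

theorem bC_mul_bD_self (k : K) :
    (bC k * bD k : Module.End ℂ (Space I F K)) = diag fun _ _ m => (m k : ℂ) :=
  ext_monomial fun x s m => by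
    classical
    simp only [Module.End.mul_apply, bD_single, bC_single, diag_single, pderiv_monomial, one_mul,
      Finsupp.smul_single, smul_monomial, smul_eq_mul, mul_one]
    congr 1
    by_cases h : m k = 0
    · simp [h]
    · rw [X, monomial_mul, one_mul, add_comm, tsub_add_cancel_of_le]
      rw [Finsupp.single_le_iff]
      omega

/-- The parity operator `(-1)^{|s|}`. -/
def parity : Module.End ℂ (Space I F K) :=
  Finsupp.lsum ℂ fun x => ((-1 : ℂ) ^ x.2.card) • Finsupp.lsingle x

@[simp] theorem parity_single (x : I) (s : Finset F) (p : MvPolynomial K ℂ) :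
    parity (Finsupp.single (x, s) p) = ((-1 : ℂ) ^ s.card) • Finsupp.single (x, s) p := by
  simp [parity]

theorem parity_mul_bC (k : K) :
    (parity * bC k : Module.End ℂ (Space I F K)) = bC k * parity :=
  ext_single fun x s p => by simp [-Finsupp.single_mul]

theorem parity_mul_bD (k : K) :
    (parity * bD k : Module.End ℂ (Space I F K)) = bD k * parity :=
  ext_single fun x s p => by simp

theorem parity_mul_onIdx (c : I → ℂ) :
    (parity * onIdx c : Module.End ℂ (Space I F K)) = onIdx c * parity :=
  ext_single fun x s p => by simp [smul_comm ((-1 : ℂ) ^ s.card)]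

theorem parity_mul_parity : (parity * parity : Module.End ℂ (Space I F K)) = 1 :=
  ext_single fun x s p => by
    rw [Module.End.mul_apply, parity_single, map_smul, parity_single, smul_smul, ← mul_pow]
    simp

variable [LinearOrder F]

/-- The sign `(-1)^{#{g ∈ s : g < f}}`. -/
def sgn (f : F) (s : Finset F) : ℂ := (-1) ^ (s.filter (· < f)).card

/-- Left exterior multiplication by an odd variable. -/
def fC (f : F) : Module.End ℂ (Space I F K) :=
  Finsupp.lsum ℂ fun x => if f ∈ x.2 then 0 else sgn f x.2 • Finsupp.lsingle (x.1, insert f x.2)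

/-- The left derivative with respect to an odd variable. -/
def fD (f : F) : Module.End ℂ (Space I F K) :=
  Finsupp.lsum ℂ fun x => if f ∈ x.2 then sgn f x.2 • Finsupp.lsingle (x.1, x.2.erase f) else 0

theorem sgn_mul_self (f : F) (s : Finset F) : sgn f s * sgn f s = 1 := by
  simp [sgn, ← mul_pow]

theorem sgn_insert {f g : F} {s : Finset F} (h : g ∉ s) :
    sgn f (insert g s) = (if g < f then -1 else 1) * sgn f s := by
  unfold sgn
  rw [Finset.filter_insert]
  split_ifs
  · rw [Finset.card_insert_of_notMem (by simp [h]), pow_succ, mul_comm]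
  · rw [one_mul]

theorem sgn_erase {f g : F} {s : Finset F} (h : g ∈ s) :
    sgn f (s.erase g) = (if g < f then -1 else 1) * sgn f s := by
  conv_rhs => rw [← Finset.insert_erase h, sgn_insert (Finset.notMem_erase g s)]
  split_ifs <;> simp

@[simp] theorem fC_single (f : F) (x : I) (s : Finset F) (p : MvPolynomial K ℂ) :
    fC f (Finsupp.single (x, s) p) =
      if f ∈ s then 0 else sgn f s • Finsupp.single (x, insert f s) p := by
  simp only [fC, Finsupp.lsum_single]
  split_ifs <;> simp

@[simp] theorem fD_single (f : F) (x : I) (s : Finset F) (p : MvPolynomial K ℂ) :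
    fD f (Finsupp.single (x, s) p) =
      if f ∈ s then sgn f s • Finsupp.single (x, s.erase f) p else 0 := by
  simp only [fD, Finsupp.lsum_single]
  split_ifs <;> simp

theorem fC_mul_fC (f g : F) : (fC f * fC g : Module.End ℂ (Space I F K)) = -(fC g * fC f) :=
  ext_single fun x s p => by
    simp only [Module.End.mul_apply, LinearMap.neg_apply, fC_single]
    rcases lt_trichotomy f g with h | rfl | h
    · by_cases hf : f ∈ s <;> by_cases hg : g ∈ s <;>
        simp [hf, hg, h.ne, h.ne', h.not_gt, h, sgn_insert, smul_smul, mul_comm,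
          Finset.insert_comm f g]
    · by_cases hf : f ∈ s <;> simp [hf]
    · by_cases hf : f ∈ s <;> by_cases hg : g ∈ s <;>
        simp [hf, hg, h.ne, h.ne', h.not_gt, h, sgn_insert, smul_smul, mul_comm,
          Finset.insert_comm f g]

theorem fD_mul_fD (f g : F) : (fD f * fD g : Module.End ℂ (Space I F K)) = -(fD g * fD f) :=
  ext_single fun x s p => by
    simp only [Module.End.mul_apply, LinearMap.neg_apply, fD_single]
    rcases lt_trichotomy f g with h | rfl | h
    · by_cases hf : f ∈ s <;> by_cases hg : g ∈ s <;>
        simp [hf, hg, h.ne, h.ne', h.not_gt, h, sgn_erase, smul_smul, mul_comm,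
          Finset.erase_right_comm (a := f) (b := g)]
    · by_cases hf : f ∈ s <;> simp [hf]
    · by_cases hf : f ∈ s <;> by_cases hg : g ∈ s <;>
        simp [hf, hg, h.ne, h.ne', h.not_gt, h, sgn_erase, smul_smul, mul_comm,
          Finset.erase_right_comm (a := f) (b := g)]

theorem fD_mul_fC (f g : F) :
    (fD f * fC g : Module.End ℂ (Space I F K)) = -(fC g * fD f) + if f = g then 1 else 0 :=
  ext_single fun x s p => by
    simp only [Module.End.mul_apply, LinearMap.neg_apply, LinearMap.add_apply, fC_single, fD_single]
    rcases lt_trichotomy f g with h | rfl | h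
    · by_cases hf : f ∈ s <;> by_cases hg : g ∈ s <;>
        simp [hf, hg, h.ne, h.ne', h.not_gt, h, sgn_insert, sgn_erase, smul_smul, mul_comm,
          Finset.erase_insert_of_ne]
    · by_cases hf : f ∈ s <;>
        simp [hf, sgn_insert, sgn_erase, smul_smul, sgn_mul_self, Finset.insert_erase]
    · by_cases hf : f ∈ s <;> by_cases hg : g ∈ s <;>
        simp [hf, hg, h.ne, h.ne', h.not_gt, h, sgn_insert, sgn_erase, smul_smul, mul_comm,
          Finset.erase_insert_of_ne]

theorem fC_mul_bC (f : F) (k : K) : (fC f * bC k : Module.End ℂ (Space I F K)) = bC k * fC f :=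
  ext_single fun x s p => by by_cases hf : f ∈ s <;> simp [hf, -Finsupp.single_mul]

theorem fC_mul_bD (f : F) (k : K) : (fC f * bD k : Module.End ℂ (Space I F K)) = bD k * fC f :=
  ext_single fun x s p => by by_cases hf : f ∈ s <;> simp [hf]

theorem fD_mul_bC (f : F) (k : K) : (fD f * bC k : Module.End ℂ (Space I F K)) = bC k * fD f :=
  ext_single fun x s p => by by_cases hf : f ∈ s <;> simp [hf, -Finsupp.single_mul]

theorem fD_mul_bD (f : F) (k : K) : (fD f * bD k : Module.End ℂ (Space I F K)) = bD k * fD f :=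
  ext_single fun x s p => by by_cases hf : f ∈ s <;> simp [hf]

theorem onIdx_mul_fC (c : I → ℂ) (f : F) :
    (onIdx c * fC f : Module.End ℂ (Space I F K)) = fC f * onIdx c :=
  ext_single fun x s p => by by_cases hf : f ∈ s <;> simp [hf, smul_comm (c x)]

theorem onIdx_mul_fD (c : I → ℂ) (f : F) :
    (onIdx c * fD f : Module.End ℂ (Space I F K)) = fD f * onIdx c :=
  ext_single fun x s p => by by_cases hf : f ∈ s <;> simp [hf, smul_comm (c x)]

theorem parity_mul_fC (f : F) :
    (parity * fC f : Module.End ℂ (Space I F K)) = -(fC f * parity) :=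
  ext_single fun x s p => by
    by_cases hf : f ∈ s <;>
      simp [hf, Finset.card_insert_of_notMem, pow_succ, smul_comm ((-1 : ℂ) ^ s.card)]

theorem parity_mul_fD (f : F) :
    (parity * fD f : Module.End ℂ (Space I F K)) = -(fD f * parity) :=
  ext_single fun x s p => by
    by_cases hf : f ∈ s
    · obtain ⟨n, hn⟩ : ∃ n, s.card = n + 1 := ⟨s.card - 1, by
        have := Finset.card_pos.mpr ⟨f, hf⟩; omega⟩
      simp [hf, Finset.card_erase_of_mem, hn, pow_succ, smul_comm ((-1 : ℂ) ^ n)]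
    · simp [hf]

theorem fC_mul_fD_self (f : F) :
    (fC f * fD f : Module.End ℂ (Space I F K)) = diag fun _ s _ => if f ∈ s then 1 else 0 :=
  ext_monomial fun x s m => by
    by_cases hf : f ∈ s <;>
      simp [hf, sgn_erase, smul_smul, sgn_mul_self, Finset.insert_erase]

end Fock

/-- Strong convergence for the discrete topology: for every vector `v`, the sequence `f M v` is
eventually constant with value `T v`. This is how locally finite sums of operators are handled. -/
def EvLim {V W : Type*} [AddCommGroup V] [Module ℂ V] [AddCommGroup W] [Module ℂ W]
    (f : ℕ → V →ₗ[ℂ] W) (T : V →ₗ[ℂ] W) : Prop :=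
  ∀ v, ∀ᶠ M in Filter.atTop, f M v = T v

namespace EvLim

variable {U V W : Type*} [AddCommGroup U] [Module ℂ U] [AddCommGroup V] [Module ℂ V]
  [AddCommGroup W] [Module ℂ W] {f g : ℕ → V →ₗ[ℂ] W} {S T : V →ₗ[ℂ] W}

theorem const (T : V →ₗ[ℂ] W) : EvLim (fun _ => T) T :=
  fun _ => Filter.Eventually.of_forall fun _ => rfl

theorem unique (h : EvLim f S) (h' : EvLim f T) : S = T := by
  ext v
  obtain ⟨M, h1, h2⟩ := ((h v).and (h' v)).exists
  rw [← h1, h2]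

theorem add (h : EvLim f S) (h' : EvLim g T) : EvLim (fun M => f M + g M) (S + T) := fun v => by
  filter_upwards [h v, h' v] with M h1 h2
  simp [h1, h2]

theorem neg (h : EvLim f S) : EvLim (fun M => -f M) (-S) := fun v => by
  filter_upwards [h v] with M h1
  simp [h1]

theorem smul (c : ℂ) (h : EvLim f S) : EvLim (fun M => c • f M) (c • S) := fun v => by
  filter_upwards [h v] with M h1
  simp [h1]

theorem sum {ι : Type*} (t : Finset ι) {f : ι → ℕ → V →ₗ[ℂ] W} {T : ι → V →ₗ[ℂ] W}
    (h : ∀ i ∈ t, EvLim (f i) (T i)) : EvLim (fun M => ∑ i ∈ t, f i M) (∑ i ∈ t, T i) := fun v => by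
  have : ∀ᶠ M in Filter.atTop, ∀ i ∈ t, f i M v = T i v :=
    (Filter.eventually_all_finset t).mpr fun i hi => h i hi v
  filter_upwards [this] with M h1
  simp only [LinearMap.sum_apply]
  exact Finset.sum_congr rfl h1

theorem comp (h : EvLim f S) {g : ℕ → U →ₗ[ℂ] V} {T : U →ₗ[ℂ] V} (h' : EvLim g T) :
    EvLim (fun M => f M ∘ₗ g M) (S ∘ₗ T) := fun v => by
  filter_upwards [h (T v), h' v] with M h1 h2
  simp [h1, h2]

theorem mul {f g : ℕ → Module.End ℂ V} {S T : Module.End ℂ V} (h : EvLim f S) (h' : EvLim g T) :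
    EvLim (fun M => f M * g M) (S * T) := h.comp h'

theorem congr (h : EvLim f S) (hfg : ∀ M, f M = g M) : EvLim g S := by
  rwa [← funext hfg]

end EvLim

/-! ### Graded brackets -/

/-- The bracket `[X, Y]_s = X Y - s Y X` is `Z`; `s = 1` is the commutator and `s = -1` the
anticommutator. -/
def Bracket {E : Type*} [Ring E] [Algebra ℂ E] (s : ℂ) (X Y Z : E) : Prop :=
  X * Y = s • (Y * X) + Z

namespace Bracket

variable {E : Type*} [Ring E] [Algebra ℂ E] {s t : ℂ} {X X' Y Z Z' : E}

theorem mul_left (h : Bracket s X Y Z) (h' : Bracket t X' Y Z') :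
    Bracket (s * t) (X * X') Y (t • (Z * X') + X * Z') := by
  unfold Bracket at *
  rw [mul_assoc, h', mul_add, mul_smul_comm, ← mul_assoc, h]
  simp only [add_mul, smul_add, smul_mul_assoc, smul_smul, mul_assoc, mul_comm t s, add_assoc]

theorem add_left (h : Bracket s X Y Z) (h' : Bracket s X' Y Z') :
    Bracket s (X + X') Y (Z + Z') := by
  unfold Bracket at *
  rw [add_mul, h, h', mul_add, smul_add]
  abel

theorem smul_left (c : ℂ) (h : Bracket s X Y Z) : Bracket s (c • X) Y (c • Z) := by
  unfold Bracket at *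
  rw [smul_mul_assoc, h, mul_smul_comm, smul_add, smul_comm c s]

theorem smul_right (c : ℂ) (h : Bracket s X Y Z) : Bracket s X (c • Y) (c • Z) := by
  unfold Bracket at *
  rw [smul_mul_assoc, mul_smul_comm, h, smul_add, smul_comm c s]

theorem sum_left {ι : Type*} (u : Finset ι) {X Z : ι → E} (h : ∀ i ∈ u, Bracket s (X i) Y (Z i)) :
    Bracket s (∑ i ∈ u, X i) Y (∑ i ∈ u, Z i) := by
  unfold Bracket at *
  rw [Finset.sum_mul, Finset.mul_sum, Finset.smul_sum, ← Finset.sum_add_distrib]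
  exact Finset.sum_congr rfl h

theorem congr (h : Bracket s X Y Z) (hs : s = t) (hZ : Z = Z') : Bracket t X Y Z' := by
  rw [← hs, ← hZ]; exact h

theorem of_mul_eq (h : X * Y = Y * X) : Bracket 1 X Y 0 := by
  simpa [Bracket] using h

theorem of_mul_eq_neg (h : X * Y = -(Y * X)) : Bracket (-1) X Y 0 := by
  simpa [Bracket] using h

end Bracket

/-! ### The modes of the generating fields -/

@[simp] theorem phiMode_inj {i j : Fin N} {m n : ℕ} :
    phiMode i m = phiMode j n ↔ i = j ∧ m = n := by
  simp [phiMode, Prod.ext_iff]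

@[simp] theorem psiMode_inj {i j : Fin N} {m n : ℕ} :
    psiMode i m = psiMode j n ↔ i = j ∧ m = n := by
  simp [psiMode, Prod.ext_iff]

@[simp] theorem phiMode_ne_psiMode (i j : Fin N) (m n : ℕ) : phiMode i m ≠ psiMode j n := by
  simp [phiMode, psiMode, Prod.ext_iff]

@[simp] theorem psiMode_ne_phiMode (i j : Fin N) (m n : ℕ) : psiMode i m ≠ phiMode j n :=
  (phiMode_ne_psiMode j i n m).symm

theorem fMode_cases (f : FMode N) : (∃ i n, f = phiMode i n) ∨ ∃ i n, f = psiMode i n := by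
  rcases f with ⟨i | i, n⟩
  · exact Or.inl ⟨i, n, rfl⟩
  · exact Or.inr ⟨i, n, rfl⟩

theorem neg_eq_smul {W : Type*} [AddCommGroup W] [Module ℂ W] (T : Module.End ℂ W) :
    -T = (-1 : ℂ) • T := by
  ext v; simp

namespace Gen

theorem coeff_A_nat (i : Fin N) (n : ℕ) :
    (A i).coeff (n : ℤ) = (Fock.bC (Sum.inl i, n) : Module.End ℂ (V N)) := by
  have h : -(n : ℤ) - 1 = Int.negSucc n := by omega
  simp only [coeff, h]; rfl

theorem coeff_B_nat (i : Fin N) (n : ℕ) :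
    (B i).coeff (n : ℤ) = (Fock.bC (Sum.inr i, n) : Module.End ℂ (V N)) := by
  have h : -(n : ℤ) - 1 = Int.negSucc n := by omega
  simp only [coeff, h]; rfl

theorem coeff_Phi_nat (i : Fin N) (n : ℕ) :
    (Phi i).coeff (n : ℤ) = (Fock.fC (phiMode i n) : Module.End ℂ (V N)) := by
  cases n with
  | zero => rfl
  | succ n =>
    have h : -((n + 1 : ℕ) : ℤ) = Int.negSucc n := by omega
    simp only [coeff, h]; rfl

theorem coeff_Psi_nat (i : Fin N) (n : ℕ) :
    (Psi i).coeff (n : ℤ) = (Fock.fC (psiMode i n) : Module.End ℂ (V N)) := by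
  have h : -(n : ℤ) - 1 = Int.negSucc n := by omega
  simp only [coeff, h]; rfl

theorem coeff_A_neg_one (i : Fin N) :
    (A i).coeff (-1) = (Fock.onIdx (fun β => (β.2 i : ℂ)) : Module.End ℂ (V N)) := rfl

theorem coeff_B_neg_one (i : Fin N) :
    (B i).coeff (-1) = (Fock.onIdx (fun β => (β.1 i : ℂ)) : Module.End ℂ (V N)) := rfl

theorem coeff_A_neg (i : Fin N) (n : ℕ) :
    (A i).coeff (-(n : ℤ) - 2) = ((n : ℂ) + 1) • (Fock.bD (Sum.inr i, n) : Module.End ℂ (V N)) := by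
  have h : -(-(n : ℤ) - 2) - 1 = Int.ofNat (n + 1) := by simp; ring
  simp only [coeff, h]; rfl

theorem coeff_B_neg (i : Fin N) (n : ℕ) :
    (B i).coeff (-(n : ℤ) - 2) = ((n : ℂ) + 1) • (Fock.bD (Sum.inl i, n) : Module.End ℂ (V N)) := by
  have h : -(-(n : ℤ) - 2) - 1 = Int.ofNat (n + 1) := by simp; ring
  simp only [coeff, h]; rfl

theorem coeff_Phi_neg (i : Fin N) (n : ℕ) :
    (Phi i).coeff (-(n : ℤ) - 1) = (Fock.fD (psiMode i n) : Module.End ℂ (V N)) := by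
  have h : -(-(n : ℤ) - 1) = Int.ofNat (n + 1) := by simp; ring
  simp only [coeff, h]; rfl

theorem coeff_Psi_neg (i : Fin N) (n : ℕ) :
    (Psi i).coeff (-(n : ℤ) - 1) = (Fock.fD (phiMode i n) : Module.End ℂ (V N)) := by
  have h : -(-(n : ℤ) - 1) - 1 = Int.ofNat n := by simp
  simp only [coeff, h]; rfl

theorem coeff_nat_of_even {g : Gen N} (hg : g.odd = false) (n : ℕ) :
    ∃ k, g.coeff n = Fock.bC k := by
  cases g with
  | A i => exact ⟨_, coeff_A_nat i n⟩
  | B i => exact ⟨_, coeff_B_nat i n⟩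
  | Phi i => simp [odd] at hg
  | Psi i => simp [odd] at hg

theorem coeff_nat_of_odd {g : Gen N} (hg : g.odd = true) (n : ℕ) :
    ∃ f, g.coeff n = Fock.fC f := by
  cases g with
  | A i => simp [odd] at hg
  | B i => simp [odd] at hg
  | Phi i => exact ⟨_, coeff_Phi_nat i n⟩
  | Psi i => exact ⟨_, coeff_Psi_nat i n⟩

theorem coeff_neg_of_even {g : Gen N} (hg : g.odd = false) {e : ℤ} (he : e < 0) :
    (∃ c, g.coeff e = Fock.onIdx c) ∨ ∃ (a : ℂ) (k : _), g.coeff e = a • Fock.bD k := by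
  rcases eq_or_ne e (-1) with rfl | h1
  · left
    cases g with
    | A i => exact ⟨_, coeff_A_neg_one i⟩
    | B i => exact ⟨_, coeff_B_neg_one i⟩
    | Phi i => simp [odd] at hg
    | Psi i => simp [odd] at hg
  · right
    obtain ⟨n, rfl⟩ : ∃ n : ℕ, e = -(n : ℤ) - 2 := ⟨(-e - 2).toNat, by omega⟩
    cases g with
    | A i => exact ⟨_, _, coeff_A_neg i n⟩
    | B i => exact ⟨_, _, coeff_B_neg i n⟩
    | Phi i => simp [odd] at hg
    | Psi i => simp [odd] at hg

theorem coeff_neg_of_odd {g : Gen N} (hg : g.odd = true) {e : ℤ} (he : e < 0) :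
    ∃ f, g.coeff e = Fock.fD f := by
  obtain ⟨n, rfl⟩ : ∃ n : ℕ, e = -(n : ℤ) - 1 := ⟨(-e - 1).toNat, by omega⟩
  cases g with
  | A i => simp [odd] at hg
  | B i => simp [odd] at hg
  | Phi i => exact ⟨_, coeff_Phi_neg i n⟩
  | Psi i => exact ⟨_, coeff_Psi_neg i n⟩

/-- The sign `(-1)^{|g|}`. -/
def sgn (g : Gen N) : ℂ := if g.odd then -1 else 1

/-- The Koszul sign `(-1)^{|g||h|}`. -/
def koszul (g h : Gen N) : ℂ := if g.odd && h.odd then -1 else 1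

theorem koszul_mul_self (g h : Gen N) : koszul g h * koszul g h = 1 := by
  unfold koszul; split_ifs <;> simp

theorem koszul_comm (g h : Gen N) : koszul g h = koszul h g := by
  unfold koszul; rw [Bool.and_comm]

/-- Creation modes supercommute. -/
theorem coeff_nat_mul_coeff_nat (g h : Gen N) (m n : ℕ) :
    g.coeff m * h.coeff n = koszul g h • (h.coeff n * g.coeff m) := by
  unfold koszul
  cases hg : g.odd <;> cases hh : h.odd
  · obtain ⟨k, hk⟩ := coeff_nat_of_even hg m
    obtain ⟨l, hl⟩ := coeff_nat_of_even hh n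
    simp [hk, hl, Fock.bC_mul_bC k l]
  · obtain ⟨k, hk⟩ := coeff_nat_of_even hg m
    obtain ⟨l, hl⟩ := coeff_nat_of_odd hh n
    simp [hk, hl, Fock.fC_mul_bC]
  · obtain ⟨k, hk⟩ := coeff_nat_of_odd hg m
    obtain ⟨l, hl⟩ := coeff_nat_of_even hh n
    simp [hk, hl, Fock.fC_mul_bC]
  · obtain ⟨k, hk⟩ := coeff_nat_of_odd hg m
    obtain ⟨l, hl⟩ := coeff_nat_of_odd hh n
    rw [hk, hl, Fock.fC_mul_fC k l]
    exact neg_eq_smul _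

/-- Annihilation modes and zero modes supercommute. -/
theorem coeff_neg_mul_coeff_neg (g h : Gen N) {d e : ℤ} (hd : d < 0) (he : e < 0) :
    g.coeff d * h.coeff e = koszul g h • (h.coeff e * g.coeff d) := by
  unfold koszul
  cases hg : g.odd <;> cases hh : h.odd
  · obtain ⟨c, hk⟩ | ⟨a, k, hk⟩ := coeff_neg_of_even hg hd <;>
    obtain ⟨c', hl⟩ | ⟨b, l, hl⟩ := coeff_neg_of_even hh he
    · simp [hk, hl, Fock.onIdx_mul, mul_comm]
    · simp [hk, hl, Fock.onIdx_mul_bD]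
    · simp [hk, hl, Fock.onIdx_mul_bD]
    · simp [hk, hl, Fock.bD_mul_bD k l, smul_smul, mul_comm]
  · obtain ⟨l, hl⟩ := coeff_neg_of_odd hh he
    obtain ⟨c, hk⟩ | ⟨a, k, hk⟩ := coeff_neg_of_even hg hd
    · simp [hk, hl, Fock.onIdx_mul_fD]
    · simp [hk, hl, Fock.fD_mul_bD]
  · obtain ⟨l, hl⟩ := coeff_neg_of_odd hg hd
    obtain ⟨c, hk⟩ | ⟨a, k, hk⟩ := coeff_neg_of_even hh he
    · simp [hk, hl, Fock.onIdx_mul_fD]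
    · simp [hk, hl, Fock.fD_mul_bD]
  · obtain ⟨k, hk⟩ := coeff_neg_of_odd hg hd
    obtain ⟨l, hl⟩ := coeff_neg_of_odd hh he
    rw [hk, hl, Fock.fD_mul_fD k l]
    exact neg_eq_smul _

/-- The twist `γ^{|g|}` by the parity operator `γ` that appears when a mode of `g` is moved past a
vector. -/
def twist (g : Gen N) : Module.End ℂ (V N) := if g.odd then Fock.parity else 1

theorem parity_mul_coeff (g : Gen N) (e : ℤ) :
    Fock.parity * g.coeff e = g.sgn • (g.coeff e * Fock.parity) := by
  unfold sgn
  rcases lt_or_ge e 0 with he | he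
  · cases hg : g.odd
    · obtain ⟨c, hk⟩ | ⟨a, k, hk⟩ := coeff_neg_of_even hg he
      · simp [hk, Fock.parity_mul_onIdx]
      · simp [hk, Fock.parity_mul_bD]
    · obtain ⟨k, hk⟩ := coeff_neg_of_odd hg he
      rw [hk, Fock.parity_mul_fD]
      exact neg_eq_smul _
  · obtain ⟨n, rfl⟩ := Int.eq_ofNat_of_zero_le he
    cases hg : g.odd
    · obtain ⟨k, hk⟩ := coeff_nat_of_even hg n
      simp [hk, Fock.parity_mul_bC]
    · obtain ⟨k, hk⟩ := coeff_nat_of_odd hg n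
      rw [hk, Fock.parity_mul_fC]
      exact neg_eq_smul _

theorem coeff_mul_onIdx (g : Gen N) (e : ℤ) (c : Lat N → ℂ) :
    Fock.onIdx c * g.coeff e = g.coeff e * Fock.onIdx c := by
  rcases lt_or_ge e 0 with he | he
  · cases hg : g.odd
    · obtain ⟨c', hk⟩ | ⟨a, k, hk⟩ := coeff_neg_of_even hg he
      · simp [hk, Fock.onIdx_mul, mul_comm]
      · simp [hk, Fock.onIdx_mul_bD]
    · obtain ⟨k, hk⟩ := coeff_neg_of_odd hg he
      simp [hk, Fock.onIdx_mul_fD]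
  · obtain ⟨n, rfl⟩ := Int.eq_ofNat_of_zero_le he
    cases hg : g.odd
    · obtain ⟨k, hk⟩ := coeff_nat_of_even hg n
      simp [hk, Fock.onIdx_mul_bC]
    · obtain ⟨k, hk⟩ := coeff_nat_of_odd hg n
      simp [hk, Fock.onIdx_mul_fC]

end Gen

theorem coeff_bLetter (k : BMode N) :
    (bLetter k).1.coeff ((bLetter k).2 : ℤ) = (Fock.bC k : Module.End ℂ (V N)) := by
  obtain ⟨i | i, n⟩ := k
  · exact Gen.coeff_A_nat i n
  · exact Gen.coeff_B_nat i n

theorem coeff_fLetter (f : FMode N) :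
    (fLetter f).1.coeff ((fLetter f).2 : ℤ) = (Fock.fC f : Module.End ℂ (V N)) := by
  obtain ⟨i, n, rfl⟩ | ⟨i, n, rfl⟩ := fMode_cases f
  · exact Gen.coeff_Phi_nat i n
  · exact Gen.coeff_Psi_nat i n

theorem odd_bLetter (k : BMode N) : (bLetter k).1.odd = false := by
  obtain ⟨i | i, n⟩ := k <;> rfl

theorem odd_fLetter (f : FMode N) : (fLetter f).1.odd = true := by
  obtain ⟨i, n, rfl⟩ | ⟨i, n, rfl⟩ := fMode_cases f <;> rfl

theorem letter_cases (g : Gen N) (n : ℕ) :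
    (∃ k, (g, n) = bLetter k) ∨ ∃ f, (g, n) = fLetter f := by
  cases g with
  | A i => exact Or.inl ⟨(Sum.inl i, n), rfl⟩
  | B i => exact Or.inl ⟨(Sum.inr i, n), rfl⟩
  | Phi i => exact Or.inr ⟨phiMode i n, rfl⟩
  | Psi i => exact Or.inr ⟨psiMode i n, rfl⟩

/-- `V_L` is generated from the vectors `e^α` by the creation modes. -/
theorem V_induction {p : V N → Prop} (hexp : ∀ α, p (expVec α))
    (hadd : ∀ v w, p v → p w → p (v + w)) (hsmul : ∀ (c : ℂ) v, p v → p (c • v))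
    (hcoeff : ∀ (g : Gen N) (n : ℕ) v, p v → p (g.coeff n v)) (v : V N) : p v := by
  have h0 : p 0 := by simpa using hsmul 0 _ (hexp 0)
  induction v using Finsupp.induction_linear with
  | zero => exact h0
  | add f g hf hg => exact hadd f g hf hg
  | single x a =>
    obtain ⟨α, s⟩ := x
    induction a using MvPolynomial.induction_on with
    | add a b ha hb => rw [Finsupp.single_add]; exact hadd _ _ ha hb
    | mul_X a k ha =>
      have h := hcoeff (bLetter k).1 (bLetter k).2 _ ha
      rwa [coeff_bLetter, Fock.bC_single, mul_comm] at h
    | C c =>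
      have h1 : (Finsupp.single (α, s) (C c) : V N) = c • Finsupp.single (α, s) 1 := by
        rw [Finsupp.smul_single, smul_eq_C_mul, mul_one]
      rw [h1]
      apply hsmul
      clear h1
      induction s using Finset.induction_on with
      | empty => exact hexp α
      | insert f s hf hs =>
        have h := hsmul (Fock.sgn f s) _ (hcoeff (fLetter f).1 (fLetter f).2 _ hs)
        rwa [coeff_fLetter, Fock.fC_single, if_neg hf, smul_smul, Fock.sgn_mul_self,
          one_smul] at h

/-! ### Translation-equivariant operators on Laurent polynomials -/

/-- The `ℂ[z, z⁻¹]`-linear extension of an operator on `V` to `V[z, z⁻¹]`. -/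
def lift (T : Module.End ℂ (V N)) : Module.End ℂ (LPoly N) := Finsupp.mapRange.linearMap T

@[simp] theorem lift_single (T : Module.End ℂ (V N)) (d : ℤ) (v : V N) :
    lift T (Finsupp.single d v) = Finsupp.single d (T v) := by
  simp [lift, Finsupp.mapRange.linearMap_apply]

@[simp] theorem lift_apply (T : Module.End ℂ (V N)) (l : LPoly N) (e : ℤ) :
    lift T l e = T (l e) := by
  simp [lift, Finsupp.mapRange.linearMap_apply]

/-- The operator `R` on `V[z, z⁻¹]` is `∑ₖ Tₖ zᵏ`. -/
def IsSeries (R : Module.End ℂ (LPoly N)) (T : ℤ → Module.End ℂ (V N)) : Prop :=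
  ∀ d v e, R (Finsupp.single d v) e = T (e - d) v

/-- The partial sums of `∑ₖ Tₖ zᵏ`. -/
def partialSeries (T : ℤ → Module.End ℂ (V N)) (M : ℕ) : Module.End ℂ (LPoly N) :=
  ∑ k ∈ Finset.Icc (-(M : ℤ)) M, Finsupp.lmapDomain (V N) ℂ (fun d => d + k) * lift (T k)

theorem partialSeries_single (T : ℤ → Module.End ℂ (V N)) (M : ℕ) (d : ℤ) (v : V N) :
    partialSeries T M (Finsupp.single d v) =
      ∑ k ∈ Finset.Icc (-(M : ℤ)) M, Finsupp.single (d + k) (T k v) := by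
  simp [partialSeries, Finsupp.mapDomain_single]

theorem LPoly.ext_single {W : Type*} [AddCommMonoid W] [Module ℂ W] {S T : LPoly N →ₗ[ℂ] W}
    (h : ∀ d v, S (Finsupp.single d v) = T (Finsupp.single d v)) : S = T :=
  Finsupp.lhom_ext h

theorem eventually_mem_Icc (t : Finset ℤ) :
    ∀ᶠ M : ℕ in Filter.atTop, ∀ k ∈ t, k ∈ Finset.Icc (-(M : ℤ)) M := by
  refine (Filter.eventually_all_finset t).mpr fun k _ => ?_
  filter_upwards [Filter.eventually_ge_atTop k.natAbs] with M hM
  rw [Finset.mem_Icc]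
  omega

theorem IsSeries.evLim {R : Module.End ℂ (LPoly N)} {T : ℤ → Module.End ℂ (V N)}
    (h : IsSeries R T) :
    EvLim (V := LPoly N) (W := LPoly N) (partialSeries T) R := by
  intro l
  induction l using Finsupp.induction_linear with
  | zero => simp
  | add f g hf hg =>
    filter_upwards [hf, hg] with M h1 h2
    rw [map_add, map_add, h1, h2]
  | single d v =>
    filter_upwards [eventually_mem_Icc (R (Finsupp.single 0 v)).support] with M hM
    ext1 e
    rw [partialSeries_single, Finsupp.finsetSum_apply, h]
    by_cases hk : e - d ∈ Finset.Icc (-(M : ℤ)) M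
    · rw [Finset.sum_eq_single_of_mem _ hk]
      · rw [show d + (e - d) = e by ring, Finsupp.single_eq_same]
      · intro k _ hne
        rw [Finsupp.single_eq_of_ne]
        intro h'; apply hne; omega
    · have h1 : T (e - d) v = 0 := by
        have h2 := h 0 v (e - d)
        rw [sub_zero] at h2
        rw [← h2]
        by_contra hne
        exact hk (hM _ (Finsupp.mem_support_iff.mpr hne))
      rw [h1]
      refine Finset.sum_eq_zero fun k hk' => Finsupp.single_eq_of_ne ?_
      intro h'
      apply hk
      rwa [show e - d = k by omega]

theorem IsSeries.ext {R R' : Module.End ℂ (LPoly N)} {T : ℤ → Module.End ℂ (V N)}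
    (h : IsSeries R T) (h' : IsSeries R' T) : R = R' :=
  LPoly.ext_single fun d v => Finsupp.ext fun e => by rw [h, h']

/-- Two operators on `V[z, z⁻¹]` supercommute if their coefficients do. -/
theorem IsSeries.mul_comm {R R' : Module.End ℂ (LPoly N)} {T T' : ℤ → Module.End ℂ (V N)}
    (h : IsSeries R T) (h' : IsSeries R' T') (s : ℂ)
    (hTT' : ∀ j k, T j * T' k = s • (T' k * T j)) : R * R' = s • (R' * R) := by
  refine EvLim.unique (h.evLim.mul h'.evLim) (((h'.evLim.mul h.evLim).smul s).congr fun M => ?_)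
  refine LPoly.ext_single fun d v => ?_
  simp only [LinearMap.smul_apply, Module.End.mul_apply, partialSeries_single, map_sum,
    Finset.smul_sum]
  rw [Finset.sum_comm]
  refine Finset.sum_congr rfl fun k _ => Finset.sum_congr rfl fun j _ => ?_
  rw [add_right_comm, Finsupp.smul_single]
  congr 1
  have h1 := LinearMap.congr_fun (hTT' j k) v
  simp only [LinearMap.smul_apply, Module.End.mul_apply] at h1
  exact h1.symm

theorem isSeries_lift_mul {R : Module.End ℂ (LPoly N)} {T : ℤ → Module.End ℂ (V N)}
    (h : IsSeries R T) (X : Module.End ℂ (V N)) : IsSeries (lift X * R) fun k => X * T k :=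
  fun d v e => by simp [h d v e]

theorem isSeries_mul_lift {R : Module.End ℂ (LPoly N)} {T : ℤ → Module.End ℂ (V N)}
    (h : IsSeries R T) (X : Module.End ℂ (V N)) : IsSeries (R * lift X) fun k => T k * X :=
  fun d v e => by simp [h d (X v) e]

theorem IsSeries.add {R R' : Module.End ℂ (LPoly N)} {T T' : ℤ → Module.End ℂ (V N)}
    (h : IsSeries R T) (h' : IsSeries R' T') : IsSeries (R + R') fun k => T k + T' k :=
  fun d v e => by simp [h d v e, h' d v e]

theorem IsSeries.smul {R : Module.End ℂ (LPoly N)} {T : ℤ → Module.End ℂ (V N)}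
    (h : IsSeries R T) (c : ℂ) : IsSeries (c • R) fun k => c • T k :=
  fun d v e => by simp [h d v e]

/-- The coefficient of `zᵏ` in the annihilation part of `∂ⁿg(z) / n!`. -/
def annihCoeff (g : Gen N) (n : ℕ) (k : ℤ) : Module.End ℂ (V N) :=
  if k + n < 0 then ((Ring.choose (k + n) n : ℤ) : ℂ) • g.coeff (k + n) else 0

theorem isSeries_annihilationPart (g : Gen N) (n : ℕ) :
    IsSeries (annihilationPart g n) (annihCoeff g n) := by
  intro d v e
  have h1 : Function.Injective fun k : ℤ => d + k - n := fun a b hab => by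
    simp only at hab; omega
  have h2 : e = (fun k : ℤ => d + k - n) (e - d + n) := by simp only; ring
  rw [annihilationPart, Finsupp.lsum_single, LinearMap.comp_apply, Finsupp.lmapDomain_apply]
  conv_lhs => rw [h2]
  rw [Finsupp.mapDomain_apply h1, annihCoeff]
  change (if _ then _ else _) = _
  split_ifs <;> rfl

/-! ### Products of creation parts with Laurent polynomials -/

theorem cauchy_single (C : PowerSeries (Module.End ℂ (V N))) (d : ℤ) (v : V N) (e : ℤ) :
    cauchy C (Finsupp.single d v) e =
      if d ≤ e then PowerSeries.coeff (e - d).toNat C v else 0 := by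
  simp only [cauchy, Finsupp.lsum_single, LinearMap.pi_apply]
  split_ifs <;> rfl

theorem cauchy_add (C C' : PowerSeries (Module.End ℂ (V N))) :
    cauchy (C + C') = cauchy C + cauchy C' :=
  LPoly.ext_single fun d v => funext fun e => by
    simp only [LinearMap.add_apply, Pi.add_apply, cauchy_single, map_add]
    split_ifs <;> simp

theorem coeff_smul (k : ℕ) (c : ℂ) (f : PowerSeries (Module.End ℂ (V N))) :
    PowerSeries.coeff k (c • f) = c • PowerSeries.coeff k f := rfl

theorem cauchy_smul (c : ℂ) (C : PowerSeries (Module.End ℂ (V N))) :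
    cauchy (c • C) = c • cauchy C :=
  LPoly.ext_single fun d v => funext fun e => by
    simp only [LinearMap.smul_apply, Pi.smul_apply, cauchy_single]
    split_ifs <;> simp

theorem cauchy_mul_C (C : PowerSeries (Module.End ℂ (V N))) (X : Module.End ℂ (V N)) :
    cauchy (C * PowerSeries.C X) = cauchy C ∘ₗ lift X :=
  LPoly.ext_single fun d v => funext fun e => by
    simp only [LinearMap.comp_apply, lift_single, cauchy_single, PowerSeries.coeff_mul_C,
      Module.End.mul_apply]

theorem apply_cauchy (C : PowerSeries (Module.End ℂ (V N))) (X : Module.End ℂ (V N)) (l : LPoly N)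
    (e : ℤ) : X (cauchy C l e) = cauchy (PowerSeries.C X * C) l e := by
  induction l using Finsupp.induction_linear with
  | zero => simp
  | add f g hf hg => simp [hf, hg]
  | single d v =>
    simp only [cauchy_single, PowerSeries.coeff_C_mul]
    split_ifs <;> simp

/-! ### Normally ordered products -/

section NormalOrdered

variable (R : Module.End ℂ (LPoly N))

theorem normalOrdered_add (l : List (Gen N × ℕ)) (C C' : PowerSeries (Module.End ℂ (V N))) :
    normalOrdered R l (C + C') = normalOrdered R l C + normalOrdered R l C' := by
  induction l generalizing C C' with
  | nil => simp [normalOrdered, cauchy_add, LinearMap.add_comp]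
  | cons x l ih =>
    simp only [normalOrdered, add_mul, ih, LinearMap.add_comp, smul_add]
    abel

theorem normalOrdered_smul (l : List (Gen N × ℕ)) (c : ℂ)
    (C : PowerSeries (Module.End ℂ (V N))) :
    normalOrdered R l (c • C) = c • normalOrdered R l C := by
  induction l generalizing C with
  | nil => simp [normalOrdered, cauchy_smul, LinearMap.smul_comp]
  | cons x l ih =>
    simp only [normalOrdered, smul_mul_assoc, ih, LinearMap.smul_comp, smul_add]
    rw [smul_comm c]

theorem creationPart_mul_creationPart (g h : Gen N) (m n : ℕ) :
    creationPart g m * creationPart h n =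
      Gen.koszul g h • (creationPart h n * creationPart g m) := by
  ext1 k
  rw [coeff_smul, PowerSeries.coeff_mul, PowerSeries.coeff_mul, Finset.smul_sum,
    ← Finset.sum_equiv (Equiv.prodComm ℕ ℕ) (s := Finset.HasAntidiagonal.antidiagonal k)
      (t := Finset.HasAntidiagonal.antidiagonal k) (by simp [add_comm]) (fun _ _ => rfl)]
  refine Finset.sum_congr rfl fun x _ => ?_
  simp only [creationPart, PowerSeries.coeff_mk, Equiv.prodComm_apply, Prod.fst_swap,
    Prod.snd_swap, smul_mul_smul_comm]
  rw [Gen.coeff_nat_mul_coeff_nat, smul_comm, mul_comm]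

theorem annihilationPart_mul_annihilationPart (g h : Gen N) (m n : ℕ) :
    annihilationPart g m * annihilationPart h n =
      Gen.koszul g h • (annihilationPart h n * annihilationPart g m) := by
  refine (isSeries_annihilationPart g m).mul_comm (isSeries_annihilationPart h n) _ fun j k => ?_
  unfold annihCoeff
  by_cases hj : j + m < 0 <;> by_cases hk : k + n < 0 <;> simp only [hj, hk, if_true, if_false,
    mul_zero, zero_mul, smul_zero]
  rw [smul_mul_smul_comm, smul_mul_smul_comm, Gen.coeff_neg_mul_coeff_neg g h hj hk, smul_comm,
    mul_comm]

theorem moveSign_cons (g h : Gen N) (n : ℕ) (l : List (Gen N × ℕ)) :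
    moveSign g ((h, n) :: l) = Gen.koszul g h * moveSign g l := by
  unfold moveSign Gen.koszul
  cases hg : g.odd <;> cases hh : h.odd <;> simp [hh, pow_succ]

theorem normalOrdered_cons_apply (g : Gen N) (n : ℕ) (l : List (Gen N × ℕ))
    (C : PowerSeries (Module.End ℂ (V N))) (x : LPoly N) :
    normalOrdered R ((g, n) :: l) C x = normalOrdered R l (C * creationPart g n) x +
      moveSign g l • normalOrdered R l C (annihilationPart g n x) := rfl

/-- Neighbouring factors of a normally ordered product supercommute. -/
theorem normalOrdered_swap (g h : Gen N) (m n : ℕ) (l : List (Gen N × ℕ))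
    (C : PowerSeries (Module.End ℂ (V N))) :
    normalOrdered R ((g, m) :: (h, n) :: l) C =
      Gen.koszul g h • normalOrdered R ((h, n) :: (g, m) :: l) C := by
  refine LinearMap.ext fun x => ?_
  have h1 := LinearMap.congr_fun (annihilationPart_mul_annihilationPart h g n m) x
  simp only [Module.End.mul_apply, LinearMap.smul_apply] at h1
  have h2 := LinearMap.congr_fun (normalOrdered_smul R l (Gen.koszul g h)
    (C * (creationPart h n * creationPart g m))) x
  rw [← mul_smul_comm, ← creationPart_mul_creationPart] at h2
  simp only [normalOrdered_cons_apply, LinearMap.smul_apply, mul_assoc] at h2 ⊢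
  rw [h2, h1, map_smul, moveSign_cons, moveSign_cons, Gen.koszul_comm h g]
  have h3 := Gen.koszul_mul_self g h
  match_scalars
  all_goals first | ring1 | linear_combination (-moveSign h l) * h3

theorem moveSign_perm (g : Gen N) {l l' : List (Gen N × ℕ)} (h : l.Perm l') :
    moveSign g l = moveSign g l' := by
  unfold moveSign
  rw [(h.filter _).length_eq]

theorem normalOrdered_cons_congr {l l' : List (Gen N × ℕ)} (c : ℂ) (hp : l.Perm l')
    (h : ∀ C, normalOrdered R l C = c • normalOrdered R l' C) (x : Gen N × ℕ)
    (C : PowerSeries (Module.End ℂ (V N))) :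
    normalOrdered R (x :: l) C = c • normalOrdered R (x :: l') C := by
  simp only [normalOrdered, h, moveSign_perm x.1 hp, LinearMap.smul_comp, smul_add]
  rw [smul_comm c]

theorem normalOrdered_even_perm {l l' : List (Gen N × ℕ)} (hp : l.Perm l')
    (h : ∀ x ∈ l, x.1.odd = false) (C : PowerSeries (Module.End ℂ (V N))) :
    normalOrdered R l C = normalOrdered R l' C := by
  induction hp generalizing C with
  | nil => rfl
  | @cons x l l' hp ih =>
    have h1 := normalOrdered_cons_congr R 1 hp (fun C => by
      rw [one_smul]; exact ih (fun y hy => h y (List.mem_cons_of_mem _ hy)) C) x C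
    rwa [one_smul] at h1
  | swap x y l =>
    have hx : x.1.odd = false := h x (by simp)
    rw [normalOrdered_swap R y.1 x.1 y.2 x.2 l C, Gen.koszul, hx]
    simp
  | trans h1 h2 ih1 ih2 =>
    rw [ih1 h, ih2 fun x hx => h x (h1.mem_iff.mpr hx)]

theorem normalOrdered_append_congr (l₀ : List (Gen N × ℕ)) {l l' : List (Gen N × ℕ)} (c : ℂ)
    (hp : l.Perm l') (h : ∀ C, normalOrdered R l C = c • normalOrdered R l' C)
    (C : PowerSeries (Module.End ℂ (V N))) :
    normalOrdered R (l₀ ++ l) C = c • normalOrdered R (l₀ ++ l') C := by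
  induction l₀ generalizing C with
  | nil => exact h C
  | cons x l₀ ih => exact normalOrdered_cons_congr R c (hp.append_left l₀) ih x C

/-- An even factor can be moved to the front. -/
theorem normalOrdered_even_middle (l₀ l : List (Gen N × ℕ)) (x : Gen N × ℕ)
    (hx : x.1.odd = false) (C : PowerSeries (Module.End ℂ (V N))) :
    normalOrdered R (l₀ ++ x :: l) C = normalOrdered R (x :: (l₀ ++ l)) C := by
  induction l₀ generalizing C with
  | nil => rfl
  | cons y l₀ ih =>
    have h1 := normalOrdered_cons_congr R 1 List.perm_middle (fun C => by
      rw [one_smul]; exact ih C) y C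
    rw [List.cons_append, h1, one_smul, normalOrdered_swap R y.1 x.1 y.2 x.2, Gen.koszul, hx]
    simp

/-- A normally ordered product with a repeated odd factor vanishes. -/
theorem normalOrdered_odd_repeat (l : List (Gen N × ℕ)) (x : Gen N × ℕ) (hx : x.1.odd = true)
    (hl : x ∈ l) (C : PowerSeries (Module.End ℂ (V N))) : normalOrdered R (x :: l) C = 0 := by
  induction l generalizing C with
  | nil => simp at hl
  | cons y l ih =>
    rcases eq_or_ne x y with rfl | hne
    · have h1 := normalOrdered_swap R x.1 x.1 x.2 x.2 l C
      simp only [Gen.koszul, hx, Bool.and_self, if_true] at h1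
      have h2 : (2 : ℂ) • normalOrdered R (x :: x :: l) C = 0 := by
        rw [two_smul]
        nth_rewrite 2 [h1]
        rw [← one_smul ℂ (normalOrdered R (x :: x :: l) C), smul_smul, ← add_smul]
        norm_num
      exact (smul_eq_zero.mp h2).resolve_left two_ne_zero
    · have hl' : x ∈ l := by simpa [hne] using hl
      have h1 := normalOrdered_cons_congr R 0 (List.Perm.refl _) (l := x :: l) (fun C => by
        rw [ih hl', zero_smul]) y C
      rw [normalOrdered_swap R x.1 y.1 x.2 y.2 l C, h1, zero_smul, smul_zero]

end NormalOrdered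

/-! ### Exponentials of power series -/

section PowerSeries

theorem commute_of_coeff {E : Type*} [Ring E] {f g : PowerSeries E}
    (h : ∀ i j, Commute (PowerSeries.coeff i f) (PowerSeries.coeff j g)) : Commute f g := by
  refine PowerSeries.ext fun k => ?_
  rw [PowerSeries.coeff_mul, PowerSeries.coeff_mul,
    Finset.sum_equiv (Equiv.prodComm ℕ ℕ) (s := Finset.HasAntidiagonal.antidiagonal k)
      (t := Finset.HasAntidiagonal.antidiagonal k) (by simp [add_comm])
      (g := fun x => PowerSeries.coeff x.1 g * PowerSeries.coeff x.2 f)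
      (fun x _ => (h x.1 x.2).eq)]

theorem commute_C_iff {E : Type*} [Ring E] {f : PowerSeries E} {X : E} :
    Commute (PowerSeries.C X) f ↔ ∀ k, Commute X (PowerSeries.coeff k f) := by
  simp only [Commute, SemiconjBy, PowerSeries.ext_iff, PowerSeries.coeff_C_mul,
    PowerSeries.coeff_mul_C]

theorem commute_sum_smul {W : Type*} [AddCommGroup W] [Module ℂ W] {ι : Type*} (t : Finset ι)
    {X : Module.End ℂ W} {Y Z : ι → Module.End ℂ W} (a b : ι → ℂ)
    (hY : ∀ i, Commute X (Y i)) (hZ : ∀ i, Commute X (Z i)) :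
    Commute X (∑ i ∈ t, (a i • Y i + b i • Z i)) :=
  Commute.sum_right _ _ _ fun i _ => ((hY i).smul_right _).add_right ((hZ i).smul_right _)

theorem commute_smul {W : Type*} [AddCommGroup W] [Module ℂ W] {X Y : Module.End ℂ W} (a : ℂ)
    (h : Commute X Y) :
    Commute X (a • Y) := h.smul_right a

theorem commute_coeff_psExp {W : Type*} [AddCommGroup W] [Module ℂ W]
    {f : PowerSeries (Module.End ℂ W)} {X : Module.End ℂ W}
    (h : ∀ k, Commute X (PowerSeries.coeff k f)) (k : ℕ) :
    Commute X (PowerSeries.coeff k (psExp f)) := by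
  rw [psExp, PowerSeries.coeff_mk]
  refine Commute.sum_right _ _ _ fun r _ => commute_smul _ ?_
  exact commute_C_iff.mp ((commute_C_iff.mpr h).pow_right r) k

end PowerSeries

theorem mode_neg (g : Gen N) (hg : g.odd = false) (m : ℕ) :
    g.mode (-((m + 1 : ℕ) : ℤ)) = g.coeff m := by
  have h : -((m + 1 : ℕ) : ℤ) = -(m : ℤ) - 1 := by push_cast; ring
  rw [h]
  cases g with
  | A i => rfl
  | B i => rfl
  | Phi i => simp [Gen.odd] at hg
  | Psi i => simp [Gen.odd] at hg

/-- `α_{-m-1}` is multiplication by a linear form. -/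
theorem heis_neg (α : Lat N) (m : ℕ) :
    heis α (-((m + 1 : ℕ) : ℤ)) = ∑ i, ((α.1 i : ℂ) • Fock.bC (Sum.inl i, m) +
      (α.2 i : ℂ) • (Fock.bC (Sum.inr i, m) : Module.End ℂ (V N))) := by
  unfold heis
  refine Finset.sum_congr rfl fun i _ => ?_
  rw [mode_neg _ rfl, mode_neg _ rfl, Gen.coeff_A_nat, Gen.coeff_B_nat]

/-- The exponent of the creation part of `e^α(z)`. -/
def expArg (α : Lat N) : PowerSeries (Module.End ℂ (V N)) :=
  PowerSeries.mk fun m => if m = 0 then 0 else ((m : ℂ)⁻¹) • heis α (-(m : ℤ))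

theorem commute_coeff_expArg (α : Lat N) {X : Module.End ℂ (V N)}
    (h : ∀ k, Commute X (Fock.bC k)) (m : ℕ) : Commute X (PowerSeries.coeff m (expArg α)) := by
  rw [expArg, PowerSeries.coeff_mk]
  split_ifs with hm
  · exact Commute.zero_right _
  · obtain ⟨n, rfl⟩ := Nat.exists_eq_succ_of_ne_zero hm
    rw [Nat.succ_eq_add_one, heis_neg]
    exact commute_smul _ (commute_sum_smul _ _ _ (fun i => h _) (fun i => h _))

theorem expCreation_eq (α : Lat N) : expCreation α = psExp (expArg α) := rfl

theorem commute_coeff_expCreation (α : Lat N) {X : Module.End ℂ (V N)}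
    (h : ∀ k, Commute X (Fock.bC k)) (m : ℕ) :
    Commute X (PowerSeries.coeff m (expCreation α)) := by
  rw [expCreation_eq]
  exact commute_coeff_psExp (commute_coeff_expArg α h) m

theorem commute_coeff_nat_bC (g : Gen N) (n : ℕ) (k : BMode N) :
    Commute (g.coeff n) (Fock.bC k) := by
  have h := Gen.coeff_nat_mul_coeff_nat g (bLetter k).1 n (bLetter k).2
  rw [Gen.koszul, odd_bLetter, Bool.and_false, if_neg Bool.false_ne_true, one_smul,
    coeff_bLetter] at h
  exact h

theorem creationPart_mul_expCreation (g : Gen N) (n : ℕ) (α : Lat N) :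
    creationPart g n * expCreation α = expCreation α * creationPart g n :=
  commute_of_coeff (E := Module.End ℂ (V N)) fun i j => by
    rw [creationPart, PowerSeries.coeff_mk]
    exact (commute_smul _ (commute_coeff_expCreation α (commute_coeff_nat_bC g _) j).symm).symm

/-! ### The field of a state with one more factor -/

/-- Inserting an odd factor at its place in the sorted list costs the sign of moving it past the
smaller factors: the fields of odd factors anticommute in a normally ordered product. -/
theorem normalOrdered_map_orderedInsert (R : Module.End ℂ (LPoly N)) (f : FMode N)
    (s : List (FMode N)) (hf : f ∉ s) (t : List (Gen N × ℕ)) (hs : s.Pairwise (· ≤ ·))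
    (C : PowerSeries (Module.End ℂ (V N))) :
    normalOrdered R ((s.orderedInsert (· ≤ ·) f).map fLetter ++ t) C =
      (-1 : ℂ) ^ (s.filter (· < f)).length •
        normalOrdered R (fLetter f :: (s.map fLetter ++ t)) C := by
  induction s generalizing C with
  | nil => simp
  | cons g s ih =>
    have hne : f ≠ g := fun h => hf (by simp [h])
    rw [List.pairwise_cons] at hs
    rw [List.orderedInsert_cons]
    split_ifs with h
    · have h1 : (g :: s).filter (· < f) = [] := by
        rw [List.filter_eq_nil_iff]
        intro a ha
        rw [decide_eq_true_eq, not_lt]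
        rcases List.mem_cons.mp ha with rfl | ha
        · exact h
        · exact h.trans (hs.1 a ha)
      simp [h1]
    · have h1 : g < f := lt_of_not_ge h
      have hp : ((s.orderedInsert (· ≤ ·) f).map fLetter ++ t).Perm
          (fLetter f :: (s.map fLetter ++ t)) :=
        ((List.perm_orderedInsert (· ≤ ·) f s).map fLetter).append_right t
      have h2 := normalOrdered_cons_congr R _ hp
        (fun C => ih (fun h' => hf (List.mem_cons_of_mem _ h')) hs.2 C) (fLetter g) C
      have h3 := normalOrdered_swap R (fLetter g).1 (fLetter f).1 (fLetter g).2 (fLetter f).2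
        (s.map fLetter ++ t) C
      rw [List.map_cons, List.cons_append, h2, List.filter_cons_of_pos (by simpa using h1)]
      simp only [Prod.mk.eta] at h3
      rw [h3, smul_smul]
      simp [Gen.koszul, odd_fLetter, pow_succ]

theorem sort_insert [DecidableEq (FMode N)] {f : FMode N} {s : Finset (FMode N)} (hf : f ∉ s) :
    (insert f s).sort = s.sort.orderedInsert (· ≤ ·) f := by
  apply List.Perm.eq_of_pairwise (le := (· ≤ ·))
  · intro a b _ _; exact le_antisymm
  · exact Finset.pairwise_sort _ _
  · exact (Finset.pairwise_sort s (· ≤ ·)).orderedInsert _ _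
  · refine List.Perm.trans ?_ (List.perm_orderedInsert (· ≤ ·) f s.sort).symm
    rw [List.perm_ext_iff_of_nodup (Finset.sort_nodup _ _)]
    · intro a; simp
    · simp [hf, Finset.sort_nodup]

theorem word_insert [DecidableEq (FMode N)] (R : Module.End ℂ (LPoly N)) {f : FMode N}
    {s : Finset (FMode N)} (hf : f ∉ s)
    (m : BMode N →₀ ℕ) (C : PowerSeries (Module.End ℂ (V N))) :
    normalOrdered R (word (insert f s) m) C =
      Fock.sgn f s • normalOrdered R (fLetter f :: word s m) C := by
  unfold word
  rw [sort_insert hf, normalOrdered_map_orderedInsert R f _ (by simpa using hf) _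
    (Finset.pairwise_sort _ _)]
  congr 2
  have h1 : (s.filter (· < f)).card = (s.sort.filter (· < f)).length := by
    rw [← List.toFinset_card_of_nodup ((Finset.sort_nodup s _).filter _)]
    congr 1
    ext a; simp
  rw [h1]

theorem word_add_single (R : Module.End ℂ (LPoly N)) (s : Finset (FMode N)) (k : BMode N)
    (m : BMode N →₀ ℕ) (C : PowerSeries (Module.End ℂ (V N))) :
    normalOrdered R (word s (m + Finsupp.single k 1)) C =
      normalOrdered R (bLetter k :: word s m) C := by
  have hp : ((Finsupp.toMultiset (m + Finsupp.single k 1)).toList.map bLetter).Perm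
      (bLetter k :: (Finsupp.toMultiset m).toList.map bLetter) := by
    rw [← List.map_cons]
    refine List.Perm.map _ ?_
    rw [← Multiset.coe_eq_coe, Multiset.coe_toList, ← Multiset.cons_coe, Multiset.coe_toList,
      map_add, Finsupp.toMultiset_single, one_smul, add_comm, Multiset.singleton_add]
  have h1 := normalOrdered_append_congr R (s.sort.map fLetter) 1 hp (fun C => by
    rw [one_smul]
    refine normalOrdered_even_perm R hp (fun x hx => ?_) C
    obtain ⟨k, -, rfl⟩ := List.mem_map.mp hx
    exact odd_bLetter k) C
  unfold word
  rw [h1, one_smul, normalOrdered_even_middle R _ _ _ (odd_bLetter k)]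

theorem moveSign_word (g : Gen N) (s : Finset (FMode N)) (m : BMode N →₀ ℕ) :
    moveSign g (word s m) = if g.odd then (-1) ^ s.card else 1 := by
  unfold moveSign word
  congr 2
  have h1 : (s.sort.map fLetter).filter (fun x : Gen N × ℕ => x.1.odd) = s.sort.map fLetter := by
    rw [List.filter_eq_self]
    intro x hx
    obtain ⟨k, -, rfl⟩ := List.mem_map.mp hx
    exact odd_fLetter k
  have h2 : ((Finsupp.toMultiset m).toList.map bLetter).filter
      (fun x : Gen N × ℕ => x.1.odd) = [] := by
    rw [List.filter_eq_nil_iff]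
    intro x hx
    obtain ⟨k, -, rfl⟩ := List.mem_map.mp hx
    simp [odd_bLetter]
  rw [List.filter_append, h1, h2]
  simp

section

variable (ε : Lat N → Lat N → ℤˣ)

/-- The state-field correspondence with a series `C` of operators multiplied from the left, as an
operator on Laurent polynomials of vectors. -/
def preField (C : PowerSeries (Module.End ℂ (V N))) : V N →ₗ[ℂ] LPoly N →ₗ[ℂ] (ℤ → V N) :=
  Finsupp.lsum ℂ fun x =>
    (basisMonomials (BMode N) ℂ).constr ℂ fun m =>
      normalOrdered (expAnnihilation ε x.1) (word x.2 m) (C * expCreation x.1)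

theorem preField_single (C : PowerSeries (Module.End ℂ (V N))) (α : Lat N) (s : Finset (FMode N))
    (m : BMode N →₀ ℕ) :
    preField ε C (Finsupp.single (α, s) (monomial m 1)) =
      normalOrdered (expAnnihilation ε α) (word s m) (C * expCreation α) := by
  have h := (basisMonomials (BMode N) ℂ).constr_basis ℂ
    (fun m => normalOrdered (expAnnihilation ε α) (word s m) (C * expCreation α)) m
  rw [coe_basisMonomials] at h
  rw [preField, Finsupp.lsum_single, h]

theorem field_eq (x y : V N) : field ε x y = preField ε 1 x (Finsupp.single 0 y) := by
  suffices h : field ε = (LinearMap.lcomp ℂ (ℤ → V N)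
      (Finsupp.lsingle 0 : V N →ₗ[ℂ] LPoly N)) ∘ₗ preField ε 1 by
    rw [h]; rfl
  refine Fock.ext_monomial fun α s m => ?_
  have h := (basisMonomials (BMode N) ℂ).constr_basis ℂ
    (fun m => normalOrdered (expAnnihilation ε α) (word s m) (expCreation α) ∘ₗ
      (Finsupp.lsingle 0 : V N →ₗ[ℂ] LPoly N)) m
  rw [coe_basisMonomials] at h
  rw [field, Finsupp.lsum_single, h, LinearMap.comp_apply, preField_single, one_mul]
  rfl

theorem nProd_eq (n : ℤ) (x y : V N) :
    nProd ε n x y = preField ε 1 x (Finsupp.single 0 y) (-n - 1) := by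
  rw [← field_eq]; rfl

theorem preField_add (C C' : PowerSeries (Module.End ℂ (V N))) :
    preField ε (C + C') = preField ε C + preField ε C' :=
  Fock.ext_monomial fun α s m => by
    simp only [LinearMap.add_apply, preField_single, add_mul, normalOrdered_add]

theorem preField_smul (c : ℂ) (C : PowerSeries (Module.End ℂ (V N))) :
    preField ε (c • C) = c • preField ε C :=
  Fock.ext_monomial fun α s m => by
    simp only [LinearMap.smul_apply, preField_single, smul_mul_assoc, normalOrdered_smul]

theorem preField_zero : preField ε (0 : PowerSeries (Module.End ℂ (V N))) = 0 := by
  simpa using preField_smul ε 0 0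

/-- The field of `g_{-n-1} x` is the normally ordered product of `∂ⁿg(z) / n!` with the field of
`x`. -/
theorem preField_coeff (C : PowerSeries (Module.End ℂ (V N))) (g : Gen N) (n : ℕ) (x : V N) :
    preField ε C (g.coeff n x) = preField ε (C * creationPart g n) x +
      preField ε C (g.twist x) ∘ₗ annihilationPart g n := by
  suffices h : preField ε C ∘ₗ g.coeff n = preField ε (C * creationPart g n) +
      (LinearMap.lcomp ℂ (ℤ → V N) (annihilationPart g n)) ∘ₗ preField ε C ∘ₗ g.twist from
    LinearMap.congr_fun h x
  refine Fock.ext_monomial fun α s m => ?_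
  have h1 : g.twist (Finsupp.single (α, s) (monomial m 1)) =
      (moveSign g (word s m)) • (Finsupp.single (α, s) (monomial m 1) : V N) := by
    rw [moveSign_word, Gen.twist]
    split_ifs
    · exact Fock.parity_single _ _ _
    · simp
  have h2 : preField ε (C * creationPart g n) (Finsupp.single (α, s) (monomial m 1)) +
      preField ε C (g.twist (Finsupp.single (α, s) (monomial m 1))) ∘ₗ annihilationPart g n =
      normalOrdered (expAnnihilation ε α) ((g, n) :: word s m) (C * expCreation α) := by
    rw [h1, map_smul, preField_single, preField_single, mul_assoc,
      creationPart_mul_expCreation, normalOrdered, mul_assoc,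
      LinearMap.smul_comp]
  refine Eq.trans ?_ h2.symm
  rw [LinearMap.comp_apply]
  rcases letter_cases g n with ⟨k, hk⟩ | ⟨f, hf⟩
  · have h3 := coeff_bLetter k
    rw [← hk] at h3
    simp only at h3
    rw [h3, Fock.bC_single, X, monomial_mul, one_mul, add_comm, preField_single, word_add_single,
      ← hk]
  · have h3 := coeff_fLetter f
    have h4 := odd_fLetter f
    rw [← hf] at h3 h4
    simp only at h3 h4
    rw [h3, Fock.fC_single]
    split_ifs with hfs
    · rw [map_zero, normalOrdered_odd_repeat _ _ _ h4]
      rw [hf]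
      exact List.mem_append_left _ (List.mem_map_of_mem (by simpa using hfs))
    · have h5 := @word_insert N LinearOrder.toDecidableEq (expAnnihilation ε α) f s hfs m
      rw [map_smul, preField_single]
      rw [h5, smul_smul, Fock.sgn_mul_self, one_smul, hf]

end

/-! ### The series of a vertex operator -/

/-- The coefficient of `wʲ` in a polynomial, for an integer `j`. -/
def zcoeff (f : Polynomial (Sym N)) (j : ℤ) : Sym N := if 0 ≤ j then f.coeff j.toNat else 0

theorem zcoeff_add (f g : Polynomial (Sym N)) (j : ℤ) :
    zcoeff (f + g) j = zcoeff f j + zcoeff g j := by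
  unfold zcoeff; split_ifs <;> simp

theorem zcoeff_sub (f g : Polynomial (Sym N)) (j : ℤ) :
    zcoeff (f - g) j = zcoeff f j - zcoeff g j := by
  unfold zcoeff; split_ifs <;> simp

theorem zcoeff_mul_C (f : Polynomial (Sym N)) (p : Sym N) (j : ℤ) :
    zcoeff (f * Polynomial.C p) j = zcoeff f j * p := by
  unfold zcoeff; split_ifs <;> simp

theorem zcoeff_C (p : Sym N) (j : ℤ) : zcoeff (Polynomial.C p) j = if j = 0 then p else 0 := by
  unfold zcoeff
  rw [Polynomial.coeff_C]
  split_ifs <;> first | rfl | omega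

theorem zcoeff_smul (f : Polynomial (Sym N)) (c : ℂ) (j : ℤ) :
    zcoeff (c • f) j = c • zcoeff f j := by
  unfold zcoeff; split_ifs <;> simp

theorem zcoeff_mul_monomial (f : Polynomial (Sym N)) (p : Sym N) (m : ℕ) (j : ℤ) :
    zcoeff (f * Polynomial.monomial m p) j = zcoeff f (j - m) * p := by
  unfold zcoeff
  split_ifs with h1 h2 h2
  · rw [show j.toNat = (j - m).toNat + m by omega, Polynomial.coeff_mul_monomial]
  · rw [← Polynomial.C_mul_X_pow_eq_monomial, ← mul_assoc, Polynomial.coeff_mul_X_pow',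
      if_neg, zero_mul]
    omega
  · omega
  · rw [zero_mul]

/-- The pairing of `α` with the generator `Aⁱ` or `Bⁱ`. -/
def pairing (α : Lat N) : Fin N ⊕ Fin N → ℂ :=
  Sum.elim (fun i => (α.2 i : ℂ)) (fun i => (α.1 i : ℂ))

theorem zcoeff_expShift_mul_X (α : Lat N) (p : Sym N) (k : BMode N) (j : ℤ) :
    zcoeff (expShift α (p * X k)) j =
      zcoeff (expShift α p) j * X k - pairing α k.1 • zcoeff (expShift α p) (j - (k.2 + 1)) := by
  have h : expShift α (X k) = Polynomial.C (X k) -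
      Polynomial.monomial (k.2 + 1) (C (pairing α k.1) : Sym N) := aeval_X _ _
  rw [map_mul, h, mul_sub, zcoeff_sub, zcoeff_mul_C, zcoeff_mul_monomial, mul_comm _ (C _),
    ← smul_eq_C_mul]
  push_cast
  rfl

theorem zcoeff_expShift_C (α : Lat N) (c : ℂ) (j : ℤ) :
    zcoeff (expShift α (C c)) j = if j = 0 then C c else 0 := by
  have h : expShift α (C c) = Polynomial.C (C c) := aeval_C _ _
  rw [h, zcoeff_C]

theorem pderiv_zcoeff_expShift (α : Lat N) (k : BMode N) (p : Sym N) (j : ℤ) :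
    pderiv k (zcoeff (expShift α p) j) = zcoeff (expShift α (pderiv k p)) j := by
  classical
  induction p using MvPolynomial.induction_on generalizing j with
  | C c =>
    have h : zcoeff (expShift α (0 : Sym N)) j = 0 := by simp [zcoeff]
    rw [zcoeff_expShift_C, pderiv_C, h]
    split_ifs <;> simp
  | add p q hp hq => simp only [map_add, zcoeff_add, hp, hq]
  | mul_X p l hp =>
    rw [zcoeff_expShift_mul_X, map_sub, Derivation.leibniz, Derivation.leibniz, Derivation.map_smul,
      hp, hp,
      map_add, zcoeff_add, smul_eq_mul, smul_eq_mul, smul_eq_mul, smul_eq_mul,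
      mul_comm (X l) (pderiv k p), zcoeff_expShift_mul_X, pderiv_X]
    by_cases h : l = k
    · subst h; simp; ring
    · have h' : zcoeff (0 : Polynomial (Sym N)) j = 0 := by simp [zcoeff]
      simp [h, h']; ring

section

variable (ε : Lat N → Lat N → ℤˣ)

theorem expAnnihilation_single (α : Lat N) (d : ℤ) (β : Lat N) (s : Finset (FMode N)) (p : Sym N)
    (e : ℤ) : expAnnihilation ε α (Finsupp.single d (Finsupp.single (β, s) p)) e =
      ((ε α β : ℤ) : ℂ) • Finsupp.single (α + β, s)
        (zcoeff (expShift α p) (d + form α β - e)) := by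
  simp only [expAnnihilation, Finsupp.lsum_single, LinearMap.comp_apply, LinearMap.smul_apply,
    Finsupp.smul_apply]
  congr 1
  simp only [AlgHom.toLinearMap_apply, Polynomial.lsum_apply, Polynomial.sum, LinearMap.comp_apply,
    Finsupp.lsingle_apply, Finsupp.finsetSum_apply]
  by_cases h : 0 ≤ d + form α β - e
  · rw [Finset.sum_eq_single (d + form α β - e).toNat]
    · rw [show d + form α β - ((d + form α β - e).toNat : ℤ) = e by omega, Finsupp.single_eq_same,
        zcoeff, if_pos h]
    · intro k _ hk
      rw [Finsupp.single_eq_of_ne]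
      omega
    · intro hk
      rw [Polynomial.notMem_support_iff.mp hk, Finsupp.single_zero, Finsupp.single_zero,
        Finsupp.zero_apply]
  · rw [zcoeff, if_neg h, Finsupp.single_zero]
    refine Finset.sum_eq_zero fun k _ => Finsupp.single_eq_of_ne ?_
    omega

/-- The coefficient of `zᵏ` in `e^α · exp (-∑_{n>0} (α_n / n) z^{-n}) · z^{α_0}`. -/
def expCoeff (α : Lat N) (k : ℤ) : Module.End ℂ (V N) :=
  Finsupp.lapply k ∘ₗ expAnnihilation ε α ∘ₗ Finsupp.lsingle 0

theorem expCoeff_single (α : Lat N) (k : ℤ) (β : Lat N) (s : Finset (FMode N)) (p : Sym N) :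
    expCoeff ε α k (Finsupp.single (β, s) p) =
      ((ε α β : ℤ) : ℂ) • Finsupp.single (α + β, s) (zcoeff (expShift α p) (form α β - k)) := by
  have h := expAnnihilation_single ε α 0 β s p k
  rw [zero_add] at h
  exact h

theorem isSeries_expAnnihilation (α : Lat N) :
    IsSeries (expAnnihilation ε α) (expCoeff ε α) := by
  intro d v e
  suffices h : Finsupp.lapply e ∘ₗ expAnnihilation ε α ∘ₗ Finsupp.lsingle d =
      expCoeff ε α (e - d) from LinearMap.congr_fun h v
  refine Fock.ext_single fun β s p => ?_
  rw [expCoeff_single, LinearMap.comp_apply, LinearMap.comp_apply, Finsupp.lsingle_apply,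
    Finsupp.lapply_apply, expAnnihilation_single]
  congr 3
  ring

theorem expCoeff_mul_bC (α : Lat N) (k : ℤ) (x : Fin N ⊕ Fin N) (n : ℕ) :
    expCoeff ε α k * Fock.bC (x, n) =
      Fock.bC (x, n) * expCoeff ε α k - pairing α x • expCoeff ε α (k + n + 1) :=
  Fock.ext_single fun β s p => by
    simp only [LinearMap.sub_apply, LinearMap.smul_apply, Module.End.mul_apply, expCoeff_single,
      Fock.bC_single, map_smul, mul_comm (X (x, n)) p, zcoeff_expShift_mul_X, Finsupp.single_sub,
      smul_sub]
    rw [mul_comm (X (x, n)), smul_comm (pairing α x), Finsupp.smul_single (pairing α x)]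
    congr 5
    ring

theorem expCoeff_mul_bD (α : Lat N) (k : ℤ) (l : BMode N) :
    expCoeff ε α k * Fock.bD l = Fock.bD l * expCoeff ε α k :=
  Fock.ext_single fun β s p => by
    simp only [Module.End.mul_apply, expCoeff_single, Fock.bD_single, map_smul,
      pderiv_zcoeff_expShift]

theorem expCoeff_mul_fC (α : Lat N) (k : ℤ) (f : FMode N) :
    expCoeff ε α k * Fock.fC f = Fock.fC f * expCoeff ε α k :=
  Fock.ext_single fun β s p => by
    by_cases hf : f ∈ s
    · simp [hf, expCoeff_single]
    · simp only [Module.End.mul_apply, expCoeff_single, Fock.fC_single, hf, map_smul, if_false]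
      rw [smul_comm]

theorem expCoeff_mul_fD (α : Lat N) (k : ℤ) (f : FMode N) :
    expCoeff ε α k * Fock.fD f = Fock.fD f * expCoeff ε α k :=
  Fock.ext_single fun β s p => by
    by_cases hf : f ∈ s
    · simp only [Module.End.mul_apply, expCoeff_single, Fock.fD_single, hf, map_smul, if_true]
      rw [smul_comm]
    · simp [hf, expCoeff_single]

theorem expCoeff_mul_onIdx (α : Lat N) (k : ℤ) (c : Lat N → ℂ) :
    expCoeff ε α k * Fock.onIdx (fun β => c (α + β)) = Fock.onIdx c * expCoeff ε α k :=
  Fock.ext_single fun β s p => by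
    rw [Module.End.mul_apply, Fock.onIdx_single, Module.End.mul_apply, expCoeff_single,
      expCoeff_single, map_smul, map_smul, Fock.onIdx_single, zcoeff_smul]

theorem preField_expVec (C : PowerSeries (Module.End ℂ (V N))) (α : Lat N) :
    preField ε C (expVec α) = cauchy (C * expCreation α) ∘ₗ expAnnihilation ε α := by
  have h := preField_single ε C α ∅ 0
  have h1 : word (∅ : Finset (FMode N)) (0 : BMode N →₀ ℕ) = [] := by simp [word]
  rw [h1] at h
  exact h

theorem expCreation_zero : (expCreation 0 : PowerSeries (Module.End ℂ (V N))) = 1 := by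
  have h : (expArg 0 : PowerSeries (Module.End ℂ (V N))) = 0 := by
    ext1 m
    simp [expArg, heis]
  rw [expCreation_eq, h]
  ext1 k
  rw [psExp, PowerSeries.coeff_mk, Finset.sum_eq_single 0]
  · simp
  · intro r _ hr
    simp [hr]
  · simp

theorem expAnnihilation_zero {ε : Lat N → Lat N → ℤˣ} (hε : IsTwist ε) :
    expAnnihilation ε 0 = 1 := by
  have h : (expShift (0 : Lat N) : Sym N →ₐ[ℂ] Polynomial (Sym N)) =
      IsScalarTower.toAlgHom ℂ (Sym N) (Polynomial (Sym N)) := by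
    refine MvPolynomial.algHom_ext fun k => ?_
    obtain ⟨i | i, n⟩ := k <;> simp [expShift]
  refine LPoly.ext_single fun d v => Finsupp.ext fun e => ?_
  induction v using Finsupp.induction_linear with
  | zero => simp
  | add v w hv hw =>
    rw [Finsupp.single_add, map_add, map_add, Finsupp.add_apply, Finsupp.add_apply, hv, hw]
  | single x p =>
    obtain ⟨β, s⟩ := x
    rw [expAnnihilation_single, hε.trivial_left 0 β rfl, h]
    have h1 : zcoeff (IsScalarTower.toAlgHom ℂ (Sym N) (Polynomial (Sym N)) p) (d + form 0 β - e) =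
        if d = e then p else 0 := by
      have h2 : form 0 β = 0 := by simp [form]
      rw [show IsScalarTower.toAlgHom ℂ (Sym N) (Polynomial (Sym N)) p = Polynomial.C p from rfl,
        zcoeff_C, h2]
      simp [sub_eq_zero]
    rw [h1]
    by_cases hde : d = e
    · subst hde; simp
    · simp [hde]

end

/-! ### The deformed products on sectors -/

/-- The vector `x` lies in `Λ ⊗ S ⊗ e^α`. -/
def InSector (α : Lat N) (x : V N) : Prop := Fock.onIdx (fun β => if β = α then 1 else 0) x = x

theorem inSector_single (α : Lat N) (s : Finset (FMode N)) (p : Sym N) :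
    InSector α (Finsupp.single (α, s) p) := by
  simp [InSector]

theorem InSector.apply {α : Lat N} {x : V N} (hx : InSector α x) {T : Module.End ℂ (V N)}
    (hT : ∀ c, Fock.onIdx c * T = T * Fock.onIdx c) : InSector α (T x) := by
  have h := LinearMap.congr_fun (hT fun β => if β = α then 1 else 0) x
  simp only [Module.End.mul_apply] at h
  rw [InSector, h, hx]

/-- Multiplication by `q^{ht α + ht β - ht (α + β)}` on the sector of `β`. -/
def qShift (q : ℂ) (α : Lat N) : Module.End ℂ (V N) := Fock.onIdx fun β => q ^ defect α β

theorem qProd_single (ε : Lat N → Lat N → ℤˣ) (q : ℂ) (n : ℤ) (α : Lat N) (s : Finset (FMode N))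
    (p : Sym N) (y : V N) :
    qProd ε q n (Finsupp.single (α, s) p) y =
      nProd ε n (Finsupp.single (α, s) p) (qShift q α y) := by
  rw [qProd, Finsupp.lsum_single]; rfl

theorem qProd_of_inSector (ε : Lat N → Lat N → ℤˣ) (q : ℂ) (n : ℤ) {α : Lat N} {x : V N}
    (hx : InSector α x) (y : V N) : qProd ε q n x y = nProd ε n x (qShift q α y) := by
  rw [← hx]
  clear hx
  induction x using Finsupp.induction_linear with
  | zero => simp
  | add f g hf hg =>
    simp only [map_add, LinearMap.add_apply, hf, hg]
  | single z p =>
    obtain ⟨β, s⟩ := z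
    rw [Fock.onIdx_single]
    dsimp only
    split_ifs with h
    · subst h
      rw [one_smul, qProd_single]
    · simp

theorem ht_zero : ht (0 : Fin N → ℤ) = 0 := by
  simpa using ht_eq (0 : Fin N → ℤ) 0 0 (by simp) (Or.inl rfl)

theorem qShift_zero (q : ℂ) : qShift q (0 : Lat N) = 1 :=
  Fock.ext_single fun x s p => by simp [qShift, defect, ht_zero]

/-! ### The operator `Q₀` -/

theorem sum_Icc_neg {W : Type*} [AddCommMonoid W] (F : ℤ → W) (hF : ∀ k, 0 ≤ k → F k = 0)
    (M : ℕ) : ∑ k ∈ Finset.Icc (-(M : ℤ)) M, F k = ∑ n ∈ Finset.range M, F (-(n : ℤ) - 1) := by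
  symm
  refine Finset.sum_of_injOn (fun n : ℕ => -(n : ℤ) - 1) ?_ ?_ ?_ ?_
  · intro a _ b _ hab
    simp only at hab
    omega
  · intro a ha
    simp only [Finset.coe_range, Set.mem_Iio] at ha
    simp only [Finset.coe_Icc, Set.mem_Icc]
    omega
  · intro k hk hk'
    apply hF
    by_contra hneg
    apply hk'
    rw [Finset.mem_Icc] at hk
    exact ⟨(-k - 1).toNat, by simp only [Finset.coe_range, Set.mem_Iio]; omega, by
      simp only; omega⟩
  · intro a _
    rfl

theorem annihCoeff_zero (g : Gen N) (k : ℤ) :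
    annihCoeff g 0 k = if k < 0 then g.coeff k else 0 := by
  simp [annihCoeff]

theorem creationPart_zero (g : Gen N) (j : ℕ) :
    PowerSeries.coeff j (creationPart g 0) = g.coeff j := by
  simp [creationPart]

theorem cauchy_one (l : LPoly N) (e : ℤ) : cauchy 1 l e = l e := by
  induction l using Finsupp.induction_linear with
  | zero => simp
  | add f g hf hg => simp [hf, hg]
  | single d v =>
    rw [cauchy_single, Finsupp.single_apply, PowerSeries.coeff_one]
    rcases lt_trichotomy d e with h | h | h
    · simp [h.ne, h.le, show ¬ e - d ≤ 0 by omega]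
    · simp [h]
    · simp [h.ne', h.not_ge]

/-- The residue of a product of creation and annihilation parts. -/
theorem evLim_cauchy_annihilationPart (C : PowerSeries (Module.End ℂ (V N))) (g : Gen N) :
    EvLim (V := V N) (W := V N)
      (fun M => ∑ n ∈ Finset.range M, PowerSeries.coeff n C * g.coeff (-(n : ℤ) - 1))
      (LinearMap.proj (-1) ∘ₗ cauchy C ∘ₗ annihilationPart g 0 ∘ₗ Finsupp.lsingle 0) := by
  intro v
  filter_upwards [(isSeries_annihilationPart g 0).evLim (Finsupp.single 0 v)] with M hM
  simp only [LinearMap.comp_apply, Finsupp.lsingle_apply]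
  rw [← hM, partialSeries_single, map_sum, sum_Icc_neg]
  · simp only [LinearMap.proj_apply, Finset.sum_apply, LinearMap.sum_apply]
    refine Finset.sum_congr rfl fun n _ => ?_
    rw [cauchy_single, if_pos (by omega), annihCoeff_zero, if_pos (by omega),
      show (-1 - (0 + (-(n : ℤ) - 1))).toNat = n by omega]
    rfl
  · intro k hk
    rw [annihCoeff_zero, if_neg (by omega)]
    simp

theorem annihilationPart_annihilationPart_neg_one (g h : Gen N) (v : V N) :
    annihilationPart g 0 (annihilationPart h 0 (Finsupp.single 0 v)) (-1) = 0 := by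
  obtain ⟨M, hM⟩ := ((isSeries_annihilationPart h 0).evLim (Finsupp.single 0 v)).exists
  rw [← hM, partialSeries_single, map_sum, Finsupp.finsetSum_apply]
  refine Finset.sum_eq_zero fun k _ => ?_
  rw [isSeries_annihilationPart g 0, annihCoeff_zero, annihCoeff_zero]
  split_ifs
  · omega
  all_goals simp

theorem twist_expVec (g : Gen N) (α : Lat N) : g.twist (expVec α) = expVec α := by
  unfold Gen.twist
  split_ifs
  · simp [expVec]
  · rfl

/-- The partial sums of `Q₀ = ∑ᵢ ∑ⱼ : Aⁱ_j Φⁱ_{-j} :`. -/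
def Q0Partial (M : ℕ) : Module.End ℂ (V N) :=
  ∑ i, (∑ n ∈ Finset.range M, Fock.bC (Sum.inl i, n) * Fock.fD (psiMode i n) +
    ∑ n ∈ Finset.range (M + 1), Fock.fC (phiMode i n) * (Gen.A i).coeff (-(n : ℤ) - 1))

theorem EvLim.succ {V W : Type*} [AddCommGroup V] [Module ℂ V] [AddCommGroup W] [Module ℂ W]
    {f : ℕ → V →ₗ[ℂ] W} {T : V →ₗ[ℂ] W} (h : EvLim f T) : EvLim (fun M => f (M + 1)) T :=
  fun v => (Filter.tendsto_add_atTop_nat 1).eventually (h v)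

/-- `Q₀` is the locally finite sum of the `:Aⁱ_j Φⁱ_{-j}:`. In the normally ordered product of
`Aⁱ(z)` and `Φⁱ(z)` only the products of a creation part and an annihilation part have a residue. -/
theorem evLim_Q0 {ε : Lat N → Lat N → ℤˣ} (hε : IsTwist ε) (q : ℂ) :
    EvLim (V := V N) (W := V N) Q0Partial (Q0 ε q) := by
  have h0 : ∀ C : PowerSeries (Module.End ℂ (V N)), preField ε C (expVec 0) = cauchy C := by
    intro C
    rw [preField_expVec, expCreation_zero, mul_one, expAnnihilation_zero hε]
    rfl
  have h1 : Q0 ε q = ∑ i,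
      (LinearMap.proj (-1) ∘ₗ cauchy (creationPart (.A i) 0) ∘ₗ
          annihilationPart (.Phi i) 0 ∘ₗ Finsupp.lsingle 0 +
        LinearMap.proj (-1) ∘ₗ cauchy (creationPart (.Phi i) 0) ∘ₗ
          annihilationPart (.A i) 0 ∘ₗ Finsupp.lsingle 0) := by
    refine LinearMap.ext fun y => ?_
    rw [Q0, map_sum, LinearMap.sum_apply, LinearMap.sum_apply]
    refine Finset.sum_congr rfl fun i _ => ?_
    have h2 : InSector (0 : Lat N) (Gen.mode (.A i) (-1) (Gen.mode (.Phi i) 0 (expVec 0))) :=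
      ((inSector_single 0 ∅ 1).apply (Gen.coeff_mul_onIdx (.Phi i) 0)).apply
        (Gen.coeff_mul_onIdx (.A i) 0)
    rw [qProd_of_inSector ε q 0 h2, qShift_zero, Module.End.one_apply, nProd_eq]
    have h3 : Gen.mode (.A i) (-1) (Gen.mode (.Phi i) 0 (expVec 0)) =
      (Gen.A i).coeff ((0 : ℕ) : ℤ) ((Gen.Phi i).coeff ((0 : ℕ) : ℤ) (expVec 0)) := rfl
    rw [h3, preField_coeff, preField_coeff]
    have h4 : (Gen.A i).twist = 1 := rfl
    rw [h4, Module.End.one_apply, preField_coeff, twist_expVec, h0, h0, h0, h0, one_mul, one_mul]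
    simp only [LinearMap.add_apply, LinearMap.comp_apply, Pi.add_apply, neg_zero, zero_sub,
      Finsupp.lsingle_apply, LinearMap.proj_apply]
    have h5 : cauchy (1 : PowerSeries (Module.End ℂ (V N))) (annihilationPart (.Phi i) 0
        (annihilationPart (.A i) 0 (Finsupp.single 0 y))) (-1) = 0 := by
      rw [cauchy_one, annihilationPart_annihilationPart_neg_one]
    rw [h5, cauchy_single, if_neg (by omega)]
    abel
  rw [h1]
  refine EvLim.sum _ fun i _ => EvLim.add ?_ ?_
  · refine (evLim_cauchy_annihilationPart _ _).congr fun M => Finset.sum_congr rfl fun n _ => ?_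
    rw [creationPart_zero, Gen.coeff_A_nat, Gen.coeff_Phi_neg]
  · refine (evLim_cauchy_annihilationPart _ _).succ.congr fun M =>
      Finset.sum_congr rfl fun n _ => ?_
    rw [creationPart_zero, Gen.coeff_Phi_nat]

/-! ### Brackets with `Q₀` -/

/-- Brackets pass to locally finite sums, given by their partial sums `f M`. -/
theorem Bracket.evLim {W : Type*} [AddCommGroup W] [Module ℂ W] {s : ℂ}
    {f z : ℕ → Module.End ℂ W} {T X Z : Module.End ℂ W} (hf : EvLim f T) (hz : EvLim z Z)
    (h : ∀ M, Bracket s (f M) X (z M)) : Bracket s T X Z :=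
  EvLim.unique (hf.mul (EvLim.const X))
    (((((EvLim.const X).mul hf).smul s).add hz).congr fun M => (h M).symm)

namespace Fock

variable {I F K : Type*}

theorem bracket_bC_bC (k l : K) : Bracket 1 (bC k) (bC l) (0 : Module.End ℂ (Space I F K)) :=
  .of_mul_eq (bC_mul_bC k l)

theorem bracket_bD_bD (k l : K) : Bracket 1 (bD k) (bD l) (0 : Module.End ℂ (Space I F K)) :=
  .of_mul_eq (bD_mul_bD k l)

theorem bracket_bD_bC [DecidableEq K] (k l : K) :
    Bracket 1 (bD k) (bC l) (if k = l then 1 else 0 : Module.End ℂ (Space I F K)) := by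
  rw [Bracket, one_smul, bD_mul_bC]

theorem bracket_bC_bD [DecidableEq K] (k l : K) :
    Bracket 1 (bC k) (bD l) (if k = l then -1 else 0 : Module.End ℂ (Space I F K)) := by
  rw [Bracket, one_smul, bD_mul_bC]
  refine LinearMap.ext fun v => ?_
  by_cases h : k = l
  · subst h; simp
  · simp [h, Ne.symm h]

theorem bracket_onIdx_onIdx (c d : I → ℂ) :
    Bracket 1 (onIdx c) (onIdx d) (0 : Module.End ℂ (Space I F K)) :=
  .of_mul_eq (by rw [onIdx_mul, onIdx_mul]; simp [mul_comm])

theorem bracket_onIdx_bC (c : I → ℂ) (k : K) :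
    Bracket 1 (onIdx c) (bC k) (0 : Module.End ℂ (Space I F K)) := .of_mul_eq (onIdx_mul_bC c k)

theorem bracket_bC_onIdx (c : I → ℂ) (k : K) :
    Bracket 1 (bC k) (onIdx c) (0 : Module.End ℂ (Space I F K)) :=
  .of_mul_eq (onIdx_mul_bC c k).symm

theorem bracket_onIdx_bD (c : I → ℂ) (k : K) :
    Bracket 1 (onIdx c) (bD k) (0 : Module.End ℂ (Space I F K)) := .of_mul_eq (onIdx_mul_bD c k)

theorem bracket_bD_onIdx (c : I → ℂ) (k : K) :
    Bracket 1 (bD k) (onIdx c) (0 : Module.End ℂ (Space I F K)) :=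
  .of_mul_eq (onIdx_mul_bD c k).symm

variable [LinearOrder F]

theorem bracket_fC_fC (f g : F) : Bracket (-1) (fC f) (fC g) (0 : Module.End ℂ (Space I F K)) :=
  .of_mul_eq_neg (fC_mul_fC f g)

theorem bracket_fD_fD (f g : F) : Bracket (-1) (fD f) (fD g) (0 : Module.End ℂ (Space I F K)) :=
  .of_mul_eq_neg (fD_mul_fD f g)

theorem bracket_fD_fC (f g : F) :
    Bracket (-1) (fD f) (fC g) (if f = g then 1 else 0 : Module.End ℂ (Space I F K)) := by
  rw [Bracket, fD_mul_fC, neg_eq_smul]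

theorem bracket_fC_fD (f g : F) :
    Bracket (-1) (fC f) (fD g) (if f = g then 1 else 0 : Module.End ℂ (Space I F K)) := by
  rw [Bracket, fD_mul_fC, ← neg_eq_smul]
  refine LinearMap.ext fun v => ?_
  by_cases h : f = g
  · subst h; simp
  · simp [h, Ne.symm h]

theorem bracket_fC_bC (f : F) (k : K) :
    Bracket 1 (fC f) (bC k) (0 : Module.End ℂ (Space I F K)) := .of_mul_eq (fC_mul_bC f k)

theorem bracket_bC_fC (f : F) (k : K) :
    Bracket 1 (bC k) (fC f) (0 : Module.End ℂ (Space I F K)) := .of_mul_eq (fC_mul_bC f k).symm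

theorem bracket_fC_bD (f : F) (k : K) :
    Bracket 1 (fC f) (bD k) (0 : Module.End ℂ (Space I F K)) := .of_mul_eq (fC_mul_bD f k)

theorem bracket_bD_fC (f : F) (k : K) :
    Bracket 1 (bD k) (fC f) (0 : Module.End ℂ (Space I F K)) := .of_mul_eq (fC_mul_bD f k).symm

theorem bracket_fD_bC (f : F) (k : K) :
    Bracket 1 (fD f) (bC k) (0 : Module.End ℂ (Space I F K)) := .of_mul_eq (fD_mul_bC f k)

theorem bracket_bC_fD (f : F) (k : K) :
    Bracket 1 (bC k) (fD f) (0 : Module.End ℂ (Space I F K)) := .of_mul_eq (fD_mul_bC f k).symm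

theorem bracket_fD_bD (f : F) (k : K) :
    Bracket 1 (fD f) (bD k) (0 : Module.End ℂ (Space I F K)) := .of_mul_eq (fD_mul_bD f k)

theorem bracket_bD_fD (f : F) (k : K) :
    Bracket 1 (bD k) (fD f) (0 : Module.End ℂ (Space I F K)) := .of_mul_eq (fD_mul_bD f k).symm

theorem bracket_fC_onIdx (f : F) (c : I → ℂ) :
    Bracket 1 (fC f) (onIdx c) (0 : Module.End ℂ (Space I F K)) :=
  .of_mul_eq (onIdx_mul_fC c f).symm

theorem bracket_onIdx_fC (f : F) (c : I → ℂ) :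
    Bracket 1 (onIdx c) (fC f) (0 : Module.End ℂ (Space I F K)) :=
  .of_mul_eq (onIdx_mul_fC c f)

theorem bracket_fD_onIdx (f : F) (c : I → ℂ) :
    Bracket 1 (fD f) (onIdx c) (0 : Module.End ℂ (Space I F K)) :=
  .of_mul_eq (onIdx_mul_fD c f).symm

theorem bracket_onIdx_fD (f : F) (c : I → ℂ) :
    Bracket 1 (onIdx c) (fD f) (0 : Module.End ℂ (Space I F K)) :=
  .of_mul_eq (onIdx_mul_fD c f)

end Fock

/-- The partial sums of `Q₀` in terms of multiplications and derivatives. -/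
theorem Q0Partial_eq (M : ℕ) : (Q0Partial M : Module.End ℂ (V N)) =
    ∑ i, (∑ n ∈ Finset.range M, Fock.bC (Sum.inl i, n) * Fock.fD (psiMode i n) +
      (∑ n ∈ Finset.range M, ((n : ℂ) + 1) •
          (Fock.fC (phiMode i (n + 1)) * Fock.bD (Sum.inr i, n)) +
        Fock.fC (phiMode i 0) * Fock.onIdx fun β => (β.2 i : ℂ))) := by
  unfold Q0Partial
  refine Finset.sum_congr rfl fun i _ => ?_
  rw [Finset.sum_range_succ']
  congr 2
  refine Finset.sum_congr rfl fun n _ => ?_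
  rw [show -((n + 1 : ℕ) : ℤ) - 1 = -(n : ℤ) - 2 by push_cast; ring, Gen.coeff_A_neg, mul_smul_comm]

/-- The bracket of an operator with `Q₀` is computed from the brackets of its constituents. -/
theorem bracket_Q0 {ε : Lat N → Lat N → ℤˣ} (hε : IsTwist ε) (q : ℂ) {s : ℂ}
    {X Z : Module.End ℂ (V N)} {z₁ z₂ : Fin N → ℕ → Module.End ℂ (V N)}
    {z₃ : Fin N → Module.End ℂ (V N)}
    (h₁ : ∀ i n, Bracket s (Fock.bC (Sum.inl i, n) * Fock.fD (psiMode i n)) X (z₁ i n))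
    (h₂ : ∀ i n, Bracket s (Fock.fC (phiMode i (n + 1)) * Fock.bD (Sum.inr i, n)) X (z₂ i n))
    (h₃ : ∀ i, Bracket s (Fock.fC (phiMode i 0) * Fock.onIdx fun β => (β.2 i : ℂ)) X (z₃ i))
    (hz : ∀ᶠ M in Filter.atTop, ∑ i, (∑ n ∈ Finset.range M, z₁ i n +
      (∑ n ∈ Finset.range M, ((n : ℂ) + 1) • z₂ i n + z₃ i)) = Z) :
    Bracket s (Q0 ε q) X Z := by
  refine Bracket.evLim (W := V N) (evLim_Q0 hε q)
    (z := fun M => ∑ i, (∑ n ∈ Finset.range M, z₁ i n +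
      (∑ n ∈ Finset.range M, ((n : ℂ) + 1) • z₂ i n + z₃ i))) ?_ ?_
  · intro v
    filter_upwards [hz] with M hM
    rw [hM]
  · intro M
    rw [Q0Partial_eq]
    exact Bracket.sum_left _ fun i _ => (Bracket.sum_left _ fun n _ => h₁ i n).add_left
      ((Bracket.sum_left _ fun n _ => (h₂ i n).smul_left _).add_left (h₃ i))

theorem eventually_sum_ite {W : Type*} [AddCommMonoid W] (F : Fin N → ℕ → W) (j : Fin N) (m : ℕ) :
    ∀ᶠ M in Filter.atTop,
      ∑ i, ∑ n ∈ Finset.range M, (if i = j ∧ n = m then F i n else 0) = F j m := by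
  filter_upwards [Filter.eventually_gt_atTop m] with M hM
  rw [Finset.sum_eq_single_of_mem j (Finset.mem_univ j),
    Finset.sum_eq_single_of_mem m (Finset.mem_range.mpr hM)]
  · simp
  · intro b _ hb; simp [hb]
  · intro b _ hb; simp [hb]

section

variable {ε : Lat N → Lat N → ℤˣ} (hε : IsTwist ε) (q : ℂ)

include hε

open Fock

theorem bracket_Q0_bC_inl (j : Fin N) (m : ℕ) : Bracket 1 (Q0 ε q) (bC (Sum.inl j, m)) 0 :=
  bracket_Q0 hε q
    (fun i n => ((bracket_bC_bC _ _).mul_left (bracket_fD_bC _ _)).congr (one_mul 1) rfl)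
    (fun i n => ((bracket_fC_bC _ _).mul_left (bracket_bD_bC _ _)).congr (one_mul 1) rfl)
    (fun i => ((bracket_fC_bC _ _).mul_left (bracket_onIdx_bC _ _)).congr (one_mul 1) rfl)
    (Filter.Eventually.of_forall fun M => by simp)

theorem bracket_Q0_bC_inr (j : Fin N) (m : ℕ) :
    Bracket 1 (Q0 ε q) (bC (Sum.inr j, m)) (((m : ℂ) + 1) • fC (phiMode j (m + 1))) :=
  bracket_Q0 hε q
    (fun i n => ((bracket_bC_bC _ _).mul_left (bracket_fD_bC _ _)).congr (one_mul 1) rfl)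
    (fun i n => ((bracket_fC_bC _ _).mul_left (bracket_bD_bC _ _)).congr (one_mul 1) rfl)
    (fun i => ((bracket_fC_bC _ _).mul_left (bracket_onIdx_bC _ _)).congr (one_mul 1) rfl) (by
      filter_upwards [eventually_sum_ite (fun i n => ((n : ℂ) + 1) •
        (fC (phiMode i (n + 1)) : Module.End ℂ (V N))) j m] with M hM
      rw [← hM]
      simp)

theorem bracket_Q0_bD_inr (j : Fin N) (m : ℕ) : Bracket 1 (Q0 ε q) (bD (Sum.inr j, m)) 0 :=
  bracket_Q0 hε q
    (fun i n => ((bracket_bC_bD _ _).mul_left (bracket_fD_bD _ _)).congr (one_mul 1) rfl)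
    (fun i n => ((bracket_fC_bD _ _).mul_left (bracket_bD_bD _ _)).congr (one_mul 1) rfl)
    (fun i => ((bracket_fC_bD _ _).mul_left (bracket_onIdx_bD _ _)).congr (one_mul 1) rfl)
    (Filter.Eventually.of_forall fun M => by simp)

theorem bracket_Q0_bD_inl (j : Fin N) (m : ℕ) :
    Bracket 1 (Q0 ε q) (bD (Sum.inl j, m)) (-fD (psiMode j m)) :=
  bracket_Q0 hε q
    (fun i n => ((bracket_bC_bD _ _).mul_left (bracket_fD_bD _ _)).congr (one_mul 1) rfl)
    (fun i n => ((bracket_fC_bD _ _).mul_left (bracket_bD_bD _ _)).congr (one_mul 1) rfl)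
    (fun i => ((bracket_fC_bD _ _).mul_left (bracket_onIdx_bD _ _)).congr (one_mul 1) rfl) (by
      have h1 : ∀ X : Module.End ℂ (V N), -1 * X = -X := fun X => LinearMap.ext fun v => by simp
      filter_upwards [eventually_sum_ite (fun i n =>
        (-fD (psiMode i n) : Module.End ℂ (V N))) j m] with M hM
      rw [← hM]
      simp [h1])

theorem bracket_Q0_onIdx (c : Lat N → ℂ) : Bracket 1 (Q0 ε q) (onIdx c) 0 :=
  bracket_Q0 hε q
    (fun i n => ((bracket_bC_onIdx _ _).mul_left (bracket_fD_onIdx _ _)).congr (one_mul 1) rfl)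
    (fun i n => ((bracket_fC_onIdx _ _).mul_left (bracket_bD_onIdx _ _)).congr (one_mul 1) rfl)
    (fun i => ((bracket_fC_onIdx _ _).mul_left (bracket_onIdx_onIdx _ _)).congr (one_mul 1) rfl)
    (Filter.Eventually.of_forall fun M => by simp)

theorem bracket_Q0_fC_phi (j : Fin N) (m : ℕ) : Bracket (-1) (Q0 ε q) (fC (phiMode j m)) 0 :=
  bracket_Q0 hε q
    (fun i n => ((bracket_bC_fC _ _).mul_left (bracket_fD_fC _ _)).congr (one_mul _) rfl)
    (fun i n => ((bracket_fC_fC _ _).mul_left (bracket_bD_fC _ _)).congr (mul_one _) rfl)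
    (fun i => ((bracket_fC_fC _ _).mul_left (bracket_onIdx_fC _ _)).congr (mul_one _) rfl)
    (Filter.Eventually.of_forall fun M => by simp)

theorem bracket_Q0_fC_psi (j : Fin N) (m : ℕ) :
    Bracket (-1) (Q0 ε q) (fC (psiMode j m)) (bC (Sum.inl j, m)) :=
  bracket_Q0 hε q
    (fun i n => ((bracket_bC_fC _ _).mul_left (bracket_fD_fC _ _)).congr (one_mul _) rfl)
    (fun i n => ((bracket_fC_fC _ _).mul_left (bracket_bD_fC _ _)).congr (mul_one _) rfl)
    (fun i => ((bracket_fC_fC _ _).mul_left (bracket_onIdx_fC _ _)).congr (mul_one _) rfl) (by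
      filter_upwards [eventually_sum_ite (fun i n =>
        (bC (Sum.inl i, n) : Module.End ℂ (V N))) j m] with M hM
      rw [← hM]
      simp)

theorem bracket_Q0_fD_psi (j : Fin N) (m : ℕ) : Bracket (-1) (Q0 ε q) (fD (psiMode j m)) 0 :=
  bracket_Q0 hε q
    (fun i n => ((bracket_bC_fD _ _).mul_left (bracket_fD_fD _ _)).congr (one_mul _) rfl)
    (fun i n => ((bracket_fC_fD _ _).mul_left (bracket_bD_fD _ _)).congr (mul_one _) rfl)
    (fun i => ((bracket_fC_fD _ _).mul_left (bracket_onIdx_fD _ _)).congr (mul_one _) rfl)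
    (Filter.Eventually.of_forall fun M => by simp)

theorem bracket_Q0_fD_phi_zero (j : Fin N) :
    Bracket (-1) (Q0 ε q) (fD (phiMode j 0)) (onIdx fun β => (β.2 j : ℂ)) :=
  bracket_Q0 hε q
    (fun i n => ((bracket_bC_fD _ _).mul_left (bracket_fD_fD _ _)).congr (one_mul _) rfl)
    (fun i n => ((bracket_fC_fD _ _).mul_left (bracket_bD_fD _ _)).congr (mul_one _) rfl)
    (fun i => ((bracket_fC_fD _ _).mul_left (bracket_onIdx_fD _ _)).congr (mul_one _) rfl)
    (Filter.Eventually.of_forall fun M => by simp)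

theorem bracket_Q0_fD_phi_succ (j : Fin N) (m : ℕ) :
    Bracket (-1) (Q0 ε q) (fD (phiMode j (m + 1))) (((m : ℂ) + 1) • bD (Sum.inr j, m)) :=
  bracket_Q0 hε q
    (fun i n => ((bracket_bC_fD _ _).mul_left (bracket_fD_fD _ _)).congr (one_mul _) rfl)
    (fun i n => ((bracket_fC_fD _ _).mul_left (bracket_bD_fD _ _)).congr (mul_one _) rfl)
    (fun i => ((bracket_fC_fD _ _).mul_left (bracket_onIdx_fD _ _)).congr (mul_one _) rfl) (by
      filter_upwards [eventually_sum_ite (fun i n =>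
        ((n : ℂ) + 1) • (bD (Sum.inr i, n) : Module.End ℂ (V N))) j m] with M hM
      rw [← hM]
      simp)

end

theorem Bracket.mul_right {E : Type*} [Ring E] [Algebra ℂ E] {s t : ℂ} {X Y Y' Z Z' : E}
    (h : Bracket s X Y Z) (h' : Bracket t X Y' Z') :
    Bracket (s * t) X (Y * Y') (Z * Y' + s • (Y * Z')) := by
  unfold Bracket at *
  rw [← mul_assoc, h, add_mul, smul_mul_assoc, mul_assoc, h', mul_add, mul_smul_comm, smul_add,
    smul_smul, mul_assoc]
  abel

namespace Fock

variable {I F K : Type*}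

theorem bracket_bC_parity (k : K) :
    Bracket 1 (bC k) parity (0 : Module.End ℂ (Space I F K)) := .of_mul_eq (parity_mul_bC k).symm

theorem bracket_bD_parity (k : K) :
    Bracket 1 (bD k) parity (0 : Module.End ℂ (Space I F K)) := .of_mul_eq (parity_mul_bD k).symm

theorem bracket_onIdx_parity (c : I → ℂ) :
    Bracket 1 (onIdx c) parity (0 : Module.End ℂ (Space I F K)) :=
  .of_mul_eq (parity_mul_onIdx c).symm

variable [LinearOrder F]

theorem bracket_fC_parity (f : F) :
    Bracket (-1) (fC f) parity (0 : Module.End ℂ (Space I F K)) :=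
  .of_mul_eq_neg (by rw [parity_mul_fC]; exact LinearMap.ext fun v => by simp)

theorem bracket_fD_parity (f : F) :
    Bracket (-1) (fD f) parity (0 : Module.End ℂ (Space I F K)) :=
  .of_mul_eq_neg (by rw [parity_mul_fD]; exact LinearMap.ext fun v => by simp)

end Fock

namespace Gen

/-- The field `d g` such that the bracket of `Q₀` with `g(z)` is a multiple of `d g(z)` or of its
derivative: `[Q₀, Ψⁱ(z)] = Aⁱ(z)`, `[Q₀, Bⁱ(z)] = ∂Φⁱ(z)`, and `[Q₀, Aⁱ(z)] = [Q₀, Φⁱ(z)] = 0`. -/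
def d : Gen N → Gen N
  | A i => Phi i
  | B i => Phi i
  | Phi i => A i
  | Psi i => A i

/-- The order of the derivative of `d g` in the bracket of `Q₀` with `g(z)`. -/
def dShift : Gen N → ℕ
  | B _ => 1
  | _ => 0

/-- The scalar in the bracket of `Q₀` with a coefficient of `g(z)`. -/
def dScalar : Gen N → ℤ → ℂ
  | A _, _ => 0
  | B _, e => e + 1
  | Phi _, _ => 0
  | Psi _, _ => 1

theorem odd_d (g : Gen N) : g.d.odd = !g.odd := by cases g <;> rfl

end Gen

theorem int_cases (e : ℤ) : e = -1 ∨ (∃ n : ℕ, e = -(n : ℤ) - 2) ∨ ∃ n : ℕ, e = n := by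
  rcases lt_trichotomy e (-1) with h | h | h
  · exact Or.inr (Or.inl ⟨(-e - 2).toNat, by omega⟩)
  · exact Or.inl h
  · exact Or.inr (Or.inr ⟨e.toNat, by omega⟩)

section

variable {ε : Lat N → Lat N → ℤˣ} (hε : IsTwist ε) (q : ℂ)

include hε

theorem bracket_Q0_coeff_A (i : Fin N) (e : ℤ) : Bracket 1 (Q0 ε q) ((Gen.A i).coeff e) 0 := by
  rcases int_cases e with rfl | ⟨n, rfl⟩ | ⟨n, rfl⟩
  · rw [Gen.coeff_A_neg_one]
    exact bracket_Q0_onIdx hε q _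
  · rw [Gen.coeff_A_neg]
    exact ((bracket_Q0_bD_inr hε q i n).smul_right _).congr rfl (smul_zero _)
  · rw [Gen.coeff_A_nat]
    exact bracket_Q0_bC_inl hε q i n

theorem bracket_Q0_coeff_Phi (i : Fin N) (e : ℤ) :
    Bracket (-1) (Q0 ε q) ((Gen.Phi i).coeff e) 0 := by
  rcases lt_or_ge e 0 with he | he
  · obtain ⟨n, rfl⟩ : ∃ n : ℕ, e = -(n : ℤ) - 1 := ⟨(-e - 1).toNat, by omega⟩
    rw [Gen.coeff_Phi_neg]
    exact bracket_Q0_fD_psi hε q i n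
  · obtain ⟨n, rfl⟩ := Int.eq_ofNat_of_zero_le he
    rw [Gen.coeff_Phi_nat]
    exact bracket_Q0_fC_phi hε q i n

theorem bracket_Q0_coeff_B (i : Fin N) (e : ℤ) :
    Bracket 1 (Q0 ε q) ((Gen.B i).coeff e) (((e : ℂ) + 1) • (Gen.Phi i).coeff (e + 1)) := by
  rcases int_cases e with rfl | ⟨n, rfl⟩ | ⟨n, rfl⟩
  · rw [Gen.coeff_B_neg_one]
    refine (bracket_Q0_onIdx hε q _).congr rfl ?_
    push_cast
    rw [neg_add_cancel, zero_smul]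
  · rw [Gen.coeff_B_neg, show -(n : ℤ) - 2 + 1 = -(n : ℤ) - 1 by ring, Gen.coeff_Phi_neg]
    refine ((bracket_Q0_bD_inl hε q i n).smul_right _).congr rfl (LinearMap.ext fun v => ?_)
    simp only [LinearMap.smul_apply, LinearMap.neg_apply]
    push_cast
    module
  · rw [Gen.coeff_B_nat, show (n : ℤ) + 1 = ((n + 1 : ℕ) : ℤ) by push_cast; ring,
      Gen.coeff_Phi_nat]
    exact bracket_Q0_bC_inr hε q i n

theorem bracket_Q0_coeff_Psi (i : Fin N) (e : ℤ) :
    Bracket (-1) (Q0 ε q) ((Gen.Psi i).coeff e) ((Gen.A i).coeff e) := by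
  rcases int_cases e with rfl | ⟨n, rfl⟩ | ⟨n, rfl⟩
  · rw [Gen.coeff_A_neg_one, show (-1 : ℤ) = -((0 : ℕ) : ℤ) - 1 by norm_num, Gen.coeff_Psi_neg]
    exact bracket_Q0_fD_phi_zero hε q i
  · rw [Gen.coeff_A_neg, show -(n : ℤ) - 2 = -((n + 1 : ℕ) : ℤ) - 1 by push_cast; ring,
      Gen.coeff_Psi_neg]
    exact bracket_Q0_fD_phi_succ hε q i n
  · rw [Gen.coeff_A_nat, Gen.coeff_Psi_nat]
    exact bracket_Q0_fC_psi hε q i n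

theorem bracket_Q0_coeff (g : Gen N) (e : ℤ) :
    Bracket g.sgn (Q0 ε q) (g.coeff e) (g.dScalar e • g.d.coeff (e + g.dShift)) := by
  cases g with
  | A i => exact (bracket_Q0_coeff_A hε q i e).congr rfl (by simp [Gen.dScalar])
  | B i => exact (bracket_Q0_coeff_B hε q i e).congr rfl (by simp [Gen.dScalar, Gen.dShift, Gen.d])
  | Phi i => exact (bracket_Q0_coeff_Phi hε q i e).congr rfl (by simp [Gen.dScalar])
  | Psi i =>
    exact (bracket_Q0_coeff_Psi hε q i e).congr rfl (by simp [Gen.dScalar, Gen.dShift, Gen.d])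

theorem bracket_Q0_parity : Bracket (-1) (Q0 ε q) Fock.parity 0 :=
  bracket_Q0 hε q
    (fun i n => ((Fock.bracket_bC_parity _).mul_left (Fock.bracket_fD_parity _)).congr
      (one_mul _) rfl)
    (fun i n => ((Fock.bracket_fC_parity _).mul_left (Fock.bracket_bD_parity _)).congr
      (mul_one _) rfl)
    (fun i => ((Fock.bracket_fC_parity _).mul_left (Fock.bracket_onIdx_parity _)).congr
      (mul_one _) rfl)
    (Filter.Eventually.of_forall fun M => by simp)

theorem Q0_mul_parity : Q0 ε q * Fock.parity = -(Fock.parity * Q0 ε q) := by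
  have h := bracket_Q0_parity hε q
  rw [Bracket, ← neg_eq_smul, add_zero] at h
  exact h

/-- The bracket of `Q₀` with each of the modes `Aⁱ_j`, `Φⁱ_j` of which it is made vanishes. -/
theorem Q0_mul_Q0 : Q0 ε q * Q0 ε q = 0 := by
  have h : ∀ M : ℕ, Q0 ε q * Q0Partial M = -(Q0Partial M * Q0 ε q) := by
    intro M
    have h1 : Bracket (-1) (Q0 ε q) (Q0Partial M) 0 := by
      rw [Q0Partial_eq]
      have hb : ∀ (X Y Z : Module.End ℂ (V N)), Bracket (-1) (Q0 ε q) X 0 →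
          Bracket (-1) (Q0 ε q) Y 0 → Bracket (-1) (Q0 ε q) (X + Y) 0 := by
        intro X Y Z hX hY
        unfold Bracket at *
        rw [mul_add, hX, hY, add_mul, smul_add]
        abel
      have hs : ∀ {ι : Type} (t : Finset ι) (X : ι → Module.End ℂ (V N)),
          (∀ i, Bracket (-1) (Q0 ε q) (X i) 0) → Bracket (-1) (Q0 ε q) (∑ i ∈ t, X i) 0 := by
        intro ι t X hX
        unfold Bracket at *
        rw [Finset.mul_sum, Finset.sum_mul, Finset.smul_sum, add_zero]
        exact Finset.sum_congr rfl fun i _ => by rw [hX i, add_zero]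
      refine hs _ _ fun i => hb _ _ 0 (hs _ _ fun n => ?_) (hb _ _ 0 (hs _ _ fun n => ?_) ?_)
      · exact ((bracket_Q0_bC_inl hε q i n).mul_right (bracket_Q0_fD_psi hε q i n)).congr
          (one_mul _) (by simp)
      · exact (((bracket_Q0_fC_phi hε q i _).mul_right (bracket_Q0_bD_inr hε q i n)).smul_right
          _).congr (mul_one _) (by simp)
      · exact ((bracket_Q0_fC_phi hε q i _).mul_right (bracket_Q0_onIdx hε q _)).congr
          (mul_one _) (by simp)
    rw [Bracket, ← neg_eq_smul, add_zero] at h1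
    exact h1
  have h2 : Q0 ε q * Q0 ε q = -(Q0 ε q * Q0 ε q) :=
    EvLim.unique (V := V N) (W := V N) (((EvLim.const (Q0 ε q)).mul (evLim_Q0 hε q)).congr h)
      ((evLim_Q0 hε q).mul (EvLim.const (Q0 ε q))).neg
  refine LinearMap.ext fun v => ?_
  have h3 := LinearMap.congr_fun h2 v
  exact self_eq_neg.mp h3

end

/-! ### Derivations of exponentials of power series -/

section PowerSeries

variable {W : Type*} [AddCommGroup W] [Module ℂ W]

/-- The coefficientwise action of a graded family of maps on power series. -/
def psMap (D : ℕ → Module.End ℂ W →ₗ[ℂ] Module.End ℂ W) (f : PowerSeries (Module.End ℂ W)) :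
    PowerSeries (Module.End ℂ W) := PowerSeries.mk fun k => D k (PowerSeries.coeff k f)

theorem psMap_mul {D : ℕ → Module.End ℂ W →ₗ[ℂ] Module.End ℂ W}
    (hD : ∀ i j x y, D (i + j) (x * y) = D i x * y + x * D j y)
    (f g : PowerSeries (Module.End ℂ W)) :
    psMap D (f * g) = psMap D f * g + f * psMap D g := by
  ext1 k
  rw [map_add, psMap, PowerSeries.coeff_mk, PowerSeries.coeff_mul, PowerSeries.coeff_mul,
    PowerSeries.coeff_mul, map_sum, ← Finset.sum_add_distrib]
  refine Finset.sum_congr rfl fun x hx => ?_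
  rw [psMap, psMap, PowerSeries.coeff_mk, PowerSeries.coeff_mk,
    ← Finset.HasAntidiagonal.mem_antidiagonal.mp hx, hD]

theorem psMap_pow {D : ℕ → Module.End ℂ W →ₗ[ℂ] Module.End ℂ W}
    (hD : ∀ i j x y, D (i + j) (x * y) = D i x * y + x * D j y)
    {f : PowerSeries (Module.End ℂ W)} (hf : Commute (psMap D f) f) (r : ℕ) :
    psMap D (f ^ (r + 1)) = (r + 1) • (psMap D f * f ^ r) := by
  induction r with
  | zero => simp
  | succ r ih =>
    rw [pow_succ, psMap_mul hD, ih, smul_mul_assoc, mul_assoc, ← pow_succ,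
      ← (hf.pow_right (r + 1)).eq, succ_nsmul (psMap D f * f ^ (r + 1)) (r + 1)]

theorem coeff_pow_eq_zero {f : PowerSeries (Module.End ℂ W)} (hf : PowerSeries.coeff 0 f = 0)
    {r j : ℕ} (h : j < r) : PowerSeries.coeff j (f ^ r) = 0 := by
  induction r generalizing j with
  | zero => omega
  | succ r ih =>
    rw [pow_succ, PowerSeries.coeff_mul]
    refine Finset.sum_eq_zero fun x hx => ?_
    have h1 := Finset.HasAntidiagonal.mem_antidiagonal.mp hx
    rcases Nat.eq_zero_or_pos x.2 with h2 | h2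
    · rw [h2, hf, mul_zero]
    · rw [ih (by omega), zero_mul]

/-- A derivation `D` satisfies `D (exp f) = D f · exp f` if `D f` commutes with `f`. -/
theorem psMap_psExp {D : ℕ → Module.End ℂ W →ₗ[ℂ] Module.End ℂ W}
    (hD : ∀ i j x y, D (i + j) (x * y) = D i x * y + x * D j y)
    {f : PowerSeries (Module.End ℂ W)} (hf0 : PowerSeries.coeff 0 f = 0)
    (hf : Commute (psMap D f) f) : psMap D (psExp f) = psMap D f * psExp f := by
  have h0 : ∀ (c : ℂ) (x : Module.End ℂ W), D 0 (c • x) = c • D 0 x := fun c x => map_smul _ _ _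
  have hone : psMap D 1 = 0 := by
    have h := psMap_mul hD 1 1
    rw [mul_one, mul_one, one_mul] at h
    exact left_eq_add.mp h
  ext1 k
  have h1 : PowerSeries.coeff k (psMap D (psExp f)) =
      ∑ r ∈ Finset.range k, ((r.factorial : ℂ)⁻¹) • PowerSeries.coeff k (psMap D f * f ^ r) := by
    rw [psMap, PowerSeries.coeff_mk, psExp, PowerSeries.coeff_mk, map_sum,
      Finset.sum_range_succ']
    have h2 : ∀ r, D k (((r.factorial : ℂ)⁻¹) • PowerSeries.coeff k (f ^ r)) =
        ((r.factorial : ℂ)⁻¹) • PowerSeries.coeff k (psMap D (f ^ r)) := fun r => by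
      rw [map_smul, psMap, PowerSeries.coeff_mk]
    rw [h2, pow_zero, hone, map_zero, smul_zero, add_zero]
    refine Finset.sum_congr rfl fun r _ => ?_
    rw [h2, psMap_pow hD hf, map_nsmul, ← Nat.cast_smul_eq_nsmul ℂ, smul_smul,
      Nat.factorial_succ]
    congr 1
    have h3 : ((r : ℂ) + 1) ≠ 0 := by exact_mod_cast Nat.succ_ne_zero r
    have h4 : (r.factorial : ℂ) ≠ 0 := by exact_mod_cast r.factorial_ne_zero
    push_cast
    field_simp
  rw [h1, PowerSeries.coeff_mul]
  simp only [PowerSeries.coeff_mul, Finset.smul_sum]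
  rw [Finset.sum_comm]
  refine Finset.sum_congr rfl fun x hx => ?_
  have h5 := Finset.HasAntidiagonal.mem_antidiagonal.mp hx
  rcases Nat.eq_zero_or_pos x.1 with h6 | h6
  · have h7 : PowerSeries.coeff 0 (psMap D f) = 0 := by
      rw [psMap, PowerSeries.coeff_mk, hf0, map_zero]
    rw [h6, h7, zero_mul]
    exact Finset.sum_eq_zero fun r _ => by rw [zero_mul, smul_zero]
  · rw [psExp, PowerSeries.coeff_mk, Finset.mul_sum]
    symm
    have h8 : Finset.range (x.2 + 1) ⊆ Finset.range k :=
      Finset.range_subset_range.mpr (by omega)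
    rw [← Finset.sum_subset h8]
    · exact Finset.sum_congr rfl fun r _ => mul_smul_comm _ _ _
    · intro r _ hr
      rw [Finset.mem_range] at hr
      -- `f` has no constant term, so `f ^ r` has no terms of degree less than `r`
      rw [coeff_pow_eq_zero hf0 (by omega), mul_zero, smul_zero]

end PowerSeries

/-! ### `Q₀` is an odd derivation -/

section

variable {ε : Lat N → Lat N → ℤˣ} (hε : IsTwist ε) (q : ℂ)

include hε

/-- The bracket of `Q₀` with the creation part of `∂ⁿg(z) / n!`. For `g = Bⁱ` it is that of
`∂ⁿ(∂Φⁱ(z)) / n!`, which is `n + 1` times that of `∂ⁿ⁺¹Φⁱ(z) / (n + 1)!`. -/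
theorem Q0_mul_creationPart (g : Gen N) (n : ℕ) :
    PowerSeries.C (Q0 ε q) * creationPart g n =
      g.sgn • (creationPart g n * PowerSeries.C (Q0 ε q)) +
        g.dScalar n • creationPart g.d (n + g.dShift) := by
  ext1 j
  have h := bracket_Q0_coeff hε q g ((j + n : ℕ) : ℤ)
  rw [Bracket] at h
  rw [map_add, coeff_smul, coeff_smul, PowerSeries.coeff_C_mul, PowerSeries.coeff_mul_C,
    creationPart, creationPart, PowerSeries.coeff_mk, PowerSeries.coeff_mk, mul_smul_comm, h,
    smul_add, smul_mul_assoc, smul_comm g.sgn]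
  congr 1
  rw [show ((j + n : ℕ) : ℤ) + (g.dShift : ℤ) = ((j + (n + g.dShift) : ℕ) : ℤ) by push_cast; ring,
    smul_smul, smul_smul]
  congr 1
  cases g with
  | A i => simp [Gen.dScalar]
  | B i =>
    simp only [Gen.dScalar, Gen.dShift]
    have h1 := Nat.add_one_mul_choose_eq (j + n) n
    have h2 : ((j : ℂ) + n + 1) * ((j + n).choose n : ℂ) =
        ((j + n + 1).choose (n + 1) : ℂ) * (n + 1) := by
      exact_mod_cast h1
    push_cast
    rw [← add_assoc]
    linear_combination h2
  | Phi i => simp [Gen.dScalar]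
  | Psi i => simp [Gen.dScalar, Gen.dShift]

/-- The bracket of `Q₀` with the annihilation part of `∂ⁿg(z) / n!`. For `g = Bⁱ` the exponent `-1`
belongs to the annihilation part of `Bⁱ(z)`, and it leads to the exponent `0` of the creation part
of `Φⁱ(z)`, but with scalar `0`. -/
theorem lift_Q0_mul_annihilationPart (g : Gen N) (n : ℕ) :
    lift (Q0 ε q) * annihilationPart g n =
      g.sgn • (annihilationPart g n * lift (Q0 ε q)) +
        g.dScalar n • annihilationPart g.d (n + g.dShift) := by
  have h1 := isSeries_lift_mul (isSeries_annihilationPart g n) (Q0 ε q)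
  have h2 := ((isSeries_mul_lift (isSeries_annihilationPart g n) (Q0 ε q)).smul g.sgn).add
    ((isSeries_annihilationPart g.d (n + g.dShift)).smul (g.dScalar n))
  refine h1.ext ?_
  convert h2 using 2 with k
  have h := bracket_Q0_coeff hε q g (k + n)
  rw [Bracket] at h
  have hB : ∀ i, g = Gen.B i → ((k + n : ℤ) + 1) * Ring.choose (k + n : ℤ) n =
      Ring.choose (k + n + 1 : ℤ) (n + 1) * (n + 1) := by
    intro i _
    have h5 := Ring.choose_smul_choose (R := ℤ) (k + n + 1) (n := n + 1) (k := 1) (by omega)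
    rw [Nat.choose_one_right, Ring.choose_one_right, nsmul_eq_mul, Nat.add_sub_cancel,
      Nat.cast_one, add_sub_cancel_right] at h5
    push_cast at h5
    linear_combination -h5
  cases g with
  | A i =>
    simp only [Gen.dScalar, zero_smul, add_zero] at h ⊢
    unfold annihCoeff
    split_ifs
    · rw [mul_smul_comm, h, smul_mul_assoc, smul_comm]
    · simp
  | Phi i =>
    simp only [Gen.dScalar, zero_smul, add_zero] at h ⊢
    unfold annihCoeff
    split_ifs
    · rw [mul_smul_comm, h, smul_mul_assoc, smul_comm]
    · simp
  | Psi i =>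
    simp only [Gen.dScalar, Gen.dShift, one_smul, add_zero, Nat.cast_zero] at h ⊢
    unfold annihCoeff
    split_ifs
    · rw [mul_smul_comm, h, smul_mul_assoc, smul_add, smul_comm]
    · simp
  | B i =>
    simp only [Gen.dScalar, Gen.dShift, Nat.cast_one] at h ⊢
    unfold annihCoeff
    have h4 := congrArg (Int.cast : ℤ → ℂ) (hB i rfl)
    push_cast at h4 ⊢
    rw [← add_assoc]
    rcases lt_trichotomy (k + n + 1) 0 with h3 | h3 | h3
    · rw [if_pos (by omega), if_pos h3, mul_smul_comm, h, smul_mul_assoc, smul_add, smul_comm]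
      congr 1
      rw [smul_smul, smul_smul]
      congr 1
      push_cast
      linear_combination h4
    -- the boundary exponent, where the scalar `k + n + 1` vanishes
    · have h5 : (k : ℂ) + n + 1 = 0 := by exact_mod_cast h3
      rw [if_pos (by omega), if_neg (by omega), mul_smul_comm, h, smul_mul_assoc, smul_comm]
      push_cast
      rw [h5]
      simp
    · rw [if_neg (by omega), if_neg (by omega)]
      simp

end

/-- The commutator with `T`, as a linear map. -/
def adMap {W : Type*} [AddCommGroup W] [Module ℂ W] (T : Module.End ℂ W) :
    Module.End ℂ W →ₗ[ℂ] Module.End ℂ W := LinearMap.mulLeft ℂ T - LinearMap.mulRight ℂ T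

theorem adMap_mul {W : Type*} [AddCommGroup W] [Module ℂ W] (T X Y : Module.End ℂ W) :
    adMap T (X * Y) = adMap T X * Y + X * adMap T Y := by
  simp only [adMap, LinearMap.sub_apply, LinearMap.mulLeft_apply, LinearMap.mulRight_apply,
    sub_mul, mul_sub, mul_assoc]
  abel

theorem adMap_of_bracket {W : Type*} [AddCommGroup W] [Module ℂ W] {T X Z : Module.End ℂ W}
    (h : Bracket 1 T X Z) : adMap T X = Z := by
  rw [Bracket, one_smul] at h
  rw [adMap, LinearMap.sub_apply, LinearMap.mulLeft_apply, LinearMap.mulRight_apply, h,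
    add_sub_cancel_left]

theorem mul_eq_add_adMap {W : Type*} [AddCommGroup W] [Module ℂ W] (T X : Module.End ℂ W) :
    T * X = X * T + adMap T X := by
  rw [adMap, LinearMap.sub_apply, LinearMap.mulLeft_apply, LinearMap.mulRight_apply,
    add_sub_cancel]

theorem evLim_annihilationPart_single (g : Gen N) (d : ℤ) (v : V N) :
    ∀ᶠ M in Filter.atTop, annihilationPart g 0 (Finsupp.single d v) =
      ∑ n ∈ Finset.range M, Finsupp.single (d + (-(n : ℤ) - 1)) (g.coeff (-(n : ℤ) - 1) v) := by
  filter_upwards [(isSeries_annihilationPart g 0).evLim (Finsupp.single d v)] with M hM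
  rw [← hM, partialSeries_single, sum_Icc_neg]
  · refine Finset.sum_congr rfl fun n _ => ?_
    rw [annihCoeff_zero, if_pos (by omega)]
  · intro k hk
    rw [annihCoeff_zero, if_neg (by omega)]
    simp

/-- The part `∑_{n>0} Φⁱ_{-n} zⁿ` of the field `Φⁱ(z)`. -/
def phiPos (i : Fin N) : PowerSeries (Module.End ℂ (V N)) :=
  PowerSeries.mk fun k => if k = 0 then 0 else Fock.fC (phiMode i k)

theorem creationPart_Phi (i : Fin N) :
    (creationPart (.Phi i) 0 : PowerSeries (Module.End ℂ (V N))) =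
    PowerSeries.C (Fock.fC (phiMode i 0)) + phiPos i := by
  ext1 k
  rw [map_add, creationPart_zero, Gen.coeff_Phi_nat, PowerSeries.coeff_C, phiPos,
    PowerSeries.coeff_mk]
  split_ifs with h
  · rw [h, add_zero]
  · rw [zero_add]

/-- The bracket of a partial sum of `Q₀` with the coefficient `R_k` of the annihilation part of
`e^α(z)`. Only the creation modes of `Aⁱ` and the zero mode `Aⁱ_0` contribute, each with the
coefficient of `Bⁱ` in `α`. -/
theorem expCoeff_Q0Partial (ε : Lat N → Lat N → ℤˣ) (α : Lat N) (k : ℤ) (M : ℕ) :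
    Q0Partial M * expCoeff ε α k = expCoeff ε α k * Q0Partial M +
      ∑ i, (α.2 i : ℂ) • (∑ n ∈ Finset.range M, expCoeff ε α (k + n + 1) * Fock.fD (psiMode i n) +
        Fock.fC (phiMode i 0) * expCoeff ε α k) := by
  have h1 : ∀ i n, Fock.bC (Sum.inl i, n) * Fock.fD (psiMode i n) * expCoeff ε α k =
      expCoeff ε α k * (Fock.bC (Sum.inl i, n) * Fock.fD (psiMode i n)) +
        (α.2 i : ℂ) • (expCoeff ε α (k + n + 1) * Fock.fD (psiMode i n)) := by
    intro i n
    have h : Fock.bC (Sum.inl i, n) * expCoeff ε α k =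
        expCoeff ε α k * Fock.bC (Sum.inl i, n) + (α.2 i : ℂ) • expCoeff ε α (k + n + 1) := by
      rw [expCoeff_mul_bC]
      exact LinearMap.ext fun v => (sub_add_cancel (_ : V N) _).symm
    rw [mul_assoc, ← expCoeff_mul_fD, ← mul_assoc, h, add_mul, mul_assoc, smul_mul_assoc]
  have h2 : ∀ i n, Fock.fC (phiMode i (n + 1)) * Fock.bD (Sum.inr i, n) * expCoeff ε α k =
      expCoeff ε α k * (Fock.fC (phiMode i (n + 1)) * Fock.bD (Sum.inr i, n)) := by
    intro i n
    rw [mul_assoc, ← expCoeff_mul_bD, ← mul_assoc, ← expCoeff_mul_fC, mul_assoc]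
  have h3 : ∀ i, (Fock.fC (phiMode i 0) * Fock.onIdx fun β => (β.2 i : ℂ)) * expCoeff ε α k =
      expCoeff ε α k * (Fock.fC (phiMode i 0) * Fock.onIdx fun β => (β.2 i : ℂ)) +
        (α.2 i : ℂ) • (Fock.fC (phiMode i 0) * expCoeff ε α k) := by
    intro i
    have h := expCoeff_mul_onIdx ε α k fun β => (β.2 i : ℂ)
    have h4 : (Fock.onIdx (fun β => ((α + β).2 i : ℂ)) : Module.End ℂ (V N)) =
        Fock.onIdx (fun β => (β.2 i : ℂ)) + (α.2 i : ℂ) • 1 :=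
      Fock.ext_single fun β s p => by
        simp only [Fock.onIdx_single, LinearMap.add_apply, LinearMap.smul_apply,
          Module.End.one_apply, Finsupp.smul_single, ← Finsupp.single_add, ← add_smul]
        congr 2
        simp only [Prod.snd_add, Pi.add_apply]
        push_cast
        ring
    rw [mul_assoc, ← h, h4, mul_add, mul_smul_comm, mul_one, mul_add, mul_smul_comm, ← mul_assoc,
      ← mul_assoc, expCoeff_mul_fC]
  rw [Q0Partial_eq, Finset.sum_mul, Finset.mul_sum, ← Finset.sum_add_distrib]
  refine Finset.sum_congr rfl fun i _ => ?_
  simp only [add_mul, mul_add, Finset.sum_mul, Finset.mul_sum, h1, smul_mul_assoc, h2, h3,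
    mul_smul_comm, Finset.sum_add_distrib, smul_add, Finset.smul_sum]
  abel

section

variable {ε : Lat N → Lat N → ℤˣ} (hε : IsTwist ε) (q : ℂ)

include hε

theorem eventually_Q0_expCoeff (α : Lat N) (k : ℤ) (v : V N) :
    ∀ᶠ M in Filter.atTop, Q0 ε q (expCoeff ε α k v) = expCoeff ε α k (Q0 ε q v) +
      ∑ i, (α.2 i : ℂ) • (∑ n ∈ Finset.range M, expCoeff ε α (k + n + 1) (Fock.fD (psiMode i n) v) +
        Fock.fC (phiMode i 0) (expCoeff ε α k v)) := by
  filter_upwards [evLim_Q0 hε q v, evLim_Q0 hε q (expCoeff ε α k v)] with M h1 h2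
  rw [← h1, ← h2]
  have h := LinearMap.congr_fun (expCoeff_Q0Partial ε α k M) v
  simpa only [Module.End.mul_apply, LinearMap.add_apply, LinearMap.sum_apply,
    LinearMap.smul_apply] using h

/-- `[Q₀, R(z)] = ∑ᵢ bᵢ (R(z) Φⁱ(z)₋ + Φⁱ_0 R(z))` for the annihilation part `R(z)` of `e^α(z)`;
here `Φⁱ(z)₋` is the annihilation part of `Φⁱ(z)` and `bᵢ` the coefficient of `Bⁱ` in `α`. -/
theorem lift_Q0_mul_expAnnihilation (α : Lat N) (l : LPoly N) :
    lift (Q0 ε q) (expAnnihilation ε α l) = expAnnihilation ε α (lift (Q0 ε q) l) +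
      ∑ i, (α.2 i : ℂ) • (expAnnihilation ε α (annihilationPart (.Phi i) 0 l) +
        lift (Fock.fC (phiMode i 0)) (expAnnihilation ε α l)) := by
  induction l using Finsupp.induction_linear with
  | zero => simp only [map_zero, add_zero, smul_zero, Finset.sum_const_zero]
  | add f g hf hg =>
    simp only [map_add, hf, hg, smul_add, Finset.sum_add_distrib]
    abel
  | single d v =>
    refine Finsupp.ext fun e => ?_
    have h1 : ∀ᶠ M in Filter.atTop, ∀ i ∈ (Finset.univ : Finset (Fin N)),
        annihilationPart (.Phi i) 0 (Finsupp.single d v) = ∑ n ∈ Finset.range M,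
          Finsupp.single (d + (-(n : ℤ) - 1)) ((Gen.Phi i).coeff (-(n : ℤ) - 1) v) :=
      (Filter.eventually_all_finset _).mpr fun i _ => evLim_annihilationPart_single _ d v
    obtain ⟨M, hM1, hM2⟩ := (h1.and (eventually_Q0_expCoeff hε q α (e - d) v)).exists
    have hR := isSeries_expAnnihilation ε α
    rw [Finsupp.add_apply, lift_apply, hR, hM2, lift_single, hR, Finsupp.finsetSum_apply]
    refine congrArg (_ + ·) (Finset.sum_congr rfl fun i hi => ?_)
    rw [Finsupp.smul_apply, Finsupp.add_apply, lift_apply, hR, hM1 i hi, map_sum,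
      Finsupp.finsetSum_apply]
    refine congrArg (fun w => (α.2 i : ℂ) • (w + _)) (Finset.sum_congr rfl fun n _ => ?_)
    rw [hR, Gen.coeff_Phi_neg, show e - (d + (-(n : ℤ) - 1)) = e - d + n + 1 by ring]

/-- `[Q₀, E(z)] = ∑ᵢ bᵢ Φⁱ(z)₊ E(z)` for the creation part `E(z)` of `e^α(z)`; here `Φⁱ(z)₊` is the
creation part of `Φⁱ(z)` without its constant term `Φⁱ_0`. -/
theorem Q0_mul_expCreation (α : Lat N) :
    PowerSeries.C (Q0 ε q) * expCreation α = expCreation α * PowerSeries.C (Q0 ε q) +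
      ∑ i, (α.2 i : ℂ) • (phiPos i * expCreation α) := by
  set D : ℕ → Module.End ℂ (V N) →ₗ[ℂ] Module.End ℂ (V N) := fun _ => adMap (Q0 ε q) with hDdef
  have hD : ∀ i j x y, D (i + j) (x * y) = D i x * y + x * D j y :=
    fun i j x y => adMap_mul _ _ _
  have hpsi : psMap D (expArg α) = ∑ i, (α.2 i : ℂ) • phiPos i := by
    ext1 k
    rw [map_sum, psMap, PowerSeries.coeff_mk, expArg, PowerSeries.coeff_mk]
    simp only [coeff_smul, phiPos, PowerSeries.coeff_mk]
    split_ifs with hk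
    · simp
    · obtain ⟨m, rfl⟩ := Nat.exists_eq_succ_of_ne_zero hk
      rw [Nat.succ_eq_add_one, map_smul, heis_neg, map_sum, Finset.smul_sum]
      refine Finset.sum_congr rfl fun i _ => ?_
      have hA' : D (m + 1) (Fock.bC (Sum.inl i, m)) = 0 :=
        adMap_of_bracket (bracket_Q0_bC_inl hε q i m)
      have hB' : D (m + 1) (Fock.bC (Sum.inr i, m)) =
          ((m : ℂ) + 1) • Fock.fC (phiMode i (m + 1)) :=
        adMap_of_bracket (bracket_Q0_bC_inr hε q i m)
      rw [map_add, map_smul, map_smul, hA', hB', smul_zero, zero_add, smul_smul, smul_smul]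
      congr 1
      have h3 : ((m : ℂ) + 1) ≠ 0 := by exact_mod_cast Nat.succ_ne_zero m
      push_cast
      field_simp
  have hcomm : Commute (psMap D (expArg α)) (expArg α) := by
    rw [hpsi]
    refine commute_of_coeff (E := Module.End ℂ (V N)) fun a b => ?_
    refine commute_coeff_expArg α (fun k => ?_) b
    rw [map_sum]
    refine Commute.sum_left _ _ _ fun i _ => ?_
    rw [coeff_smul]
    refine (commute_smul _ ?_).symm
    rw [phiPos, PowerSeries.coeff_mk]
    split_ifs
    · exact Commute.zero_right _
    · exact (Fock.fC_mul_bC _ k).symm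
  have h0 : PowerSeries.coeff 0 (expArg α : PowerSeries (Module.End ℂ (V N))) = 0 := by
    rw [expArg, PowerSeries.coeff_mk, if_pos rfl]
  have h := psMap_psExp hD h0 hcomm
  rw [hpsi, ← expCreation_eq, Finset.sum_mul] at h
  simp only [smul_mul_assoc] at h
  rw [← h]
  ext1 k
  rw [map_add, PowerSeries.coeff_C_mul, PowerSeries.coeff_mul_C, psMap, PowerSeries.coeff_mk]
  exact mul_eq_add_adMap _ _

theorem Q0_coeff (g : Gen N) (n : ℕ) (x : V N) :
    Q0 ε q (g.coeff n x) = g.sgn • g.coeff n (Q0 ε q x) +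
      g.dScalar n • g.d.coeff ((n + g.dShift : ℕ) : ℤ) x := by
  have h := LinearMap.congr_fun (bracket_Q0_coeff hε q g n) x
  simpa only [Module.End.mul_apply, LinearMap.add_apply, LinearMap.smul_apply, Nat.cast_add] using h

theorem Q0_parity (x : V N) : Q0 ε q (Fock.parity x) = -Fock.parity (Q0 ε q x) :=
  LinearMap.congr_fun (Q0_mul_parity hε q) x

theorem Q0_twist (g : Gen N) (x : V N) : Q0 ε q (g.twist x) = g.sgn • g.twist (Q0 ε q x) := by
  cases h : g.odd <;> simp [Gen.twist, Gen.sgn, h, Q0_parity hε q]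

/-- `Q₀ e^α = ∑ᵢ bᵢ Φⁱ_0 e^α`, with `bᵢ` the coefficient of `Bⁱ` in `α`. -/
theorem Q0_expVec (α : Lat N) :
    Q0 ε q (expVec α) = ∑ i, (α.2 i : ℂ) • (Gen.Phi i).coeff ((0 : ℕ) : ℤ) (expVec α) := by
  obtain ⟨M, hM⟩ := (evLim_Q0 hε q (expVec α)).exists
  rw [← hM, Q0Partial_eq, LinearMap.sum_apply]
  refine Finset.sum_congr rfl fun i _ => ?_
  rw [Gen.coeff_Phi_nat]
  have h1 : ∀ n, Fock.fD (psiMode i n) (expVec α) = 0 := fun n => by simp [expVec]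
  have h2 : ∀ n, Fock.bD (Sum.inr i, n) (expVec α) = 0 := fun n => by
    rw [expVec, Fock.bD_single, (pderiv _).map_one_eq_zero, Finsupp.single_zero]
  simp only [LinearMap.add_apply, LinearMap.sum_apply, Module.End.mul_apply, LinearMap.smul_apply,
    h1, h2, map_zero, smul_zero, Finset.sum_const_zero, zero_add]
  rw [expVec, Fock.onIdx_single, ← Finsupp.smul_single, map_smul]

end

theorem Gen.parity_twist (g : Gen N) (x : V N) : Fock.parity (g.twist x) = g.d.twist x := by
  have h := LinearMap.congr_fun
    (Fock.parity_mul_parity (I := Lat N) (F := FMode N) (K := BMode N)) x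
  cases hg : g.odd <;> simp_all [Gen.twist, Gen.odd_d]

theorem Gen.twist_parity (g : Gen N) (x : V N) : g.twist (Fock.parity x) = g.d.twist x := by
  have h := LinearMap.congr_fun
    (Fock.parity_mul_parity (I := Lat N) (F := FMode N) (K := BMode N)) x
  cases hg : g.odd <;> simp_all [Gen.twist, Gen.odd_d]

theorem commute_C_fC_expCreation (f : FMode N) (α : Lat N) :
    PowerSeries.C (Fock.fC f) * expCreation α = expCreation α * PowerSeries.C (Fock.fC f) := by
  have h : ∀ m, Commute (Fock.fC f) (PowerSeries.coeff m (expCreation α)) := fun m =>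
    commute_coeff_expCreation α (fun k => Fock.fC_mul_bC f k) m
  ext1 m
  rw [PowerSeries.coeff_C_mul, PowerSeries.coeff_mul_C]
  exact h m

theorem cauchy_sum_smul (c : Fin N → ℂ) (f : Fin N → PowerSeries (Module.End ℂ (V N))) :
    cauchy (∑ i, c i • f i) = ∑ i, c i • cauchy (f i) := by
  induction (Finset.univ : Finset (Fin N)) using Finset.cons_induction with
  | empty =>
    rw [Finset.sum_empty, Finset.sum_empty]
    have := cauchy_smul (N := N) 0 0
    rwa [zero_smul, zero_smul] at this
  | cons a t ha ih => rw [Finset.sum_cons, Finset.sum_cons, cauchy_add, cauchy_smul, ih]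

theorem preField_Phi_expVec (ε : Lat N → Lat N → ℤˣ) (C : PowerSeries (Module.End ℂ (V N)))
    (α : Lat N) (i : Fin N)
    (l : LPoly N) (e : ℤ) :
    preField ε C ((Gen.Phi i).coeff ((0 : ℕ) : ℤ) (expVec α)) l e =
      cauchy (C * expCreation α) (lift (Fock.fC (phiMode i 0)) (expAnnihilation ε α l)) e +
        cauchy (C * phiPos i * expCreation α) (expAnnihilation ε α l) e +
        cauchy (C * expCreation α) (expAnnihilation ε α (annihilationPart (.Phi i) 0 l)) e := by
  rw [preField_coeff, twist_expVec, creationPart_Phi, mul_add, preField_add]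
  simp only [preField_expVec, LinearMap.add_apply, LinearMap.comp_apply, Pi.add_apply]
  rw [mul_assoc C, commute_C_fC_expCreation, ← mul_assoc, cauchy_mul_C]
  rfl

section

variable {ε : Lat N → Lat N → ℤˣ}

/-- The bracket of `Q` with the field of `x` is the field of `Q x`; here the field is multiplied
from the left by a series `C` whose bracket with `Q` is `C'`. -/
def BracketField (ε : Lat N → Lat N → ℤˣ) (Q : Module.End ℂ (V N)) (x : V N) : Prop :=
  ∀ (C C' : PowerSeries (Module.End ℂ (V N))) (s : ℂ)
    (_ : PowerSeries.C Q * C = s • (C * PowerSeries.C Q) + C') (l : LPoly N) (e : ℤ),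
    Q (preField ε C x l e) = preField ε C' x l e +
      s • (preField ε C (Q x) l e + preField ε C (Fock.parity x) (lift Q l) e)

theorem BracketField.add {Q : Module.End ℂ (V N)} {v w : V N} (hv : BracketField ε Q v)
    (hw : BracketField ε Q w) : BracketField ε Q (v + w) := by
  intro C C' s hC l e
  simp only [map_add, LinearMap.add_apply, Pi.add_apply, hv C C' s hC l e, hw C C' s hC l e]
  module

theorem BracketField.smul {Q : Module.End ℂ (V N)} {v : V N} (c : ℂ) (hv : BracketField ε Q v) :
    BracketField ε Q (c • v) := by
  intro C C' s hC l e
  simp only [map_smul, LinearMap.smul_apply, Pi.smul_apply, hv C C' s hC l e]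
  module

end

section

variable {ε : Lat N → Lat N → ℤˣ} (hε : IsTwist ε) (q : ℂ)

include hε

theorem Q0_cauchy_expCreation (C C' : PowerSeries (Module.End ℂ (V N))) (s : ℂ)
    (hC : PowerSeries.C (Q0 ε q) * C = s • (C * PowerSeries.C (Q0 ε q)) + C') (α : Lat N)
    (l : LPoly N) (e : ℤ) :
    Q0 ε q (cauchy (C * expCreation α) l e) = cauchy (C' * expCreation α) l e +
      s • (cauchy (C * expCreation α) (lift (Q0 ε q) l) e +
        ∑ i, (α.2 i : ℂ) • cauchy (C * phiPos i * expCreation α) l e) := by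
  have h1 : PowerSeries.C (Q0 ε q) * (C * expCreation α) =
      C' * expCreation α + s • ((C * expCreation α) * PowerSeries.C (Q0 ε q) +
        ∑ i, (α.2 i : ℂ) • (C * phiPos i * expCreation α)) := by
    rw [← mul_assoc, hC, add_mul, smul_mul_assoc, mul_assoc C, Q0_mul_expCreation hε q, mul_add,
      Finset.mul_sum, add_comm, mul_assoc]
    simp only [mul_smul_comm, mul_assoc]
  rw [apply_cauchy, h1, cauchy_add, cauchy_smul, cauchy_add, cauchy_mul_C, cauchy_sum_smul]
  simp only [LinearMap.add_apply, LinearMap.smul_apply, LinearMap.comp_apply, Pi.add_apply,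
    Pi.smul_apply, LinearMap.sum_apply, Finset.sum_apply]

/-- The brackets of `Q₀` with the two parts of `e^α(z)` add up to `∑ᵢ bᵢ :Φⁱ(z) e^α(z):`, the field
of `Q₀ e^α`. -/
theorem bracketField_expVec (α : Lat N) : BracketField ε (Q0 ε q) (expVec α) := by
  intro C C' s hC l e
  have hγ : Fock.parity (expVec α) = expVec α := by simp [expVec]
  have h2 : preField ε C (Q0 ε q (expVec α)) l e = ∑ i, (α.2 i : ℂ) •
      preField ε C ((Gen.Phi i).coeff ((0 : ℕ) : ℤ) (expVec α)) l e := by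
    rw [Q0_expVec hε q]
    simp only [map_sum, map_smul, LinearMap.sum_apply, LinearMap.smul_apply, Finset.sum_apply,
      Pi.smul_apply]
  have h3 : cauchy (C * expCreation α) (lift (Q0 ε q) (expAnnihilation ε α l)) e =
      cauchy (C * expCreation α) (expAnnihilation ε α (lift (Q0 ε q) l)) e +
      ∑ i, (α.2 i : ℂ) •
        (cauchy (C * expCreation α) (expAnnihilation ε α (annihilationPart (.Phi i) 0 l)) e +
          cauchy (C * expCreation α) (lift (Fock.fC (phiMode i 0)) (expAnnihilation ε α l)) e) := by
    rw [lift_Q0_mul_expAnnihilation hε q]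
    simp only [map_add, map_sum, map_smul, Finset.sum_apply, Pi.smul_apply, Pi.add_apply]
  rw [hγ, h2]
  simp only [preField_Phi_expVec]
  rw [preField_expVec, preField_expVec, LinearMap.comp_apply, LinearMap.comp_apply,
    LinearMap.comp_apply, Q0_cauchy_expCreation hε q C C' s hC, h3]
  generalize cauchy (C * expCreation α) (expAnnihilation ε α (lift (Q0 ε q) l)) e = w₀
  simp only [smul_add, Finset.sum_add_distrib]
  abel

/-- The induction step: one more factor `∂ⁿg(z) / n!` in the normally ordered product. The parity of
`x` enters because an odd factor is moved past the field of `x` with a sign. -/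
theorem BracketField.coeff (g : Gen N) (n : ℕ) {x : V N} (hx : BracketField ε (Q0 ε q) x)
    (hx' : BracketField ε (Q0 ε q) (Fock.parity x)) : BracketField ε (Q0 ε q) (g.coeff n x) := by
  intro C C' s hC l e
  have htw : BracketField ε (Q0 ε q) (g.twist x) := by
    cases h : g.odd
    · simpa [Gen.twist, h] using hx
    · simpa [Gen.twist, h] using hx'
  have hC2 : PowerSeries.C (Q0 ε q) * (C * creationPart g n) =
      (s * g.sgn) • (C * creationPart g n * PowerSeries.C (Q0 ε q)) +
        ((s * g.dScalar n) • (C * creationPart g.d (n + g.dShift)) + C' * creationPart g n) := by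
    rw [← mul_assoc, hC, add_mul, smul_mul_assoc, mul_assoc C, Q0_mul_creationPart hε q, mul_add,
      mul_smul_comm, mul_smul_comm, smul_add, smul_smul, smul_smul, mul_assoc, add_assoc]
  have hγ : Fock.parity (g.coeff n x) = g.sgn • g.coeff n (Fock.parity x) :=
    LinearMap.congr_fun (g.parity_mul_coeff n) x
  have hl : lift (Q0 ε q) (annihilationPart g n l) =
      g.sgn • annihilationPart g n (lift (Q0 ε q) l) +
        g.dScalar n • annihilationPart g.d (n + g.dShift) l :=
    LinearMap.congr_fun (lift_Q0_mul_annihilationPart hε q g n) l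
  rw [hγ, Q0_coeff hε q]
  simp only [map_add, map_smul, LinearMap.add_apply, LinearMap.smul_apply, Pi.add_apply,
    Pi.smul_apply]
  simp only [preField_coeff, LinearMap.add_apply, LinearMap.comp_apply, Pi.add_apply, map_add]
  rw [hx _ _ _ hC2, htw _ _ _ hC, hl, Q0_twist hε q, Gen.parity_twist, Gen.twist_parity,
    preField_add, preField_smul]
  simp only [map_add, map_smul, LinearMap.add_apply, LinearMap.smul_apply, Pi.add_apply,
    Pi.smul_apply]
  module

/-- The bracket of `Q₀` with the field of `x` is the field of `Q₀ x`. -/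
theorem bracketField_Q0 (x : V N) : BracketField ε (Q0 ε q) x := by
  suffices h : BracketField ε (Q0 ε q) x ∧ BracketField ε (Q0 ε q) (Fock.parity x) from h.1
  induction x using V_induction with
  | hexp α =>
    have hγ : Fock.parity (expVec α) = expVec α := by simp [expVec]
    rw [hγ]
    exact ⟨bracketField_expVec hε q α, bracketField_expVec hε q α⟩
  | hadd v w hv hw =>
    rw [map_add]
    exact ⟨hv.1.add hw.1, hv.2.add hw.2⟩
  | hsmul c v hv =>
    rw [map_smul]
    exact ⟨hv.1.smul c, hv.2.smul c⟩
  | hcoeff g n x ih =>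
    refine ⟨ih.1.coeff hε q g n ih.2, ?_⟩
    have hγ : Fock.parity (g.coeff n x) = g.sgn • g.coeff n (Fock.parity x) :=
      LinearMap.congr_fun (g.parity_mul_coeff n) x
    have h2 : Fock.parity (Fock.parity x) = x := LinearMap.congr_fun Fock.parity_mul_parity x
    rw [hγ]
    exact (ih.2.coeff hε q g n (h2.symm ▸ ih.1)).smul _

theorem Q0_nProd (n : ℤ) (x y : V N) : Q0 ε q (nProd ε n x y) =
    nProd ε n (Q0 ε q x) y + nProd ε n (Fock.parity x) (Q0 ε q y) := by
  have h := bracketField_Q0 hε q x 1 0 1 (by simp) (Finsupp.single 0 y) (-n - 1)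
  rw [preField_zero, lift_single, one_smul] at h
  simp only [nProd_eq]
  rw [h]
  exact zero_add _

theorem Q0_onIdx (c : Lat N → ℂ) (x : V N) :
    Q0 ε q (Fock.onIdx c x) = Fock.onIdx c (Q0 ε q x) := by
  have h := LinearMap.congr_fun (bracket_Q0_onIdx hε q c) x
  simpa using h

/-- `Q₀` is an odd derivation of all products of `V_{L,q}`. -/
theorem Q0_qProd (n : ℤ) (x y : V N) : Q0 ε q (qProd ε q n x y) =
    qProd ε q n (Q0 ε q x) y + qProd ε q n (Fock.parity x) (Q0 ε q y) := by
  induction x using Finsupp.induction_linear with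
  | zero => simp only [map_zero, LinearMap.zero_apply, add_zero]
  | add v w hv hw =>
    simp only [map_add, LinearMap.add_apply, hv, hw]
    abel
  | single a p =>
    obtain ⟨α, s⟩ := a
    have h1 := inSector_single α s p
    have h2 : InSector α (Q0 ε q (Finsupp.single (α, s) p)) :=
      h1.apply fun c => LinearMap.ext fun v => (Q0_onIdx hε q c v).symm
    have h3 : InSector α (Fock.parity (Finsupp.single (α, s) p)) :=
      h1.apply fun c => (Fock.parity_mul_onIdx c).symm
    rw [qProd_of_inSector _ _ _ h1, qProd_of_inSector _ _ _ h2, qProd_of_inSector _ _ _ h3,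
      Q0_nProd hε q, qShift, Q0_onIdx hε q]

end

/-! ### The operator `D` squares to zero -/

theorem span_anticomm {W : Type*} [AddCommGroup W] [Module ℂ W] {S T : Set (Module.End ℂ W)}
    (h : ∀ X ∈ S, ∀ Y ∈ T, X * Y = -(Y * X)) {X Y : Module.End ℂ W}
    (hX : X ∈ Submodule.span ℂ S) (hY : Y ∈ Submodule.span ℂ T) : X * Y = -(Y * X) := by
  induction hX, hY using Submodule.span_induction₂ with
  | mem_mem x y hx hy => exact h x hx y hy
  | zero_left => simp
  | zero_right => simp
  | add_left x y z _ _ _ h1 h2 => rw [add_mul, mul_add, h1, h2, neg_add]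
  | add_right x y z _ _ _ h1 h2 => rw [add_mul, mul_add, h1, h2, neg_add]
  | smul_left c x y _ _ h1 => rw [smul_mul_assoc, mul_smul_comm, h1, smul_neg]
  | smul_right c x y _ _ h1 => rw [smul_mul_assoc, mul_smul_comm, h1, smul_neg]

theorem apply_of_mul_eq {W : Type*} [AddCommGroup W] [Module ℂ W] {S T S' T' : Module.End ℂ W}
    (h : S * T = S' * T') (v : W) : S (T v) = S' (T' v) := LinearMap.congr_fun h v

/-- The operators `R_k` of `e^α(z)`, deformed by the powers of `q` of the products of `V_{L,q}`. -/
def expCoeffQ (ε : Lat N → Lat N → ℤˣ) (q : ℂ) (α : Lat N) (k : ℤ) : Module.End ℂ (V N) :=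
  expCoeff ε α k * qShift q α

theorem defect_comm_add (α β γ : Lat N) :
    defect β γ + defect α (β + γ) = defect α γ + defect β (α + γ) := by
  have h1 := ht_add_le β.1 γ.1
  have h2 := ht_add_le α.1 (β.1 + γ.1)
  have h3 := ht_add_le α.1 γ.1
  have h4 := ht_add_le β.1 (α.1 + γ.1)
  simp only [defect, Prod.fst_add]
  rw [add_left_comm β.1 α.1 γ.1] at h4 ⊢
  omega

theorem form_of_snd_eq_zero {α : Lat N} (hα : α.2 = 0) (β : Lat N) :
    form α β = ∑ i, α.1 i * β.2 i := by
  simp [form, hα]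

theorem form_add_right (α β γ : Lat N) : form α (β + γ) = form α β + form α γ := by
  simp only [form, Prod.fst_add, Prod.snd_add, Pi.add_apply, ← Finset.sum_add_distrib]
  exact Finset.sum_congr rfl fun i _ => by ring

theorem expCoeff_expVec (ε : Lat N → Lat N → ℤˣ) (α β : Lat N) (k : ℤ) :
    expCoeff ε α k (expVec β) =
      if k = form α β then ((ε α β : ℤ) : ℂ) • expVec (α + β) else 0 := by
  rw [expVec, expCoeff_single, ← C_1, zcoeff_expShift_C]
  by_cases h : k = form α β
  · rw [if_pos h, if_pos (by omega)]; rfl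
  · rw [if_neg h, if_neg (by omega), Finsupp.single_zero, smul_zero]

theorem qShift_expVec (q : ℂ) (α β : Lat N) :
    qShift q α (expVec β) = q ^ defect α β • (expVec β : V N) := by
  rw [qShift, expVec, Fock.onIdx_single, Finsupp.smul_single]

theorem qShift_coeff (q : ℂ) (α : Lat N) (g : Gen N) (e : ℤ) (v : V N) :
    qShift q α (g.coeff e v) = g.coeff e (qShift q α v) :=
  apply_of_mul_eq (g.coeff_mul_onIdx e fun β => q ^ defect α β) v

/-- The bracket of `R_k` with a creation operator. -/
theorem expCoeff_coeff_nat (ε : Lat N → Lat N → ℤˣ) {α : Lat N} (hα : α.2 = 0) (g : Gen N) (n : ℕ) :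
    ((∀ i, g ≠ Gen.B i) ∧ ∀ k, ∀ v : V N,
      expCoeff ε α k (g.coeff n v) = g.coeff n (expCoeff ε α k v)) ∨
      ∃ i, g = Gen.B i ∧ ∀ k, ∀ v : V N, expCoeff ε α k (g.coeff n v) =
        g.coeff n (expCoeff ε α k v) - (α.1 i : ℂ) • expCoeff ε α (k + n + 1) v := by
  cases g with
  | A i =>
    left; refine ⟨by simp, fun k v => ?_⟩
    rw [Gen.coeff_A_nat]
    have h := LinearMap.congr_fun (expCoeff_mul_bC ε α k (Sum.inl i) n) v
    have h2 : pairing α (Sum.inl i) = 0 := by simp [pairing, hα]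
    rw [h2] at h
    refine h.trans ?_
    exact (congrArg (fun w => _ - w) (zero_smul ℂ _)).trans (sub_zero (_ : V N))
  | B i =>
    right; refine ⟨i, rfl, fun k v => ?_⟩
    rw [Gen.coeff_B_nat]
    exact LinearMap.congr_fun (expCoeff_mul_bC ε α k (Sum.inr i) n) v
  | Phi i =>
    left; refine ⟨by simp, fun k v => ?_⟩
    rw [Gen.coeff_Phi_nat]
    exact apply_of_mul_eq (expCoeff_mul_fC ε α k _) v
  | Psi i =>
    left; refine ⟨by simp, fun k v => ?_⟩
    rw [Gen.coeff_Psi_nat]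
    exact apply_of_mul_eq (expCoeff_mul_fC ε α k _) v

section

variable {ε : Lat N → Lat N → ℤˣ} (hε : IsTwist ε) (q : ℂ)

include hε

/-- The powers of `q` agree by the cocycle identity `defect_comm_add`, the rest because `L_A` is
isotropic. -/
theorem expCoeffQ_comm {α β : Lat N} (hα : α.2 = 0) (hβ : β.2 = 0) (j k : ℤ) (v : V N) :
    expCoeffQ ε q α j (expCoeffQ ε q β k v) = expCoeffQ ε q β k (expCoeffQ ε q α j v) := by
  simp only [expCoeffQ, Module.End.mul_apply]
  induction v using V_induction generalizing j k with
  | hexp γ =>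
    have h1 : form α (β + γ) = form α γ := by
      rw [form_add_right, form_of_snd_eq_zero hα]; simp [hβ]
    have h2 : form β (α + γ) = form β γ := by
      rw [form_add_right, form_of_snd_eq_zero hβ]; simp [hα]
    by_cases h3 : j = form α γ
    · by_cases h4 : k = form β γ
      · simp only [map_smul, qShift_expVec, expCoeff_expVec, hε.trivial_left α _ hα,
          hε.trivial_left β _ hβ, h1, h2, if_pos h3, if_pos h4, smul_smul, add_left_comm α β γ]
        have h := congrArg (q ^ ·) (defect_comm_add α β γ)
        simp only [pow_add] at h
        simp [h]
      · simp only [map_smul, qShift_expVec, expCoeff_expVec, h2, if_pos h3, if_neg h4,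
          map_zero, smul_zero]
    · by_cases h4 : k = form β γ
      · simp only [map_smul, qShift_expVec, expCoeff_expVec, h1, if_neg h3, if_pos h4,
          map_zero, smul_zero]
      · simp only [map_smul, qShift_expVec, expCoeff_expVec, if_neg h3, if_neg h4,
          map_zero, smul_zero]
  | hadd v w hv hw => simp only [map_add, hv, hw]
  | hsmul c v hv => simp only [map_smul, hv]
  | hcoeff g n v ih =>
    simp only [qShift_coeff]
    rcases expCoeff_coeff_nat ε hα g n with ⟨_, h1⟩ | ⟨i, rfl, h1⟩
    · rcases expCoeff_coeff_nat ε hβ g n with ⟨_, h2⟩ | ⟨i, rfl, h2⟩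
      · simp only [h1, h2, qShift_coeff, ih]
      · simp only [h1, h2, qShift_coeff, ih, map_sub, map_smul]
    · rcases expCoeff_coeff_nat ε hβ (Gen.B i) n with ⟨_, h2⟩ | ⟨i', hi, h2⟩
      · simp only [h1, h2, qShift_coeff, ih, map_sub, map_smul]
      · obtain rfl : i = i' := by simpa using hi
        simp only [h1, h2, qShift_coeff, ih, map_sub, map_smul]
        module

end

theorem commute_coeff_expCreation_of_snd_eq_zero {α : Lat N} (hα : α.2 = 0)
    {X : Module.End ℂ (V N)} (h : ∀ i n, Commute X (Fock.bC (Sum.inl i, n))) (m : ℕ) :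
    Commute X (PowerSeries.coeff m (expCreation α)) := by
  rw [expCreation_eq]
  refine commute_coeff_psExp (fun k => ?_) m
  rw [expArg, PowerSeries.coeff_mk]
  split_ifs with hk
  · exact Commute.zero_right _
  · obtain ⟨k, rfl⟩ := Nat.exists_eq_succ_of_ne_zero hk
    rw [Nat.succ_eq_add_one, heis_neg]
    refine commute_smul _ (Commute.sum_right _ _ _ fun i _ => ?_)
    simp only [hα, Pi.zero_apply, Int.cast_zero, zero_smul, add_zero]
    exact commute_smul _ (h i k)

/-- The operators of which the operator `(Ψⁱ_{-1} e^α)₍₀₎` is a locally finite sum. -/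
def psiExpSet (ε : Lat N → Lat N → ℤˣ) (q : ℂ) (i : Fin N) (α : Lat N) :
    Set (Module.End ℂ (V N)) :=
  {X | ∃ (e : ℤ) (j : ℕ) (k : ℤ), X = (Gen.Psi i).coeff e *
    (PowerSeries.coeff j (expCreation α) * expCoeffQ ε q α k)}

theorem Psi_anticomm (i i' : Fin N) (e e' : ℤ) (v : V N) :
    (Gen.Psi i).coeff e ((Gen.Psi i').coeff e' v) =
    -(Gen.Psi i').coeff e' ((Gen.Psi i).coeff e v) := by
  have h : ∀ e : ℤ, (∃ n : ℕ, e = -(n : ℤ) - 1) ∨ ∃ n : ℕ, e = n := fun e => by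
    rcases lt_or_ge e 0 with h | h
    · exact Or.inl ⟨(-e - 1).toNat, by omega⟩
    · exact Or.inr ⟨e.toNat, by omega⟩
  rcases h e with ⟨n, rfl⟩ | ⟨n, rfl⟩ <;> rcases h e' with ⟨m, rfl⟩ | ⟨m, rfl⟩ <;>
    simp only [Gen.coeff_Psi_neg, Gen.coeff_Psi_nat]
  · exact LinearMap.congr_fun (Fock.fD_mul_fD _ _) v
  · have h := LinearMap.congr_fun
      (Fock.fD_mul_fC (I := Lat N) (K := BMode N) (phiMode i n) (psiMode i' m)) v
    simpa using h
  · have h := LinearMap.congr_fun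
      (Fock.fD_mul_fC (I := Lat N) (K := BMode N) (phiMode i' m) (psiMode i n)) v
    have h2 : Fock.fD (phiMode i' m) (Fock.fC (psiMode i n) v) =
      -Fock.fC (psiMode i n) (Fock.fD (phiMode i' m) v) := by simpa using h
    rw [h2, neg_neg]
  · exact LinearMap.congr_fun (Fock.fC_mul_fC _ _) v

theorem Psi_expCreation (i : Fin N) (e : ℤ) (α : Lat N) (m : ℕ) (v : V N) :
    (Gen.Psi i).coeff e (PowerSeries.coeff m (expCreation α) v) =
      PowerSeries.coeff m (expCreation α) ((Gen.Psi i).coeff e v) := by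
  have h : ∀ k, Commute ((Gen.Psi i).coeff e) (Fock.bC k : Module.End ℂ (V N)) := by
    intro k
    rcases lt_or_ge e 0 with h | h
    · obtain ⟨f, hf⟩ := Gen.coeff_neg_of_odd (g := Gen.Psi i) rfl h
      rw [hf]
      exact Fock.fD_mul_bC f _
    · obtain ⟨n, rfl⟩ := Int.eq_ofNat_of_zero_le h
      exact commute_coeff_nat_bC _ _ _
  exact apply_of_mul_eq (commute_coeff_expCreation α h m) v

theorem Psi_expCoeffQ (ε : Lat N → Lat N → ℤˣ) (q : ℂ) (i : Fin N) (e : ℤ) (α : Lat N) (k : ℤ)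
    (v : V N) : (Gen.Psi i).coeff e (expCoeffQ ε q α k v) =
      expCoeffQ ε q α k ((Gen.Psi i).coeff e v) := by
  rw [expCoeffQ, Module.End.mul_apply, Module.End.mul_apply, qShift_coeff]
  generalize qShift q α v = w
  rcases lt_or_ge e 0 with h | h
  · obtain ⟨f, hf⟩ := Gen.coeff_neg_of_odd (g := Gen.Psi i) rfl h
    rw [hf]
    exact (apply_of_mul_eq (expCoeff_mul_fD ε α k f) w).symm
  · obtain ⟨n, rfl⟩ := Int.eq_ofNat_of_zero_le h
    rw [Gen.coeff_Psi_nat]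
    exact (apply_of_mul_eq (expCoeff_mul_fC ε α k _) w).symm

theorem expCreation_expCreation (α β : Lat N) (j k : ℕ) (v : V N) :
    PowerSeries.coeff j (expCreation α) (PowerSeries.coeff k (expCreation β) v) =
      PowerSeries.coeff k (expCreation β) (PowerSeries.coeff j (expCreation α) v) := by
  have h1 : ∀ l, Commute (Fock.bC l) (PowerSeries.coeff k (expCreation β) : Module.End ℂ (V N)) :=
    fun l => commute_coeff_expCreation β (fun l' => Fock.bC_mul_bC l l') k
  have h2 : Commute (PowerSeries.coeff k (expCreation β) : Module.End ℂ (V N))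
      (PowerSeries.coeff j (expCreation α)) :=
    commute_coeff_expCreation α (fun l => (h1 l).symm) j
  exact apply_of_mul_eq h2.symm v

theorem expCreation_expCoeffQ (ε : Lat N → Lat N → ℤˣ) (q : ℂ) {α β : Lat N} (hα : α.2 = 0)
    (hβ : β.2 = 0) (j : ℕ) (k : ℤ) (v : V N) :
    PowerSeries.coeff j (expCreation α) (expCoeffQ ε q β k v) =
      expCoeffQ ε q β k (PowerSeries.coeff j (expCreation α) v) := by
  have h : ∀ i n, Commute (expCoeffQ ε q β k) (Fock.bC (Sum.inl i, n) : Module.End ℂ (V N)) := by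
    intro i n
    refine LinearMap.ext fun w => ?_
    rw [Module.End.mul_apply, Module.End.mul_apply, expCoeffQ, Module.End.mul_apply,
      Module.End.mul_apply, ← Gen.coeff_A_nat, qShift_coeff]
    rcases expCoeff_coeff_nat ε hβ (Gen.A i) n with ⟨_, h1⟩ | ⟨i', hi, h1⟩
    · rw [h1]
    · cases hi
  exact (apply_of_mul_eq (commute_coeff_expCreation_of_snd_eq_zero hα h j) v).symm

/-- All coefficients of `Ψⁱ(z)` anticommute with all those of `Ψⁱ'(w)`, and they commute with the
coefficients of `e^α(z)` and `e^β(w)`; for `α, β ∈ L_A` the latter commute with each other. -/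
theorem psiExpSet_anticomm {ε : Lat N → Lat N → ℤˣ} (hε : IsTwist ε) (q : ℂ) (i i' : Fin N)
    {α β : Lat N} (hα : α.2 = 0) (hβ : β.2 = 0) :
    ∀ X ∈ psiExpSet ε q i α, ∀ Y ∈ psiExpSet ε q i' β, X * Y = -(Y * X) := by
  rintro _ ⟨e, j, k, rfl⟩ _ ⟨e', j', k', rfl⟩
  refine LinearMap.ext fun v => ?_
  simp only [Module.End.mul_apply, LinearMap.neg_apply]
  rw [← Psi_expCoeffQ, ← Psi_expCreation i' e' α, Psi_anticomm, ← expCreation_expCoeffQ ε q hβ hα,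
    expCreation_expCreation, expCoeffQ_comm hε q hα hβ, expCreation_expCoeffQ ε q hα hβ,
    Psi_expCreation i e β, Psi_expCoeffQ]

/-- Partial sums of `(Ψⁱ_{-1} e^α)₍₀₎`. -/
def psiExpPartial (ε : Lat N → Lat N → ℤˣ) (q : ℂ) (i : Fin N) (α : Lat N) (M : ℕ) :
    Module.End ℂ (V N) :=
  LinearMap.proj (-1) ∘ₗ
    (cauchy (creationPart (.Psi i) 0 * expCreation α) ∘ₗ partialSeries (expCoeff ε α) M +
      cauchy (expCreation α) ∘ₗ partialSeries (expCoeff ε α) M ∘ₗ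
        partialSeries (annihCoeff (.Psi i) 0) M) ∘ₗ Finsupp.lsingle 0 ∘ₗ qShift q α

theorem evLim_psiExpPartial (ε : Lat N → Lat N → ℤˣ) (q : ℂ) (i : Fin N) (α : Lat N) :
    EvLim (V := V N) (W := V N) (psiExpPartial ε q i α)
      (qProd ε q 0 ((Gen.Psi i).coeff ((0 : ℕ) : ℤ) (expVec α))) := by
  have hR := (isSeries_expAnnihilation ε α).evLim
  have hP := (isSeries_annihilationPart (N := N) (.Psi i) 0).evLim
  have h1 := ((EvLim.const (cauchy (creationPart (.Psi i) 0 * expCreation α))).comp hR).add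
    ((EvLim.const (cauchy (expCreation α))).comp (hR.comp hP))
  have h2 := (EvLim.const (LinearMap.proj (R := ℂ) (φ := fun _ : ℤ => V N) (-1))).comp
    (h1.comp (EvLim.const (Finsupp.lsingle 0 ∘ₗ qShift q α)))
  intro v
  filter_upwards [h2 v] with M hM
  have h3 : InSector α ((Gen.Psi i).coeff ((0 : ℕ) : ℤ) (expVec α)) :=
    (inSector_single α ∅ 1).apply fun c => Gen.coeff_mul_onIdx _ _ _
  rw [qProd_of_inSector _ _ _ h3, nProd_eq, preField_coeff, twist_expVec, preField_expVec,
    preField_expVec, one_mul, one_mul]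
  exact hM

theorem psiExpPartial_mem (ε : Lat N → Lat N → ℤˣ) (q : ℂ) (i : Fin N) (α : Lat N) (M : ℕ) :
    psiExpPartial ε q i α M ∈ Submodule.span ℂ (psiExpSet ε q i α) := by
  have h1 : ∀ k v, cauchy (creationPart (.Psi i) 0 * expCreation α)
      (Finsupp.single k (expCoeff ε α k (qShift q α v))) (-1) =
      if k ≤ -1 then ∑ x ∈ Finset.HasAntidiagonal.antidiagonal (-1 - k).toNat,
        (Gen.Psi i).coeff x.1 (PowerSeries.coeff x.2 (expCreation α) (expCoeffQ ε q α k v))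
      else 0 := by
    intro k v
    rw [cauchy_single, PowerSeries.coeff_mul]
    split_ifs
    · rw [LinearMap.sum_apply]
      refine Finset.sum_congr rfl fun x _ => ?_
      rw [creationPart_zero]; rfl
    · rfl
  have h2 : ∀ l k v, cauchy (expCreation α)
      (Finsupp.single (l + k) (expCoeff ε α k (annihCoeff (.Psi i) 0 l (qShift q α v)))) (-1) =
      if l + k ≤ -1 ∧ l < 0 then (Gen.Psi i).coeff l
        (PowerSeries.coeff (-1 - (l + k)).toNat (expCreation α) (expCoeffQ ε q α k v))
      else 0 := by
    intro l k v
    rw [cauchy_single, annihCoeff_zero]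
    by_cases hl : l < 0
    · rw [if_pos hl, ← qShift_coeff, Psi_expCreation, Psi_expCoeffQ]
      simp only [hl, and_true]
      rfl
    · rw [if_neg hl, LinearMap.zero_apply, map_zero, map_zero, ite_self, if_neg (fun h => hl h.2)]
  have h3 : psiExpPartial ε q i α M =
      ∑ k ∈ Finset.Icc (-(M : ℤ)) M, (if k ≤ -1 then
        ∑ x ∈ Finset.HasAntidiagonal.antidiagonal (-1 - k).toNat,
          (Gen.Psi i).coeff x.1 * (PowerSeries.coeff x.2 (expCreation α) * expCoeffQ ε q α k)
        else 0) +
      ∑ l ∈ Finset.Icc (-(M : ℤ)) M, ∑ k ∈ Finset.Icc (-(M : ℤ)) M,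
        (if l + k ≤ -1 ∧ l < 0 then (Gen.Psi i).coeff l *
          (PowerSeries.coeff (-1 - (l + k)).toNat (expCreation α) * expCoeffQ ε q α k) else 0) := by
    refine LinearMap.ext fun v => ?_
    simp only [psiExpPartial, LinearMap.comp_apply, LinearMap.add_apply, Finsupp.lsingle_apply,
      partialSeries_single, map_sum, LinearMap.proj_apply, Pi.add_apply, zero_add, Finset.sum_apply,
      h1, h2, LinearMap.sum_apply]
    congr 1
    · refine Finset.sum_congr rfl fun k _ => ?_
      split_ifs
      · rw [LinearMap.sum_apply]; rfl
      · rfl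
    · refine Finset.sum_congr rfl fun l _ => Finset.sum_congr rfl fun k _ => ?_
      split_ifs <;> rfl
  rw [h3]
  refine add_mem (Submodule.sum_mem _ fun k _ => ?_)
    (Submodule.sum_mem _ fun l _ => Submodule.sum_mem _ fun k _ => ?_)
  · split_ifs
    · exact Submodule.sum_mem _ fun x _ => Submodule.subset_span ⟨_, _, _, rfl⟩
    · exact zero_mem _
  · split_ifs
    · exact Submodule.subset_span ⟨_, _, _, rfl⟩
    · exact zero_mem _

/-- The residues of the fields of `Ψⁱ e^α` and `Ψⁱ' e^β` anticommute for `α, β ∈ L_A`. -/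
theorem psiExp_anticomm {ε : Lat N → Lat N → ℤˣ} (hε : IsTwist ε) (q : ℂ) (i i' : Fin N)
    {α β : Lat N} (hα : α.2 = 0) (hβ : β.2 = 0) (v : V N) :
    qProd ε q 0 ((Gen.Psi i).coeff ((0 : ℕ) : ℤ) (expVec α))
      (qProd ε q 0 ((Gen.Psi i').coeff ((0 : ℕ) : ℤ) (expVec β)) v) =
    -qProd ε q 0 ((Gen.Psi i').coeff ((0 : ℕ) : ℤ) (expVec β))
      (qProd ε q 0 ((Gen.Psi i).coeff ((0 : ℕ) : ℤ) (expVec α)) v) := by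
  have h1 := (evLim_psiExpPartial ε q i α).comp (evLim_psiExpPartial ε q i' β)
  have h2 := ((evLim_psiExpPartial ε q i' β).comp (evLim_psiExpPartial ε q i α)).neg
  refine LinearMap.congr_fun (h1.unique (h2.congr fun M => ?_)) v
  exact (span_anticomm (psiExpSet_anticomm hε q i i' hα hβ) (psiExpPartial_mem ε q i α M)
    (psiExpPartial_mem ε q i' β M)).symm

theorem D_apply (ε : Lat N → Lat N → ℤˣ) (q : ℂ) (v : V N) :
    D ε q v = ∑ i, (qProd ε q 0 ((Gen.Psi i).coeff ((0 : ℕ) : ℤ) (expVec (genA i))) v -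
      qProd ε q 0 ((Gen.Psi i).coeff ((0 : ℕ) : ℤ) (expVec (xiLast N))) v) := by
  have h : ∀ i, (Gen.Psi i).mode (-1) = ((Gen.Psi i).coeff ((0 : ℕ) : ℤ) : Module.End ℂ (V N)) :=
    fun i => rfl
  simp only [D, h, map_sum, map_sub, LinearMap.sum_apply, LinearMap.sub_apply]

theorem D_mul_D {ε : Lat N → Lat N → ℤˣ} (hε : IsTwist ε) (q : ℂ) : D ε q * D ε q = 0 := by
  refine LinearMap.ext fun v => ?_
  have h : D ε q (D ε q v) = -D ε q (D ε q v) := by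
    have hA : ∀ i, (genA i : Lat N).2 = 0 := fun i => rfl
    have hX : (xiLast N).2 = 0 := rfl
    have e1 : ∀ i w, D ε q (qProd ε q 0 ((Gen.Psi i).coeff ((0 : ℕ) : ℤ) (expVec (genA i))) w) =
        -qProd ε q 0 ((Gen.Psi i).coeff ((0 : ℕ) : ℤ) (expVec (genA i))) (D ε q w) := by
      intro i w
      rw [D_apply, D_apply, map_sum, ← Finset.sum_neg_distrib]
      refine Finset.sum_congr rfl fun j _ => ?_
      rw [psiExp_anticomm hε q j i (hA j) (hA i), psiExp_anticomm hε q j i hX (hA i), map_sub]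
      abel
    have e2 : ∀ i w, D ε q (qProd ε q 0 ((Gen.Psi i).coeff ((0 : ℕ) : ℤ) (expVec (xiLast N))) w) =
        -qProd ε q 0 ((Gen.Psi i).coeff ((0 : ℕ) : ℤ) (expVec (xiLast N))) (D ε q w) := by
      intro i w
      rw [D_apply, D_apply, map_sum, ← Finset.sum_neg_distrib]
      refine Finset.sum_congr rfl fun j _ => ?_
      rw [psiExp_anticomm hε q j i (hA j) hX, psiExp_anticomm hε q j i hX hX, map_sub]
      abel
    conv_lhs => rw [D_apply ε q v, map_sum]
    rw [D_apply ε q (D ε q v), ← Finset.sum_neg_distrib]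
    refine Finset.sum_congr rfl fun j _ => ?_
    rw [map_sub, e1, e2]
    abel
  rw [Module.End.mul_apply, LinearMap.zero_apply]
  have h2 : (2 : ℂ) • D ε q (D ε q v) = 0 := by
    rw [two_smul]
    nth_rewrite 1 [h]
    exact neg_add_cancel _
  exact (smul_eq_zero.mp h2).resolve_left two_ne_zero

/-! ### The operators `Q₀` and `D` anticommute -/

theorem eventually_sum_ite_range {W : Type*} [AddCommMonoid W] (F : ℕ → W) (m : ℕ) :
    ∀ᶠ M in Filter.atTop, ∑ n ∈ Finset.range M, (if n = m then F n else 0) = F m := by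
  filter_upwards [Filter.eventually_gt_atTop m] with M hM
  rw [Finset.sum_ite_eq' (Finset.range M) m F, if_pos (Finset.mem_range.mpr hM)]

/-- The coefficients of the field `α(z) = ∑ᵢ αᵢ Aⁱ(z)` for `α ∈ L_A`. -/
def heisCoeff (α : Lat N) (e : ℤ) : Module.End ℂ (V N) := ∑ i, (α.1 i : ℂ) • (Gen.A i).coeff e

theorem heisCoeff_apply (α : Lat N) (e : ℤ) (v : V N) :
    heisCoeff α e v = ∑ i, (α.1 i : ℂ) • (Gen.A i).coeff e v := by
  simp only [heisCoeff, LinearMap.sum_apply, LinearMap.smul_apply]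

theorem heisCoeff_neg_expVec (α β : Lat N) (hα : α.2 = 0) (m : ℕ) :
    heisCoeff α (-(m : ℤ) - 1) (expVec β) = if m = 0 then (form α β : ℂ) • expVec β else 0 := by
  rw [heisCoeff_apply]
  split_ifs with h
  · subst h
    rw [form_of_snd_eq_zero hα, Int.cast_sum, Finset.sum_smul]
    refine Finset.sum_congr rfl fun i _ => ?_
    rw [show -((0 : ℕ) : ℤ) - 1 = -1 by simp, Gen.coeff_A_neg_one, expVec, Fock.onIdx_single]
    simp only [Finsupp.smul_single, smul_smul, Int.cast_mul]
  · obtain ⟨n, rfl⟩ := Nat.exists_eq_succ_of_ne_zero h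
    refine Finset.sum_eq_zero fun i _ => ?_
    rw [show -((n.succ : ℕ) : ℤ) - 1 = -(n : ℤ) - 2 by push_cast; ring, Gen.coeff_A_neg, expVec,
      LinearMap.smul_apply, Fock.bD_single, (pderiv _).map_one_eq_zero, Finsupp.single_zero,
      smul_zero, smul_zero]

theorem heisCoeff_neg_coeff_nat (α : Lat N) (m : ℕ) (g : Gen N) (n : ℕ) :
    (∀ i, g ≠ Gen.B i) → ∀ v : V N, heisCoeff α (-(m : ℤ) - 1) (g.coeff n v) =
      g.coeff n (heisCoeff α (-(m : ℤ) - 1) v) := by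
  intro hg v
  simp only [heisCoeff_apply, map_sum, map_smul]
  refine Finset.sum_congr rfl fun i _ => congrArg _ ?_
  rcases Nat.eq_zero_or_pos m with rfl | hm
  · rw [show -((0 : ℕ) : ℤ) - 1 = -1 by simp, Gen.coeff_A_neg_one]
    exact apply_of_mul_eq (g.coeff_mul_onIdx n _) v
  · obtain ⟨k, rfl⟩ := Nat.exists_eq_succ_of_ne_zero hm.ne'
    rw [show -((k.succ : ℕ) : ℤ) - 1 = -(k : ℤ) - 2 by push_cast; ring, Gen.coeff_A_neg]
    simp only [LinearMap.smul_apply, map_smul]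
    refine congrArg _ ?_
    cases g with
    | A j =>
      rw [Gen.coeff_A_nat]
      have h := LinearMap.congr_fun (Fock.bD_mul_bC (I := Lat N) (F := FMode N)
        ((Sum.inr i, k) : BMode N) (Sum.inl j, n)) v
      simpa using h
    | B j => exact absurd rfl (hg j)
    | Phi j => rw [Gen.coeff_Phi_nat]; exact (apply_of_mul_eq (Fock.fC_mul_bD _ _) v).symm
    | Psi j => rw [Gen.coeff_Psi_nat]; exact (apply_of_mul_eq (Fock.fC_mul_bD _ _) v).symm

theorem heisCoeff_neg_coeff_B (α : Lat N) (m : ℕ) (j : Fin N) (n : ℕ) (v : V N) :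
    heisCoeff α (-(m : ℤ) - 1) ((Gen.B j).coeff n v) =
      (Gen.B j).coeff n (heisCoeff α (-(m : ℤ) - 1) v) +
        if m = n + 1 then (((n : ℂ) + 1) * α.1 j) • v else 0 := by
  rcases Nat.eq_zero_or_pos m with rfl | hm
  · rw [if_neg (by omega), add_zero]
    simp only [heisCoeff_apply, map_sum, map_smul]
    refine Finset.sum_congr rfl fun i _ => congrArg _ ?_
    rw [show -((0 : ℕ) : ℤ) - 1 = -1 by simp, Gen.coeff_A_neg_one]
    exact apply_of_mul_eq ((Gen.B j).coeff_mul_onIdx n _) v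
  · obtain ⟨k, rfl⟩ := Nat.exists_eq_succ_of_ne_zero hm.ne'
    have h : ∀ i, (Gen.A i).coeff (-((k.succ : ℕ) : ℤ) - 1) ((Gen.B j).coeff n v) =
        (Gen.B j).coeff n ((Gen.A i).coeff (-((k.succ : ℕ) : ℤ) - 1) v) +
          if i = j then (if k = n then ((n : ℂ) + 1) • v else 0) else 0 := by
      intro i
      rw [show -((k.succ : ℕ) : ℤ) - 1 = -(k : ℤ) - 2 by push_cast; ring, Gen.coeff_A_neg,
        Gen.coeff_B_nat]
      have h := LinearMap.congr_fun (Fock.bD_mul_bC (I := Lat N) (F := FMode N)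
        ((Sum.inr i, k) : BMode N) (Sum.inr j, n)) v
      have h2 : Fock.bD (Sum.inr i, k) (Fock.bC (Sum.inr j, n) v) =
          Fock.bC (Sum.inr j, n) (Fock.bD (Sum.inr i, k) v) +
            if i = j ∧ k = n then v else 0 := by
        refine h.trans ?_
        rw [LinearMap.add_apply]
        refine congrArg₂ (· + ·) rfl ?_
        by_cases h3 : i = j ∧ k = n
        · rw [if_pos h3, if_pos (by rw [h3.1, h3.2])]; rfl
        · rw [if_neg h3, if_neg (by simpa using h3)]; rfl
      rw [LinearMap.smul_apply, LinearMap.smul_apply, h2, smul_add, map_smul]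
      refine congrArg₂ (· + ·) rfl ?_
      by_cases h3 : i = j
      · by_cases h4 : k = n
        · simp [h3, h4]
        · simp [h4]
      · simp [h3]
    simp only [heisCoeff_apply, h, smul_add, Finset.sum_add_distrib, map_sum, map_smul]
    refine congrArg₂ (· + ·) rfl ?_
    simp only [smul_ite, smul_zero]
    rw [Finset.sum_ite_eq' Finset.univ j, if_pos (Finset.mem_univ j)]
    by_cases h4 : k = n
    · subst h4
      rw [if_pos rfl, if_pos rfl, smul_smul, mul_comm]
    · rw [if_neg h4, if_neg (by omega)]

/-- The Euler identity `∂ R(z) = R(z) α(z)₊` for the annihilation part `R(z)` of `e^α(z)`. -/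
theorem eventually_expCoeff_euler (ε : Lat N → Lat N → ℤˣ) {α : Lat N} (hα : α.2 = 0) (v : V N) :
    ∀ k : ℤ, ∀ᶠ M in Filter.atTop, (k : ℂ) • expCoeff ε α k v =
      ∑ m ∈ Finset.range M, expCoeff ε α (k + m) (heisCoeff α (-(m : ℤ) - 1) v) := by
  induction v using V_induction with
  | hexp β =>
    intro k
    filter_upwards [eventually_sum_ite_range
      (fun m => expCoeff ε α (k + m) ((form α β : ℂ) • expVec β)) 0] with M hM
    simp only [heisCoeff_neg_expVec α β hα, apply_ite, map_zero]
    rw [hM, Nat.cast_zero, add_zero, map_smul, expCoeff_expVec]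
    split_ifs with h
    · rw [h]
    · rw [smul_zero, smul_zero]
  | hadd v w hv hw =>
    intro k
    filter_upwards [hv k, hw k] with M h1 h2
    simp only [map_add, smul_add, h1, h2, Finset.sum_add_distrib]
  | hsmul c v hv =>
    intro k
    filter_upwards [hv k] with M h1
    simp only [map_smul, smul_comm _ c, h1, Finset.smul_sum]
  | hcoeff g n v ih =>
    intro k
    rcases expCoeff_coeff_nat ε hα g n with ⟨hg, h1⟩ | ⟨j, rfl, h1⟩
    · filter_upwards [ih k] with M hM
      simp only [heisCoeff_neg_coeff_nat α _ g n hg, h1, ← map_smul, hM, map_sum]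
    · have h2 := eventually_sum_ite_range
        (fun m => expCoeff ε α (k + m) ((((n : ℂ) + 1) * α.1 j) • v)) (n + 1)
      filter_upwards [ih k, ih (k + n + 1), h2] with M hM1 hM2 hM3
      simp only [heisCoeff_neg_coeff_B, map_add, h1, apply_ite (expCoeff ε α _), map_zero,
        Finset.sum_add_distrib, Finset.sum_sub_distrib]
      rw [hM3, ← map_sum, ← hM1, smul_sub, map_smul, map_smul]
      have h3 : ∑ m ∈ Finset.range M, (α.1 j : ℂ) • expCoeff ε α (k + m + n + 1)
          (heisCoeff α (-(m : ℤ) - 1) v) =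
            (α.1 j : ℂ) • (((k + n + 1 : ℤ) : ℂ) • expCoeff ε α (k + n + 1) v) := by
        rw [hM2, Finset.smul_sum]
        refine Finset.sum_congr rfl fun m _ => ?_
        rw [show k + n + 1 + m = k + m + n + 1 by ring]
      rw [h3, show k + ((n + 1 : ℕ) : ℤ) = k + n + 1 by push_cast; ring]
      push_cast
      module

/-- The derivative `∂` on `V[z, z⁻¹]`. -/
def lDeriv : Module.End ℂ (LPoly N) :=
  Finsupp.lsum ℂ fun d => (d : ℂ) • Finsupp.lsingle (d - 1)

theorem lDeriv_single (d : ℤ) (v : V N) :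
    lDeriv (Finsupp.single d v) = (d : ℂ) • Finsupp.single (d - 1) v := by
  simp [lDeriv]

theorem lDeriv_apply (l : LPoly N) (e : ℤ) : lDeriv l e = ((e : ℂ) + 1) • l (e + 1) := by
  induction l using Finsupp.induction_linear with
  | zero => simp
  | add f g hf hg => simp only [map_add, Finsupp.add_apply, hf, hg, smul_add]
  | single d v =>
    rw [lDeriv_single, Finsupp.smul_apply, Finsupp.single_apply, Finsupp.single_apply]
    by_cases h : d - 1 = e
    · rw [if_pos h, if_pos (by omega), ← h]; push_cast; module
    · rw [if_neg h, if_neg (by omega), smul_zero, smul_zero]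

theorem expAnnihilation_heis (ε : Lat N → Lat N → ℤˣ) {α : Lat N} (hα : α.2 = 0) (v : V N) :
    expAnnihilation ε α (∑ i, (α.1 i : ℂ) • annihilationPart (.A i) 0 (Finsupp.single 0 v)) =
      lDeriv (expAnnihilation ε α (Finsupp.single 0 v)) := by
  refine Finsupp.ext fun e => ?_
  have hR := isSeries_expAnnihilation ε α
  have h1 : ∀ᶠ M in Filter.atTop, ∀ i ∈ (Finset.univ : Finset (Fin N)),
      annihilationPart (.A i) 0 (Finsupp.single 0 v) = ∑ n ∈ Finset.range M,
        Finsupp.single (0 + (-(n : ℤ) - 1)) ((Gen.A i).coeff (-(n : ℤ) - 1) v) :=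
    (Filter.eventually_all_finset _).mpr fun i _ => evLim_annihilationPart_single _ 0 v
  obtain ⟨M, hM1, hM2⟩ := (h1.and (eventually_expCoeff_euler ε hα v (e + 1))).exists
  rw [Finset.sum_congr rfl fun i hi => congrArg _ (hM1 i hi), lDeriv_apply, hR, sub_zero]
  push_cast at hM2
  rw [hM2]
  simp only [map_sum, map_smul, Finsupp.finsetSum_apply, Finsupp.smul_apply, heisCoeff_apply,
    Finset.smul_sum]
  rw [Finset.sum_comm]
  refine Finset.sum_congr rfl fun m _ => Finset.sum_congr rfl fun i _ => ?_
  rw [hR, show e - (0 + (-(m : ℤ) - 1)) = e + 1 + m by ring]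

/-- The Euler identity `∂ E(z) = α(z)₋ E(z)` for the creation part `E(z)` of `e^α(z)`. -/
theorem coeff_expCreation_succ {α : Lat N} (hα : α.2 = 0) (m : ℕ) :
    ((m : ℂ) + 1) • PowerSeries.coeff (m + 1) (expCreation α) =
      PowerSeries.coeff m ((∑ i, (α.1 i : ℂ) • creationPart (.A i) 0) * expCreation α :
        PowerSeries (Module.End ℂ (V N))) := by
  set D : ℕ → Module.End ℂ (V N) →ₗ[ℂ] Module.End ℂ (V N) := fun k =>
    (k : ℂ) • LinearMap.id with hDdef
  have hDa : ∀ k x, D k x = (k : ℂ) • x := fun k x => rfl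
  have hD : ∀ i j x y, D (i + j) (x * y) = D i x * y + x * D j y := fun i j x y => by
    rw [hDa, hDa, hDa, smul_mul_assoc, mul_smul_comm, ← add_smul, Nat.cast_add]
  have hpsi : psMap D (expArg α) =
      PowerSeries.X * ∑ i, (α.1 i : ℂ) • creationPart (.A i) 0 := by
    ext1 k
    rw [psMap, PowerSeries.coeff_mk, expArg, PowerSeries.coeff_mk]
    cases k with
    | zero => rw [if_pos rfl, map_zero, PowerSeries.coeff_zero_X_mul]
    | succ k =>
      have h0 : ((k + 1 : ℕ) : ℂ) ≠ 0 := by exact_mod_cast Nat.succ_ne_zero k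
      rw [if_neg (Nat.succ_ne_zero k), PowerSeries.coeff_succ_X_mul, hDa, smul_smul,
        mul_inv_cancel₀ h0, one_smul, heis_neg, map_sum]
      refine Finset.sum_congr rfl fun i _ => ?_
      rw [coeff_smul, creationPart_zero, Gen.coeff_A_nat, hα, Pi.zero_apply, Int.cast_zero,
        zero_smul, add_zero]
  have hcomm : Commute (psMap D (expArg α)) (expArg α) := by
    refine commute_of_coeff (E := Module.End ℂ (V N)) fun a b => ?_
    refine commute_coeff_expArg α (fun k => ?_) b
    rw [psMap, PowerSeries.coeff_mk, hDa]
    exact (commute_smul _ (commute_coeff_expArg α (fun l => Fock.bC_mul_bC k l) a)).symm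
  have h0 : PowerSeries.coeff 0 (expArg α : PowerSeries (Module.End ℂ (V N))) = 0 := by
    rw [expArg, PowerSeries.coeff_mk, if_pos rfl]
  have h := congrArg (PowerSeries.coeff (m + 1)) (psMap_psExp hD h0 hcomm)
  rw [hpsi, ← expCreation_eq, mul_assoc, PowerSeries.coeff_succ_X_mul, psMap,
    PowerSeries.coeff_mk, hDa] at h
  rw [← h]
  push_cast
  rfl

/-- The Leibniz rule for the product of a power series `C` with derivative `C'` and a Laurent
polynomial. -/
theorem cauchy_euler {C C' : PowerSeries (Module.End ℂ (V N))}
    (h : ∀ m : ℕ, ((m : ℂ) + 1) • PowerSeries.coeff (m + 1) C = PowerSeries.coeff m C')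
    (l : LPoly N) (e : ℤ) :
    cauchy C' l e + cauchy C (lDeriv l) e = ((e : ℂ) + 1) • cauchy C l (e + 1) := by
  induction l using Finsupp.induction_linear with
  | zero => simp
  | add f g hf hg =>
    simp only [map_add, Pi.add_apply, smul_add, ← hf, ← hg]
    abel
  | single d v =>
    rw [lDeriv_single, map_smul, Pi.smul_apply, cauchy_single, cauchy_single, cauchy_single]
    by_cases h1 : d ≤ e
    · rw [if_pos h1, if_pos (by omega), if_pos (by omega), ← h]
      have h2 : (e - d).toNat + 1 = (e + 1 - d).toNat := by omega
      have h3 : (((e - d).toNat : ℕ) : ℂ) = (e : ℂ) - d := by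
        have : (((e - d).toNat : ℕ) : ℤ) = e - d := by omega
        exact_mod_cast congrArg (Int.cast (R := ℂ)) this
      rw [h2, h3, show e - (d - 1) = e + 1 - d by ring, LinearMap.smul_apply]
      module
    · rw [if_neg h1, zero_add]
      by_cases h2 : d = e + 1
      · subst h2
        rw [if_pos (by omega), if_pos (by omega)]
        push_cast
        rw [show e - (e + 1 - 1) = e + 1 - (e + 1) by ring]
      · rw [if_neg (by omega), if_neg (by omega), smul_zero, smul_zero]

/-- The state is the derivative of `e^α`, and the field of a derivative has no residue. -/
theorem nProd_heis_expVec (ε : Lat N → Lat N → ℤˣ) {α : Lat N} (hα : α.2 = 0) (y : V N) :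
    nProd ε 0 (∑ i, (α.1 i : ℂ) • (Gen.A i).coeff ((0 : ℕ) : ℤ) (expVec α)) y = 0 := by
  have h : ∀ i, nProd ε 0 ((Gen.A i).coeff ((0 : ℕ) : ℤ) (expVec α)) y =
      cauchy (creationPart (.A i) 0 * expCreation α)
        (expAnnihilation ε α (Finsupp.single 0 y)) (-1) +
      cauchy (expCreation α) (expAnnihilation ε α
        (annihilationPart (.A i) 0 (Finsupp.single 0 y))) (-1) := by
    intro i
    rw [nProd_eq, preField_coeff, twist_expVec, preField_expVec, preField_expVec, one_mul, one_mul]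
    rfl
  have h2 := cauchy_euler (coeff_expCreation_succ hα)
    (expAnnihilation ε α (Finsupp.single 0 y)) (-1)
  rw [← expAnnihilation_heis ε hα, Finset.sum_mul] at h2
  simp only [smul_mul_assoc] at h2
  rw [cauchy_sum_smul] at h2
  simp only [LinearMap.sum_apply, LinearMap.smul_apply, Finset.sum_apply, Pi.smul_apply, map_sum,
    map_smul] at h2
  simp only [map_sum, map_smul, LinearMap.sum_apply, LinearMap.smul_apply, h, smul_add,
    Finset.sum_add_distrib]
  refine h2.trans ?_
  simp

theorem qProd_heis_expVec (ε : Lat N → Lat N → ℤˣ) (q : ℂ) {α : Lat N} (hα : α.2 = 0) (y : V N) :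
    ∑ i, (α.1 i : ℂ) • qProd ε q 0 ((Gen.A i).coeff ((0 : ℕ) : ℤ) (expVec α)) y = 0 := by
  have h : ∀ i, qProd ε q 0 ((Gen.A i).coeff ((0 : ℕ) : ℤ) (expVec α)) y =
      nProd ε 0 ((Gen.A i).coeff ((0 : ℕ) : ℤ) (expVec α)) (qShift q α y) := fun i =>
    qProd_of_inSector _ _ _ ((inSector_single α ∅ 1).apply fun c => Gen.coeff_mul_onIdx _ _ _) _
  have h2 := nProd_heis_expVec ε hα (qShift q α y)
  simp only [map_sum, map_smul, LinearMap.sum_apply, LinearMap.smul_apply] at h2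
  simp only [h, h2]

section

variable {ε : Lat N → Lat N → ℤˣ} (hε : IsTwist ε) (q : ℂ)

include hε

theorem Q0_expVec_of_snd_eq_zero {α : Lat N} (hα : α.2 = 0) : Q0 ε q (expVec α) = 0 := by
  rw [Q0_expVec hε q]
  exact Finset.sum_eq_zero fun i _ => by rw [hα, Pi.zero_apply, Int.cast_zero, zero_smul]

theorem Q0_Psi_expVec (i : Fin N) {α : Lat N} (hα : α.2 = 0) :
    Q0 ε q ((Gen.Psi i).coeff ((0 : ℕ) : ℤ) (expVec α)) =
      (Gen.A i).coeff ((0 : ℕ) : ℤ) (expVec α) := by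
  rw [Q0_coeff hε q, Q0_expVec_of_snd_eq_zero hε q hα, map_zero, smul_zero, zero_add]
  exact one_smul ℂ _

/-- `Q₀ (Ψⁱ e^α) = Aⁱ e^α` for `α ∈ L_A`, so by the derivation property `Q₀ D + D Q₀` is a sum of
the residues of the fields of `∂e^α` for `α = Aⁱ` and, up to sign, for `α = -A¹ - ⋯ - Aᴺ`. -/
theorem Q0_D (v : V N) : Q0 ε q (D ε q v) = -D ε q (Q0 ε q v) := by
  have hγ : ∀ (i : Fin N) (α : Lat N), Fock.parity ((Gen.Psi i).coeff ((0 : ℕ) : ℤ) (expVec α)) =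
      -(Gen.Psi i).coeff ((0 : ℕ) : ℤ) (expVec α) := by
    intro i α
    have h := LinearMap.congr_fun ((Gen.Psi i).parity_mul_coeff ((0 : ℕ) : ℤ)) (expVec α)
    have h2 : Fock.parity (expVec α) = expVec α := by simp [expVec]
    simp only [Module.End.mul_apply, LinearMap.smul_apply, h2] at h
    rw [h]
    exact neg_one_smul ℂ _
  have hA : ∀ i, (genA i : Lat N).2 = 0 := fun i => rfl
  have hX : (xiLast N).2 = 0 := rfl
  have h1 : ∀ i, qProd ε q 0 ((Gen.A i).coeff ((0 : ℕ) : ℤ) (expVec (genA i))) v = 0 := by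
    intro i
    have h := qProd_heis_expVec ε q (hA i) v
    rw [Finset.sum_eq_single i] at h
    · simpa [genA] using h
    · intro j _ hj
      simp [genA, Pi.single_eq_of_ne hj]
    · simp
  have h2 : ∑ i, qProd ε q 0 ((Gen.A i).coeff ((0 : ℕ) : ℤ) (expVec (xiLast N))) v = 0 := by
    have h := qProd_heis_expVec ε q hX v
    simpa [xiLast] using h
  rw [D_apply, D_apply, map_sum, ← Finset.sum_neg_distrib]
  simp only [map_sub, Q0_qProd hε q, Q0_Psi_expVec hε q _ (hA _), Q0_Psi_expVec hε q _ hX, hγ,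
    map_neg, LinearMap.neg_apply, h1, zero_add]
  simp only [sub_eq_add_neg, neg_add, neg_neg, Finset.sum_add_distrib, Finset.sum_neg_distrib, h2]
  abel

theorem D_mul_Q0 : D ε q * Q0 ε q = -(Q0 ε q * D ε q) :=
  LinearMap.ext fun v => by
    rw [Module.End.mul_apply, LinearMap.neg_apply, Module.End.mul_apply, Q0_D hε q, neg_neg]

end

/-! ### The cohomology of `Q₀` -/

theorem Bracket.add_right {W : Type*} [AddCommGroup W] [Module ℂ W] {s : ℂ}
    {X Y Y' Z Z' : Module.End ℂ W} (h : Bracket s X Y Z) (h' : Bracket s X Y' Z') :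
    Bracket s X (Y + Y') (Z + Z') := by
  rw [Bracket] at *
  rw [mul_add, h, h', add_mul, smul_add]
  abel

theorem Bracket.sum_right {W : Type*} [AddCommGroup W] [Module ℂ W] {s : ℂ} {ι : Type*}
    (u : Finset ι) {X : Module.End ℂ W} {Y Z : ι → Module.End ℂ W}
    (h : ∀ i ∈ u, Bracket s X (Y i) (Z i)) : Bracket s X (∑ i ∈ u, Y i) (∑ i ∈ u, Z i) := by
  rw [Bracket, Finset.mul_sum, Finset.sum_mul, Finset.smul_sum, ← Finset.sum_add_distrib]
  exact Finset.sum_congr rfl fun i hi => h i hi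

theorem Bracket.anticomm {W : Type*} [AddCommGroup W] [Module ℂ W] {X Y Z : Module.End ℂ W}
    (h : Bracket (-1) X Y Z) : X * Y + Y * X = Z := by
  rw [Bracket] at h
  rw [h, neg_one_smul, neg_add_eq_sub, sub_add_cancel]

theorem neg_one_smul_mul_neg {W : Type*} [AddCommGroup W] [Module ℂ W] (X Y : Module.End ℂ W) :
    (-1 : ℂ) • (X * -Y) = X * Y := by
  rw [mul_neg, neg_one_smul, neg_neg]

theorem commute_of_anticomm {W : Type*} [AddCommGroup W] [Module ℂ W] {Q H T : Module.End ℂ W}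
    (hQ : Q * Q = 0) (h : Q * H + H * Q = T) : Q * T = T * Q := by
  rw [← h, mul_add, add_mul, ← mul_assoc, hQ, zero_mul, zero_add, mul_assoc H, hQ, mul_zero,
    add_zero, mul_assoc]

namespace Fock

variable {I F K : Type*}

/-- The projection to the kernel of a diagonal operator. -/
def diagKer (d : I → Finset F → (K →₀ ℕ) → ℂ) : Module.End ℂ (Space I F K) :=
  diag fun x s m => if d x s m = 0 then 1 else 0

theorem diagKer_comm {Q H : Module.End ℂ (Space I F K)} {d : I → Finset F → (K →₀ ℕ) → ℂ}
    (hQ : Q * Q = 0) (h : Q * H + H * Q = diag d) (v : Space I F K) :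
    Q (diagKer d v) = diagKer d (Q v) :=
  LinearMap.congr_fun (comp_diag_of_comm Q d (commute_of_anticomm hQ h)
    fun z => if z = 0 then 1 else 0) v

/-- If the anticommutator of a differential with some operator is diagonal, then every cocycle is
cohomologous to its projection to the kernel of this diagonal operator. -/
theorem eq_diagKer_add {Q H : Module.End ℂ (Space I F K)} {d : I → Finset F → (K →₀ ℕ) → ℂ}
    (hQ : Q * Q = 0) (h : Q * H + H * Q = diag d) {v : Space I F K} (hv : Q v = 0) :
    v = diagKer d v + Q (diag (fun x s m => (d x s m)⁻¹) (H v)) := by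
  have h1 : diag d v = Q (H v) := by
    rw [← h, LinearMap.add_apply, Module.End.mul_apply, Module.End.mul_apply, hv, map_zero,
      add_zero]
  have h2 : Q (diag (fun x s m => (d x s m)⁻¹) (H v)) =
      diag (fun x s m => (d x s m)⁻¹) (Q (H v)) :=
    LinearMap.congr_fun (comp_diag_of_comm Q d (commute_of_anticomm hQ h) fun z => z⁻¹) (H v)
  have h3 : diagKer d + diag (fun x s m => (d x s m)⁻¹) * diag d =
      (1 : Module.End ℂ (Space I F K)) := by
    rw [diagKer, diag_mul_diag, diag_add, ← diag_one]
    congr 1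
    funext x s m
    by_cases hd : d x s m = 0
    · simp [hd]
    · simp [hd]
  rw [h2, ← h1]
  exact (LinearMap.congr_fun h3 v).symm

end Fock

/-- The mode `Φⁱ_0`. -/
def phiZero : Fin N ↪ FMode N := ⟨fun i => phiMode i 0, fun i j h => by simpa using h⟩

/-- The vector `Φ^{i₁}_0 ⋯ Φ^{iᵣ}_0 e^a` for `a ∈ L_A` and `S = {i₁ < ⋯ < iᵣ}`. -/
def zeroMode (a : Fin N → ℤ) (S : Finset (Fin N)) : V N :=
  Finsupp.single ((a, 0), S.map phiZero) 1

theorem sgn_map_phiZero (i : Fin N) (S : Finset (Fin N)) :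
    Fock.sgn (phiMode i 0) (S.map phiZero) = Fock.sgn i S := by
  rw [Fock.sgn, Fock.sgn]
  congr 1
  have h : (S.map phiZero).filter (· < phiMode i 0) = (S.filter (· < i)).map phiZero := by
    rw [Finset.filter_map]
    congr 1
    refine Finset.filter_congr fun j _ => ?_
    simp [phiZero, phiMode, Prod.Lex.toLex_lt_toLex]
  rw [h, Finset.card_map]

theorem phiMode_mem_map_phiZero (i : Fin N) (n : ℕ) (S : Finset (Fin N)) :
    phiMode i n ∈ S.map phiZero ↔ i ∈ S ∧ n = 0 := by
  rw [Finset.mem_map]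
  constructor
  · rintro ⟨j, hj, h⟩
    have h2 := phiMode_inj.mp h
    exact ⟨h2.1 ▸ hj, h2.2.symm⟩
  · rintro ⟨hi, rfl⟩
    exact ⟨i, hi, rfl⟩

theorem psiMode_notMem_map_phiZero (i : Fin N) (n : ℕ) (S : Finset (Fin N)) :
    psiMode i n ∉ S.map phiZero := by
  simp [phiZero, phiMode, psiMode]

theorem fC_zeroMode (i : Fin N) (a : Fin N → ℤ) (S : Finset (Fin N)) :
    Fock.fC (phiMode i 0) (zeroMode a S) =
      if i ∈ S then 0 else Fock.sgn i S • zeroMode a (insert i S) := by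
  rw [zeroMode, Fock.fC_single, sgn_map_phiZero]
  simp only [phiMode_mem_map_phiZero, and_true]
  split_ifs
  · rfl
  · rw [zeroMode, Finset.map_insert]
    congr!

theorem fD_zeroMode (i : Fin N) (a : Fin N → ℤ) (S : Finset (Fin N)) :
    Fock.fD (phiMode i 0) (zeroMode a S) =
      if i ∈ S then Fock.sgn i S • zeroMode a (S.erase i) else 0 := by
  rw [zeroMode, Fock.fD_single, sgn_map_phiZero]
  simp only [phiMode_mem_map_phiZero, and_true]
  split_ifs
  · rw [zeroMode, Finset.map_erase]
    congr!
  · rfl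

theorem zeroMode_insert {i : Fin N} {S : Finset (Fin N)} (hi : i ∉ S) (a : Fin N → ℤ) :
    zeroMode a (insert i S) = Fock.sgn i S • Fock.fC (phiMode i 0) (zeroMode a S) := by
  rw [fC_zeroMode, if_neg hi, smul_smul, Fock.sgn_mul_self, one_smul]

/-- The span of the vectors `Φ^{i₁}_0 ⋯ Φ^{iᵣ}_0 e^a`, `a ∈ L_A`, which represents the cohomology of
`Q₀`. -/
def zeroModes (N : ℕ) : Submodule ℂ (V N) :=
  Submodule.span ℂ (Set.range fun x : (Fin N → ℤ) × Finset (Fin N) =>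
    zeroMode x.1 x.2)

/-- The eigenvalues of the anticommutator of `Q₀` with `homotopy M`: the energy of the modes
with index less than `M`, increased by one in the sectors outside `L_A`. -/
def energy (M : ℕ) (β : Lat N) (s : Finset (FMode N)) (m : BMode N →₀ ℕ) : ℕ :=
  ∑ i, ∑ n ∈ Finset.range M, (m (Sum.inl i, n) + (if psiMode i n ∈ s then 1 else 0) +
    (n + 1) * (m (Sum.inr i, n) + if phiMode i (n + 1) ∈ s then 1 else 0)) +
    if β.2 = 0 then 0 else 1

theorem energy_cast (M : ℕ) (β : Lat N) (s : Finset (FMode N)) (m : BMode N →₀ ℕ) :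
    (energy M β s m : ℂ) =
    ∑ i, (∑ n ∈ Finset.range M, ((m (Sum.inl i, n) : ℂ) + (if psiMode i n ∈ s then 1 else 0) +
      ((n : ℂ) + 1) * ((m (Sum.inr i, n) : ℂ) + if phiMode i (n + 1) ∈ s then 1 else 0)) +
      (β.2 i : ℂ) * ((β.2 i : ℂ) * (∑ j, (β.2 j : ℂ) ^ 2)⁻¹)) := by
  have h : ∑ i, (β.2 i : ℂ) * ((β.2 i : ℂ) * (∑ j, (β.2 j : ℂ) ^ 2)⁻¹) =
      ((if β.2 = 0 then 0 else 1 : ℕ) : ℂ) := by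
    simp only [← mul_assoc, ← pow_two, ← Finset.sum_mul]
    split_ifs with hβ
    · simp [hβ]
    · rw [Nat.cast_one, mul_inv_cancel₀]
      intro h0
      apply hβ
      have h1 : ∑ j, β.2 j ^ 2 = 0 := by exact_mod_cast h0
      rw [Finset.sum_eq_zero_iff_of_nonneg fun i _ => sq_nonneg _] at h1
      funext i
      exact pow_eq_zero_iff two_ne_zero |>.mp (h1 i (Finset.mem_univ i))
  rw [Finset.sum_add_distrib, h, energy]
  push_cast
  rfl

/-- The homotopy operator, in the modes with index less than `M`, so that the sum is finite. It
sends `Aⁱ_{-n-1}` to `Ψⁱ_{-n-1}` and `Φⁱ_{-n-1}` to `Bⁱ_{-n-1}`. In the sector of `β` outside `L_A`,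
`Q₀` also multiplies by `∑ᵢ bᵢ Φⁱ_0`, with `bᵢ` the coefficients of the `Bⁱ` in `β`, and the last
term contracts with the dual vector `bᵢ / ∑ⱼ bⱼ²`; inside `L_A` this term is zero. -/
def homotopy (M : ℕ) : Module.End ℂ (V N) :=
  ∑ i, (∑ n ∈ Finset.range M, (Fock.fC (psiMode i n) * Fock.bD (Sum.inl i, n) +
    Fock.bC (Sum.inr i, n) * Fock.fD (phiMode i (n + 1))) +
    Fock.fD (phiMode i 0) * Fock.onIdx fun β => (β.2 i : ℂ) * (∑ j, (β.2 j : ℂ) ^ 2)⁻¹)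

theorem Fock.smul_diag {I F K : Type*} (a : ℂ) (c : I → Finset F → (K →₀ ℕ) → ℂ) :
    (a • Fock.diag c : Module.End ℂ (Fock.Space I F K)) = Fock.diag fun x s m => a * c x s m :=
  Fock.ext_monomial fun x s m => by
    rw [LinearMap.smul_apply, Fock.diag_single, Fock.diag_single, smul_smul]

theorem Fock.onIdx_eq_diag {I F K : Type*} (c : I → ℂ) :
    (Fock.onIdx c : Module.End ℂ (Fock.Space I F K)) = Fock.diag fun x _ _ => c x :=
  Fock.ext_monomial fun x s m => by
    rw [Fock.onIdx_single, Fock.diag_single, Finsupp.smul_single]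

section

variable {ε : Lat N → Lat N → ℤˣ} (hε : IsTwist ε) (q : ℂ)

include hε

/-- Each summand of `homotopy M` pairs two modes that `Q₀` maps to each other, so its anticommutator
with `Q₀` counts the occurrences of these modes. -/
theorem Q0_anticomm_homotopy (M : ℕ) :
    Q0 ε q * homotopy M + homotopy M * Q0 ε q = Fock.diag fun β s m => (energy M β s m : ℂ) := by
  have h1 : ∀ i n, Bracket (-1) (Q0 ε q) (Fock.fC (psiMode i n) * Fock.bD (Sum.inl i, n))
      (Fock.diag fun _ s m => (m (Sum.inl i, n) : ℂ) + if psiMode i n ∈ s then 1 else 0) := by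
    intro i n
    refine ((bracket_Q0_fC_psi hε q i n).mul_right (bracket_Q0_bD_inl hε q i n)).congr
      (mul_one _) ?_
    rw [neg_one_smul_mul_neg, Fock.bC_mul_bD_self, Fock.fC_mul_fD_self, Fock.diag_add]
    refine congrArg Fock.diag ?_
    funext x s m
    split_ifs <;> rfl
  have h2 : ∀ i n, Bracket (-1) (Q0 ε q) (Fock.bC (Sum.inr i, n) * Fock.fD (phiMode i (n + 1)))
      (Fock.diag fun _ s m => ((n : ℂ) + 1) *
        ((m (Sum.inr i, n) : ℂ) + if phiMode i (n + 1) ∈ s then 1 else 0)) := by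
    intro i n
    refine ((bracket_Q0_bC_inr hε q i n).mul_right (bracket_Q0_fD_phi_succ hε q i n)).congr
      (one_mul _) ?_
    rw [one_smul, smul_mul_assoc, mul_smul_comm, Fock.bC_mul_bD_self, Fock.fC_mul_fD_self,
      Fock.smul_diag, Fock.smul_diag, Fock.diag_add]
    refine congrArg Fock.diag ?_
    funext x s m
    split_ifs <;> ring
  have h3 : ∀ i, Bracket (-1) (Q0 ε q)
      (Fock.fD (phiMode i 0) * Fock.onIdx fun β => (β.2 i : ℂ) * (∑ j, (β.2 j : ℂ) ^ 2)⁻¹)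
      (Fock.diag fun β _ _ => (β.2 i : ℂ) * ((β.2 i : ℂ) * (∑ j, (β.2 j : ℂ) ^ 2)⁻¹)) := by
    intro i
    refine ((bracket_Q0_fD_phi_zero hε q i).mul_right (bracket_Q0_onIdx hε q _)).congr
      (mul_one _) ?_
    rw [mul_zero, smul_zero, add_zero, Fock.onIdx_mul, Fock.onIdx_eq_diag]
  have h := Bracket.sum_right Finset.univ fun i (_ : i ∈ (Finset.univ : Finset (Fin N))) =>
    (Bracket.sum_right (Finset.range M) fun n _ => (h1 i n).add_right (h2 i n)).add_right (h3 i)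
  rw [homotopy, h.anticomm]
  simp only [Fock.diag_add, Fock.sum_diag, energy_cast]

theorem Q0_zeroModes {w : V N} (hw : w ∈ zeroModes N) : Q0 ε q w = 0 := by
  induction hw using Submodule.span_induction with
  | mem w hw =>
    obtain ⟨⟨a, S⟩, rfl⟩ := hw
    induction S using Finset.induction_on with
    | empty => exact Q0_expVec_of_snd_eq_zero hε q rfl
    | insert i S hi ih =>
      have h := LinearMap.congr_fun (bracket_Q0_fC_phi hε q i 0) (zeroMode a S)
      simp only [Module.End.mul_apply, LinearMap.smul_apply, add_zero] at h ih ⊢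
      rw [zeroMode_insert hi, map_smul, h, ih, map_zero, smul_zero, smul_zero]
  | zero => exact map_zero _
  | add x y _ _ hx hy => rw [map_add, hx, hy, add_zero]
  | smul c x _ hx => rw [map_smul, hx, smul_zero]

end

/-- If `M` exceeds the indices of all modes that occur in `v`, the vanishing of the energy leaves
only the zero modes of `Φ` and the sectors of `L_A`. -/
theorem eventually_diagKer_mem (v : V N) :
    ∀ᶠ M in Filter.atTop, Fock.diagKer (fun β s m => (energy M β s m : ℂ)) v ∈ zeroModes N := by
  induction v using Finsupp.induction_linear with
  | zero => exact Filter.Eventually.of_forall fun M => by rw [map_zero]; exact zero_mem _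
  | add v w hv hw =>
    filter_upwards [hv, hw] with M h1 h2
    rw [map_add]
    exact add_mem h1 h2
  | single x p =>
    obtain ⟨⟨a, b⟩, s⟩ := x
    induction p using MvPolynomial.induction_on' with
    | add p p' hp hp' =>
      filter_upwards [hp, hp'] with M h1 h2
      rw [Finsupp.single_add, map_add]
      exact add_mem h1 h2
    | monomial m c =>
      filter_upwards [Filter.eventually_gt_atTop (m.support.sup fun k => k.2),
        Filter.eventually_gt_atTop (s.sup fun f => (ofLex f).2)] with M h1 h2
      have h3 : (Finsupp.single ((a, b), s) (monomial m c) : V N) =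
          c • Finsupp.single ((a, b), s) (monomial m 1) := by
        rw [Finsupp.smul_single, smul_monomial, smul_eq_mul, mul_one]
      rw [h3, map_smul, Fock.diagKer, Fock.diag_single]
      refine Submodule.smul_mem _ _ ?_
      split_ifs with h
      · rw [one_smul]
        obtain ⟨h4, h5⟩ := Nat.add_eq_zero_iff.mp (Nat.cast_eq_zero.mp h)
        have hb : b = 0 := by
          by_contra hb
          exact one_ne_zero ((if_neg hb).symm.trans h5)
        simp only [Finset.sum_eq_zero_iff, Finset.mem_univ, true_implies, Finset.mem_range,
          Nat.add_eq_zero_iff, Nat.mul_eq_zero, one_ne_zero, and_false, false_or,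
          ite_eq_right_iff, imp_false] at h4
        have hm : m = 0 := by
          refine Finsupp.ext fun ⟨k, n⟩ => ?_
          by_contra hk
          have hn : n < M := lt_of_le_of_lt
            (Finset.le_sup (f := fun k : BMode N => k.2) (Finsupp.mem_support_iff.mpr hk)) h1
          rcases k with i | i
          · exact hk (h4 i n hn).1.1
          · exact hk (h4 i n hn).2.1
        have hs : s = (Finset.univ.filter fun i => phiMode i 0 ∈ s).map phiZero := by
          ext f
          have hf : f ∈ s → (ofLex f).2 < M := fun hf => lt_of_le_of_lt
            (Finset.le_sup (f := fun f : FMode N => (ofLex f).2) hf) h2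
          rcases fMode_cases f with ⟨i, n, rfl⟩ | ⟨i, n, rfl⟩
          · rw [phiMode_mem_map_phiZero, Finset.mem_filter]
            constructor
            · intro h
              cases n with
              | zero => exact ⟨⟨Finset.mem_univ i, h⟩, rfl⟩
              | succ n => exact absurd h (h4 i n (lt_trans (Nat.lt_succ_self n) (hf h))).2.2
            · rintro ⟨⟨_, h⟩, rfl⟩
              exact h
          · refine iff_of_false (fun h => (h4 i n (hf h)).1.2 h) (psiMode_notMem_map_phiZero i n _)
        rw [hb, hm, hs]
        exact Submodule.subset_span ⟨(a, _), rfl⟩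
      · rw [zero_smul]
        exact zero_mem _

theorem diagKer_of_mem (M : ℕ) {w : V N} (hw : w ∈ zeroModes N) :
    Fock.diagKer (fun β s m => (energy M β s m : ℂ)) w = w := by
  induction hw using Submodule.span_induction with
  | mem w hw =>
    obtain ⟨⟨a, S⟩, rfl⟩ := hw
    have h : ((energy M ((a, 0) : Lat N) (S.map phiZero) 0 : ℕ) : ℂ) = 0 := by
      simp [energy, -Finset.mem_map, phiMode_mem_map_phiZero, psiMode_notMem_map_phiZero]
    change Fock.diagKer (fun β s m => (energy M β s m : ℂ)) (Finsupp.single _ (monomial 0 1)) = _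
    rw [Fock.diagKer, Fock.diag_single, if_pos h, one_smul]
    rfl
  | zero => exact map_zero _
  | add x y _ _ hx hy => rw [map_add, hx, hy]
  | smul c x _ hx => rw [map_smul, hx]

section

variable {ε : Lat N → Lat N → ℤˣ} (hε : IsTwist ε) (q : ℂ)

include hε

/-- Every `Q₀`-cocycle is cohomologous to a combination of the `Φ^{i₁}_0 ⋯ Φ^{iᵣ}_0 e^a`. -/
theorem exists_zeroModes_add {v : V N} (hv : Q0 ε q v = 0) :
    ∃ w ∈ zeroModes N, ∃ u, v = w + Q0 ε q u := by
  obtain ⟨M, hM⟩ := (eventually_diagKer_mem v).exists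
  exact ⟨_, hM, _, Fock.eq_diagKer_add (Q0_mul_Q0 hε q) (Q0_anticomm_homotopy hε q M) hv⟩

/-- No nonzero combination of zero modes is a `Q₀`-coboundary. -/
theorem eq_zero_of_mem_zeroModes {u : V N} (hu : Q0 ε q u ∈ zeroModes N) : Q0 ε q u = 0 := by
  obtain ⟨M, hM⟩ := (eventually_diagKer_mem u).exists
  rw [← diagKer_of_mem M hu, ← Fock.diagKer_comm (Q0_mul_Q0 hε q) (Q0_anticomm_homotopy hε q M),
    Q0_zeroModes hε q hM]

end

/-! ### The product and the operator `D` on the zero modes -/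

theorem zeroMode_empty (a : Fin N → ℤ) : zeroMode a ∅ = expVec (a, 0) := rfl

theorem zeroMode_mem (a : Fin N → ℤ) (S : Finset (Fin N)) : zeroMode a S ∈ zeroModes N :=
  Submodule.subset_span ⟨(a, S), rfl⟩

theorem map_mem_zeroModes {T : Module.End ℂ (V N)}
    (h : ∀ a S, T (zeroMode a S) ∈ zeroModes N) {v : V N} (hv : v ∈ zeroModes N) :
    T v ∈ zeroModes N := by
  induction hv using Submodule.span_induction with
  | mem w hw =>
    obtain ⟨⟨a, S⟩, rfl⟩ := hw
    exact h a S
  | zero => rw [map_zero]; exact zero_mem _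
  | add x y _ _ hx hy => rw [map_add]; exact add_mem hx hy
  | smul c x _ hx => rw [map_smul]; exact Submodule.smul_mem _ _ hx

theorem fC_mem_zeroModes (i : Fin N) {v : V N} (hv : v ∈ zeroModes N) :
    Fock.fC (phiMode i 0) v ∈ zeroModes N :=
  map_mem_zeroModes (fun a S => by
    rw [fC_zeroMode]
    split_ifs
    · exact zero_mem _
    · exact Submodule.smul_mem _ _ (zeroMode_mem _ _)) hv

/-- The zero modes are generated from the vectors `e^a`, `a ∈ L_A`, by the operators `Φⁱ_0`. -/
theorem zeroModes_induction {p : (v : V N) → v ∈ zeroModes N → Prop}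
    (hexp : ∀ a, p (expVec (a, 0)) (zeroMode_mem a ∅))
    (hadd : ∀ v w hv hw, p v hv → p w hw → p (v + w) (add_mem hv hw))
    (hsmul : ∀ (c : ℂ) v hv, p v hv → p (c • v) (Submodule.smul_mem _ c hv))
    (hphi : ∀ i v hv, p v hv → p (Fock.fC (phiMode i 0) v) (fC_mem_zeroModes i hv)) {v : V N}
    (hv : v ∈ zeroModes N) : p v hv := by
  induction hv using Submodule.span_induction with
  | mem w hw =>
    obtain ⟨⟨a, S⟩, rfl⟩ := hw
    induction S using Finset.induction_on with
    | empty => exact hexp a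
    | insert i S hi ih =>
      have h := hsmul (Fock.sgn i S) _ _ (hphi i _ _ ih)
      simp only [fC_zeroMode, if_neg hi, smul_smul, Fock.sgn_mul_self, one_smul] at h
      exact h
  | zero =>
    have h := hsmul 0 _ _ (hexp 0)
    simp only [zero_smul] at h
    exact h
  | add x y hx hy hpx hpy => exact hadd x y hx hy hpx hpy
  | smul c x hx hpx => exact hsmul c x hx hpx

theorem fD_mem_zeroModes (i : Fin N) {v : V N} (hv : v ∈ zeroModes N) :
    Fock.fD (phiMode i 0) v ∈ zeroModes N :=
  map_mem_zeroModes (fun a S => by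
    rw [fD_zeroMode]
    split_ifs
    · exact Submodule.smul_mem _ _ (zeroMode_mem _ _)
    · exact zero_mem _) hv

theorem fD_psi_zeroModes (i : Fin N) (n : ℕ) {v : V N} (hv : v ∈ zeroModes N) :
    Fock.fD (psiMode i n) v = 0 := by
  induction hv using Submodule.span_induction with
  | mem w hw =>
    obtain ⟨⟨a, S⟩, rfl⟩ := hw
    exact (Fock.fD_single _ _ _ _).trans (if_neg (psiMode_notMem_map_phiZero i n S))
  | zero => exact map_zero _
  | add x y _ _ hx hy => rw [map_add, hx, hy, add_zero]
  | smul c x _ hx => rw [map_smul, hx, smul_zero]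

theorem fD_phi_succ_zeroModes (i : Fin N) (n : ℕ) {v : V N} (hv : v ∈ zeroModes N) :
    Fock.fD (phiMode i (n + 1)) v = 0 := by
  induction hv using Submodule.span_induction with
  | mem w hw =>
    obtain ⟨⟨a, S⟩, rfl⟩ := hw
    refine (Fock.fD_single _ _ _ _).trans (if_neg ?_)
    rw [phiMode_mem_map_phiZero]
    exact fun h => Nat.succ_ne_zero n h.2
  | zero => exact map_zero _
  | add x y _ _ hx hy => rw [map_add, hx, hy, add_zero]
  | smul c x _ hx => rw [map_smul, hx, smul_zero]

theorem coeff_zero_expCreation (α : Lat N) :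
    PowerSeries.coeff 0 (expCreation α : PowerSeries (Module.End ℂ (V N))) = 1 := by
  rw [expCreation, psExp, PowerSeries.coeff_mk]
  simp

theorem annihilationPart_Psi_zeroModes (i : Fin N) {v : V N} (hv : v ∈ zeroModes N) :
    annihilationPart (.Psi i) 0 (Finsupp.single 0 v) =
      Finsupp.single (-1) (Fock.fD (phiMode i 0) v) := by
  refine Finsupp.ext fun e => ?_
  rw [isSeries_annihilationPart, Finsupp.single_apply, annihCoeff_zero, sub_zero]
  split_ifs with h1 h2 h2
  · rw [← h2]
    exact LinearMap.congr_fun (Gen.coeff_Psi_neg i 0) v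
  · obtain ⟨n, rfl⟩ : ∃ n : ℕ, e = -((n + 1 : ℕ) : ℤ) - 1 := ⟨(-e - 2).toNat, by omega⟩
    rw [Gen.coeff_Psi_neg, fD_phi_succ_zeroModes i n hv]
  · omega
  · rfl

theorem annihilationPart_Phi_zeroModes (i : Fin N) {v : V N} (hv : v ∈ zeroModes N) :
    annihilationPart (.Phi i) 0 (Finsupp.single 0 v) = 0 := by
  refine Finsupp.ext fun e => ?_
  rw [isSeries_annihilationPart, annihCoeff_zero, sub_zero]
  split_ifs with h1
  · obtain ⟨n, rfl⟩ : ∃ n : ℕ, e = -(n : ℤ) - 1 := ⟨(-e - 1).toNat, by omega⟩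
    rw [Gen.coeff_Phi_neg, fD_psi_zeroModes i n hv]; rfl
  · rfl

theorem qShift_mem_zeroModes (q : ℂ) (α : Lat N) {v : V N} (hv : v ∈ zeroModes N) :
    qShift q α v ∈ zeroModes N :=
  map_mem_zeroModes (fun b S => by
    rw [qShift, zeroMode, Fock.onIdx_single, ← Finsupp.smul_single]
    exact Submodule.smul_mem _ _ (zeroMode_mem _ _)) hv

section

variable (ε : Lat N → Lat N → ℤˣ) (q : ℂ)

/-- The action of `e^a`, `a ∈ L_A`, on the zero modes: the coefficient of `z⁰` in the annihilation
part of the deformed field of `e^a`. The other coefficients vanish on the zero modes. -/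
def shiftOp (a : Fin N → ℤ) : Module.End ℂ (V N) := expCoeffQ ε q (a, 0) 0

theorem shiftOp_fC (a : Fin N → ℤ) (f : FMode N) (v : V N) :
    shiftOp ε q a (Fock.fC f v) = Fock.fC f (shiftOp ε q a v) := by
  rw [shiftOp, expCoeffQ, Module.End.mul_apply, Module.End.mul_apply, qShift,
    apply_of_mul_eq (Fock.onIdx_mul_fC _ f) v]
  exact apply_of_mul_eq (expCoeff_mul_fC ε _ _ f) _

theorem shiftOp_fD (a : Fin N → ℤ) (f : FMode N) (v : V N) :
    shiftOp ε q a (Fock.fD f v) = Fock.fD f (shiftOp ε q a v) := by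
  rw [shiftOp, expCoeffQ, Module.End.mul_apply, Module.End.mul_apply, qShift,
    apply_of_mul_eq (Fock.onIdx_mul_fD _ f) v]
  exact apply_of_mul_eq (expCoeff_mul_fD ε _ _ f) _

theorem expCoeff_zeroModes (a : Fin N → ℤ) {k : ℤ} (hk : k ≠ 0) {v : V N}
    (hv : v ∈ zeroModes N) : expCoeff ε (a, 0) k v = 0 := by
  induction hv using Submodule.span_induction with
  | mem w hw =>
    obtain ⟨⟨b, S⟩, rfl⟩ := hw
    have h : form ((a, 0) : Lat N) (b, 0) = 0 := by simp [form]
    simp only [zeroMode]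
    rw [expCoeff_single, h, ← C_1, zcoeff_expShift_C, if_neg (by omega), Finsupp.single_zero,
      smul_zero]
  | zero => exact map_zero _
  | add x y _ _ hx hy => rw [map_add, hx, hy, add_zero]
  | smul c x _ hx => rw [map_smul, hx, smul_zero]

theorem expAnnihilation_zeroModes (a : Fin N → ℤ) (d : ℤ) {v : V N} (hv : v ∈ zeroModes N) :
    expAnnihilation ε (a, 0) (Finsupp.single d v) =
      Finsupp.single d (expCoeff ε (a, 0) 0 v) := by
  refine Finsupp.ext fun e => ?_
  rw [isSeries_expAnnihilation, Finsupp.single_apply]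
  split_ifs with h
  · rw [h, sub_self]
  · exact expCoeff_zeroModes ε a (k := e - d) (by omega) hv

theorem psiExp_zeroModes (i : Fin N) (a : Fin N → ℤ) {v : V N} (hv : v ∈ zeroModes N) :
    qProd ε q 0 ((Gen.Psi i).coeff ((0 : ℕ) : ℤ) (expVec (a, 0))) v =
      shiftOp ε q a (Fock.fD (phiMode i 0) v) := by
  have h3 : InSector (a, 0) ((Gen.Psi i).coeff ((0 : ℕ) : ℤ) (expVec (a, 0))) :=
    (inSector_single (a, 0) ∅ 1).apply fun c => Gen.coeff_mul_onIdx _ _ _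
  have h4 : Fock.fD (phiMode i 0) (qShift q (a, 0) v) =
      qShift q (a, 0) (Fock.fD (phiMode i 0) v) :=
    (apply_of_mul_eq (Fock.onIdx_mul_fD _ _) v).symm
  rw [qProd_of_inSector _ _ _ h3, nProd_eq, preField_coeff, twist_expVec, preField_expVec,
    preField_expVec, one_mul, one_mul, LinearMap.add_apply, Pi.add_apply, LinearMap.comp_apply,
    LinearMap.comp_apply, LinearMap.comp_apply,
    annihilationPart_Psi_zeroModes i (qShift_mem_zeroModes q _ hv), h4,
    expAnnihilation_zeroModes ε a 0 (qShift_mem_zeroModes q _ hv),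
    expAnnihilation_zeroModes ε a (-1)
      (qShift_mem_zeroModes q _ (fD_mem_zeroModes i hv)), cauchy_single, cauchy_single,
    if_neg (by omega), if_pos (by omega), zero_add]
  exact LinearMap.congr_fun (coeff_zero_expCreation (a, 0)) _

/-- On zero modes, `D` is the Koszul differential of the operators `e^{Aⁱ} - e^{-A¹-⋯-Aᴺ}`. -/
theorem D_zeroModes {v : V N} (hv : v ∈ zeroModes N) :
    D ε q v = ∑ i, (shiftOp ε q (Pi.single i 1) (Fock.fD (phiMode i 0) v) -
      shiftOp ε q (fun _ => -1) (Fock.fD (phiMode i 0) v)) := by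
  rw [D_apply]
  refine Finset.sum_congr rfl fun i _ => ?_
  rw [genA, xiLast, psiExp_zeroModes ε q i _ hv, psiExp_zeroModes ε q i _ hv]

end

theorem apply_of_mul_eq_neg {W : Type*} [AddCommGroup W] [Module ℂ W]
    {S T S' T' : Module.End ℂ W} (h : S * T = -(S' * T')) (v : W) : S (T v) = -S' (T' v) :=
  LinearMap.congr_fun h v

theorem coeff_zero_mul (f g : PowerSeries (Module.End ℂ (V N))) :
    PowerSeries.coeff 0 (f * g) = PowerSeries.coeff 0 f * PowerSeries.coeff 0 g := by
  rw [PowerSeries.coeff_mul, Finset.Nat.antidiagonal_zero, Finset.sum_singleton]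

theorem coeff_zero_one_apply (v : V N) :
    PowerSeries.coeff 0 (1 : PowerSeries (Module.End ℂ (V N))) v = v := by
  rw [PowerSeries.coeff_one, if_pos rfl]
  rfl

theorem nProd_neg_one (ε : Lat N → Lat N → ℤˣ) (x y : V N) :
    nProd ε (-1) x y = preField ε 1 x (Finsupp.single 0 y) 0 := nProd_eq ε (-1) x y

theorem preField_fC_zeroModes (ε : Lat N → Lat N → ℤˣ) (C : PowerSeries (Module.End ℂ (V N)))
    (i : Fin N) (x : V N) {y : V N} (hy : y ∈ zeroModes N) :
    preField ε C (Fock.fC (phiMode i 0) x) (Finsupp.single 0 y) =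
      preField ε (C * creationPart (.Phi i) 0) x (Finsupp.single 0 y) := by
  rw [← Gen.coeff_Phi_nat i 0, preField_coeff, LinearMap.add_apply, LinearMap.comp_apply,
    annihilationPart_Phi_zeroModes i hy, map_zero, add_zero]

theorem coeff_zero_mul_creationPart_Phi (C : PowerSeries (Module.End ℂ (V N))) (i : Fin N)
    (v : V N) : PowerSeries.coeff 0 (C * creationPart (.Phi i) 0) v =
      PowerSeries.coeff 0 C (Fock.fC (phiMode i 0) v) := by
  rw [coeff_zero_mul, creationPart_zero, Gen.coeff_Phi_nat]
  rfl

/-- On zero modes the fields of zero modes are power series, so only the constant term of `C`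
contributes to the coefficient of `z⁰`. -/
theorem preField_zeroModes (ε : Lat N → Lat N → ℤˣ) {x : V N} (hx : x ∈ zeroModes N) :
    ∀ (C : PowerSeries (Module.End ℂ (V N))), ∀ y ∈ zeroModes N,
      preField ε C x (Finsupp.single 0 y) 0 = PowerSeries.coeff 0 C (nProd ε (-1) x y) := by
  induction hx using zeroModes_induction with
  | hexp a =>
    intro C y hy
    rw [nProd_neg_one, preField_expVec, preField_expVec, LinearMap.comp_apply,
      LinearMap.comp_apply, expAnnihilation_zeroModes ε a 0 hy, cauchy_single, cauchy_single,
      if_pos le_rfl, if_pos le_rfl, one_mul, sub_zero, Int.toNat_zero, coeff_zero_mul]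
    rfl
  | hadd v w hv hw ihv ihw =>
    intro C y hy
    simp only [map_add, LinearMap.add_apply, Pi.add_apply, ihv C y hy, ihw C y hy]
  | hsmul c v hv ihv =>
    intro C y hy
    simp only [map_smul, LinearMap.smul_apply, Pi.smul_apply, ihv C y hy]
  | hphi i v hv ih =>
    intro C y hy
    rw [nProd_neg_one, preField_fC_zeroModes ε C i v hy, preField_fC_zeroModes ε 1 i v hy,
      ih _ y hy, ih _ y hy, coeff_zero_mul_creationPart_Phi, coeff_zero_mul_creationPart_Phi]
    rw [coeff_zero_one_apply]

theorem nProd_fC_zeroModes (ε : Lat N → Lat N → ℤˣ) {x y : V N} (hx : x ∈ zeroModes N)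
    (hy : y ∈ zeroModes N) (i : Fin N) :
    nProd ε (-1) (Fock.fC (phiMode i 0) x) y = Fock.fC (phiMode i 0) (nProd ε (-1) x y) := by
  rw [nProd_neg_one, preField_fC_zeroModes ε 1 i x hy, preField_zeroModes ε hx _ y hy,
    coeff_zero_mul_creationPart_Phi, coeff_zero_one_apply]

theorem qProd_fC (ε : Lat N → Lat N → ℤˣ) (q : ℂ) {x y : V N} (hx : x ∈ zeroModes N)
    (hy : y ∈ zeroModes N) (i : Fin N) :
    qProd ε q (-1) (Fock.fC (phiMode i 0) x) y = Fock.fC (phiMode i 0) (qProd ε q (-1) x y) := by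
  induction hx using Submodule.span_induction with
  | mem w hw =>
    obtain ⟨⟨a, S⟩, rfl⟩ := hw
    have h1 : InSector (a, 0) (zeroMode a S) := inSector_single _ _ _
    rw [qProd_of_inSector _ _ _ h1,
      qProd_of_inSector _ _ _ (h1.apply fun c => Fock.onIdx_mul_fC c _)]
    exact nProd_fC_zeroModes ε (zeroMode_mem a S) (qShift_mem_zeroModes q _ hy) i
  | zero => simp only [map_zero, LinearMap.zero_apply]
  | add v w _ _ hv hw => simp only [map_add, LinearMap.add_apply, hv, hw]
  | smul c v _ hv => simp only [map_smul, LinearMap.smul_apply, hv]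

theorem qProd_expVec (ε : Lat N → Lat N → ℤˣ) (q : ℂ) (a : Fin N → ℤ) {y : V N}
    (hy : y ∈ zeroModes N) : qProd ε q (-1) (expVec (a, 0)) y = shiftOp ε q a y := by
  have h : InSector (a, 0) (expVec ((a, 0) : Lat N)) := inSector_single _ _ _
  rw [qProd_of_inSector _ _ _ h, nProd_neg_one, preField_expVec,
    LinearMap.comp_apply, expAnnihilation_zeroModes ε a 0 (qShift_mem_zeroModes q _ hy),
    cauchy_single, if_pos le_rfl, one_mul, sub_zero, Int.toNat_zero, coeff_zero_expCreation]
  rfl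

/-- `Φⁱ_0` is moved past `D` at the cost of the operator that `D` pairs with it. -/
theorem D_fC (ε : Lat N → Lat N → ℤˣ) (q : ℂ) {v : V N} (hv : v ∈ zeroModes N) (i : Fin N) :
    D ε q (Fock.fC (phiMode i 0) v) = -Fock.fC (phiMode i 0) (D ε q v) +
      (shiftOp ε q (Pi.single i 1) v - shiftOp ε q (fun _ => -1) v) := by
  have h : ∀ j, Fock.fD (phiMode j 0) (Fock.fC (phiMode i 0) v) =
      -Fock.fC (phiMode i 0) (Fock.fD (phiMode j 0) v) + if j = i then v else 0 := by
    intro j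
    refine (LinearMap.congr_fun (Fock.fD_mul_fC (I := Lat N) (K := BMode N)
      (phiMode j 0) (phiMode i 0)) v).trans ?_
    rw [LinearMap.add_apply]
    refine congrArg₂ (· + ·) rfl ?_
    by_cases hj : j = i
    · rw [if_pos hj, if_pos (by rw [hj])]; rfl
    · rw [if_neg hj, if_neg (by simpa using hj)]; rfl
  rw [D_zeroModes ε q hv, D_zeroModes ε q (fC_mem_zeroModes i hv)]
  simp only [h, map_add, map_neg, shiftOp_fC, apply_ite (shiftOp ε q _), map_zero, map_sum, map_sub]
  rw [← Finset.sum_neg_distrib]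
  simp only [add_sub_add_comm, Finset.sum_add_distrib]
  refine congrArg₂ (· + ·) (Finset.sum_congr rfl fun j _ => ?_) ?_
  · abel
  · rw [Finset.sum_sub_distrib, Finset.sum_ite_eq', Finset.sum_ite_eq', if_pos (Finset.mem_univ i),
      if_pos (Finset.mem_univ i)]

section

variable {ε : Lat N → Lat N → ℤˣ} (hε : IsTwist ε) (q : ℂ)

include hε

theorem shiftOp_comm (a b : Fin N → ℤ) (v : V N) :
    shiftOp ε q a (shiftOp ε q b v) = shiftOp ε q b (shiftOp ε q a v) :=
  expCoeffQ_comm hε q rfl rfl 0 0 v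

theorem shiftOp_zeroMode (a b : Fin N → ℤ) (S : Finset (Fin N)) :
    shiftOp ε q a (zeroMode b S) = q ^ (ht a + ht b - ht (a + b)).toNat • zeroMode (a + b) S := by
  have h : form ((a, 0) : Lat N) (b, 0) = 0 := by simp [form]
  rw [shiftOp, expCoeffQ, Module.End.mul_apply, zeroMode, qShift, Fock.onIdx_single,
    ← Finsupp.smul_single, map_smul, expCoeff_single, h, hε.trivial_left _ _ rfl, ← C_1,
    zcoeff_expShift_C, if_pos (sub_zero 0)]
  simp [zeroMode, defect]

theorem shiftOp_mem_zeroModes (a : Fin N → ℤ) {v : V N} (hv : v ∈ zeroModes N) :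
    shiftOp ε q a v ∈ zeroModes N :=
  map_mem_zeroModes (fun b S => by
    rw [shiftOp_zeroMode hε]
    exact Submodule.smul_mem _ _ (zeroMode_mem _ _)) hv

theorem D_mem_zeroModes {v : V N} (hv : v ∈ zeroModes N) : D ε q v ∈ zeroModes N := by
  rw [D_zeroModes ε q hv]
  exact Submodule.sum_mem _ fun i _ => sub_mem
    (shiftOp_mem_zeroModes hε q _ (fD_mem_zeroModes i hv))
    (shiftOp_mem_zeroModes hε q _ (fD_mem_zeroModes i hv))

theorem shiftOp_shiftOp (a b : Fin N → ℤ) {v : V N} (hv : v ∈ zeroModes N) :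
    shiftOp ε q a (shiftOp ε q b v) =
      q ^ (ht a + ht b - ht (a + b)).toNat • shiftOp ε q (a + b) v := by
  induction hv using Submodule.span_induction with
  | mem w hw =>
    obtain ⟨⟨c, S⟩, rfl⟩ := hw
    have h1 := ht_add_le a b
    have h2 := ht_add_le b c
    have h3 := ht_add_le a (b + c)
    have h4 := ht_add_le (a + b) c
    simp only [shiftOp_zeroMode hε, map_smul, smul_smul, ← pow_add, add_assoc] at h4 ⊢
    congr 2
    omega
  | zero => rw [map_zero, map_zero, map_zero, smul_zero]
  | add x y _ _ hx hy => rw [map_add, map_add, map_add, hx, hy, smul_add]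
  | smul c x _ hx => rw [map_smul, map_smul, map_smul, hx, smul_comm]

theorem shiftOp_zero {v : V N} (hv : v ∈ zeroModes N) : shiftOp ε q 0 v = v := by
  induction hv using Submodule.span_induction with
  | mem w hw =>
    obtain ⟨⟨c, S⟩, rfl⟩ := hw
    simp [shiftOp_zeroMode hε, ht_zero]
  | zero => exact map_zero _
  | add x y _ _ hx hy => rw [map_add, hx, hy]
  | smul c x _ hx => rw [map_smul, hx]

theorem qProd_mem_zeroModes {x y : V N} (hx : x ∈ zeroModes N) (hy : y ∈ zeroModes N) :
    qProd ε q (-1) x y ∈ zeroModes N := by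
  induction hx using zeroModes_induction with
  | hexp a => rw [qProd_expVec ε q a hy]; exact shiftOp_mem_zeroModes hε q a hy
  | hadd v w _ _ hv hw => rw [map_add]; exact add_mem hv hw
  | hsmul c v _ hv => rw [map_smul]; exact Submodule.smul_mem _ _ hv
  | hphi i v hv ih => rw [qProd_fC ε q hv hy]; exact fC_mem_zeroModes i ih

theorem qProd_shiftOp (a : Fin N → ℤ) {x y : V N} (hx : x ∈ zeroModes N) (hy : y ∈ zeroModes N) :
    qProd ε q (-1) (shiftOp ε q a x) y = shiftOp ε q a (qProd ε q (-1) x y) := by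
  induction hx using zeroModes_induction with
  | hexp b =>
    rw [qProd_expVec ε q b hy, shiftOp_shiftOp hε q a b hy, ← zeroMode_empty, shiftOp_zeroMode hε,
      map_smul, zeroMode_empty, LinearMap.smul_apply, qProd_expVec ε q _ hy]
  | hadd v w _ _ hv hw => simp only [map_add, LinearMap.add_apply, hv, hw]
  | hsmul c v _ hv => simp only [map_smul, LinearMap.smul_apply, hv]
  | hphi i v hv ih =>
    rw [shiftOp_fC, qProd_fC ε q (shiftOp_mem_zeroModes hε q a hv) hy, ih, qProd_fC ε q hv hy,
      shiftOp_fC]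

/-- On zero modes, `D` is an odd derivation of the product. -/
theorem D_qProd {x y : V N} (hx : x ∈ zeroModes N) (hy : y ∈ zeroModes N) :
    D ε q (qProd ε q (-1) x y) = qProd ε q (-1) (D ε q x) y +
      qProd ε q (-1) (Fock.parity x) (D ε q y) := by
  induction hx using zeroModes_induction with
  | hexp a =>
    have h1 : D ε q (expVec (a, 0)) = 0 := by
      rw [← zeroMode_empty, D_zeroModes ε q (zeroMode_mem a ∅)]
      refine Finset.sum_eq_zero fun i _ => ?_
      rw [fD_zeroMode, if_neg (Finset.notMem_empty i), map_zero, map_zero, sub_zero]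
    have h2 : Fock.parity (expVec ((a, 0) : Lat N)) = expVec (a, 0) := by simp [expVec]
    rw [h1, h2, map_zero, LinearMap.zero_apply, zero_add, qProd_expVec ε q a hy,
      qProd_expVec ε q a (D_mem_zeroModes hε q hy), D_zeroModes ε q hy,
      D_zeroModes ε q (shiftOp_mem_zeroModes hε q a hy), map_sum]
    refine Finset.sum_congr rfl fun i _ => ?_
    rw [← shiftOp_fD, map_sub, shiftOp_comm hε q a, shiftOp_comm hε q a]
  | hadd v w _ _ hv hw =>
    simp only [map_add, LinearMap.add_apply, hv, hw]
    abel
  | hsmul c v _ hv => simp only [map_smul, LinearMap.smul_apply, hv, smul_add]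
  | hphi i v hv ih =>
    have h2 : Fock.parity (Fock.fC (phiMode i 0) v) = -Fock.fC (phiMode i 0) (Fock.parity v) :=
      apply_of_mul_eq_neg (Fock.parity_mul_fC (phiMode i 0)) v
    have h3 : Fock.parity v ∈ zeroModes N := map_mem_zeroModes (fun a S => by
      rw [zeroMode, Fock.parity_single]
      exact Submodule.smul_mem _ _ (zeroMode_mem _ _)) hv
    have hD := D_mem_zeroModes hε q hv
    rw [qProd_fC ε q hv hy, D_fC ε q (qProd_mem_zeroModes hε q hv hy), ih, D_fC ε q hv, h2]
    simp only [map_add, map_neg, map_sub, LinearMap.add_apply, LinearMap.neg_apply,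
      LinearMap.sub_apply]
    rw [qProd_fC ε q hD hy, qProd_fC ε q h3 (D_mem_zeroModes hε q hy), qProd_shiftOp hε q _ hv hy,
      qProd_shiftOp hε q _ hv hy]
    abel

end

/-! ### The deformed group ring of `L_A` -/

section Action

variable {W : Type*} [AddCommGroup W] [Module ℂ W]

open scoped IsMulCommutative in
/-- Commuting operators `T` and `Yᵢ` define an action of the polynomial ring. -/
theorem exists_polynomialAction (T : Module.End ℂ W) (Y : Fin N → Module.End ℂ W)
    (hT : ∀ i, Commute T (Y i)) (hY : ∀ i j, Commute (Y i) (Y j)) :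
    ∃ M : Polynomial (MvPolynomial (Fin N) ℂ) →+* Module.End ℂ W,
      M Polynomial.X = T ∧ (∀ i, M (Polynomial.C (X i)) = Y i) ∧
        ∀ c : ℂ, M (Polynomial.C (C c)) = c • 1 := by
  have hcomm : ∀ a ∈ insert T (Set.range Y), ∀ b ∈ insert T (Set.range Y), a * b = b * a := by
    rintro a (rfl | ⟨i, rfl⟩) b (rfl | ⟨j, rfl⟩)
    · rfl
    · exact hT j
    · exact (hT i).symm
    · exact hY i j
  have := Algebra.isMulCommutative_adjoin ℂ hcomm
  let t : Algebra.adjoin ℂ (insert T (Set.range Y)) :=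
    ⟨T, Algebra.subset_adjoin (Set.mem_insert _ _)⟩
  let y : Fin N → Algebra.adjoin ℂ (insert T (Set.range Y)) := fun i =>
    ⟨Y i, Algebra.subset_adjoin (Set.mem_insert_of_mem _ ⟨i, rfl⟩)⟩
  let f : MvPolynomial (Fin N) ℂ →+* Algebra.adjoin ℂ (insert T (Set.range Y)) :=
    MvPolynomial.eval₂Hom (algebraMap ℂ _) y
  refine ⟨((Algebra.adjoin ℂ (insert T (Set.range Y))).val : _ →+* Module.End ℂ W).comp
    (Polynomial.eval₂RingHom f t), ?_, fun i => ?_, fun c => ?_⟩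
  · simp [t]
  · simp [f, y]
  · simp [f, Algebra.algebraMap_eq_smul_one]

end Action

/-- The polynomial ring `ℂ[y₁, …, y_N][T]`, where `T` stands for `e^{-A¹-⋯-Aᴺ}` and `yᵢ` for
`e^{Aⁱ} - e^{-A¹-⋯-Aᴺ}`. -/
abbrev PolyRing (N : ℕ) : Type := Polynomial (MvPolynomial (Fin N) ℂ)

/-- The element `xᵢ = T + yᵢ`, which stands for `e^{Aⁱ}`. -/
def xVar (i : Fin N) : PolyRing N := Polynomial.X + Polynomial.C (X i)

/-- The monomial `x₁^{n₁} ⋯ x_N^{n_N} T^{n_{N+1}}` for `a = ∑ nⱼ ξⱼ`, with at most `N` of the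
exponents positive. It stands for `e^a`. -/
def fanMonomial (a : Fin N → ℤ) : PolyRing N :=
  (∏ i, xVar i ^ (a i + lastCoord a).toNat) * Polynomial.X ^ lastCoord a

/-- The relation `T x₁ ⋯ x_N = q^{N+1}`. -/
def fanRelation (N : ℕ) (q : ℂ) : PolyRing N :=
  Polynomial.X * ∏ i, xVar i - Polynomial.C (C (q ^ (N + 1)))

theorem monic_xVar (i : Fin N) : (xVar i).Monic := Polynomial.monic_X_add_C _

theorem monic_X_mul_prod : (Polynomial.X * ∏ i, xVar i : PolyRing N).Monic :=
  Polynomial.monic_X.mul (Polynomial.monic_prod_of_monic _ _ fun i _ => monic_xVar i)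

theorem natDegree_X_mul_prod : (Polynomial.X * ∏ i, xVar i : PolyRing N).natDegree = N + 1 := by
  rw [Polynomial.monic_X.natDegree_mul (Polynomial.monic_prod_of_monic _ _ fun i _ => monic_xVar i),
    Polynomial.natDegree_X, Polynomial.natDegree_prod_of_monic _ _ fun i _ => monic_xVar i]
  simp [xVar, add_comm]

theorem monic_fanRelation (q : ℂ) : (fanRelation N q).Monic := by
  refine monic_X_mul_prod.sub_of_left (Polynomial.degree_lt_degree ?_)
  rw [natDegree_X_mul_prod, Polynomial.natDegree_C]
  exact Nat.succ_pos N

theorem lastCoord_add_le (a b : Fin N → ℤ) : lastCoord (a + b) ≤ lastCoord a + lastCoord b :=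
  lastCoord_le _ _ fun i => by
    have := neg_le_lastCoord a i
    have := neg_le_lastCoord b i
    simp only [Pi.add_apply]
    push_cast
    omega

theorem ht_eq_sum (a : Fin N → ℤ) : ht a = ∑ i, a i + (N + 1) * lastCoord a := by
  rw [ht, Finset.sum_add_distrib, Finset.sum_const, Finset.card_univ, Fintype.card_fin,
    nsmul_eq_mul]
  ring

/-- Two representations of an element of `L_A` by the `ξⱼ` differ by a multiple of
`ξ₁ + ⋯ + ξ_{N+1} = 0`, which has `N + 1` terms. -/
theorem ht_defect (a b : Fin N → ℤ) : (ht a + ht b - ht (a + b)).toNat =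
    (N + 1) * (lastCoord a + lastCoord b - lastCoord (a + b)) := by
  have h := lastCoord_add_le a b
  obtain ⟨k, hk⟩ := Nat.exists_eq_add_of_le h
  have h2 : ht a + ht b - ht (a + b) = (((N + 1) * k : ℕ) : ℤ) := by
    have hk' : (lastCoord a : ℤ) + lastCoord b = lastCoord (a + b) + k := by exact_mod_cast hk
    simp only [ht_eq_sum, Pi.add_apply, Finset.sum_add_distrib]
    push_cast
    linear_combination ((N : ℤ) + 1) * hk'
  rw [h2, Int.toNat_natCast, hk, Nat.add_sub_cancel_left]

theorem fanMonomial_mul (a b : Fin N → ℤ) : fanMonomial a * fanMonomial b =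
    (Polynomial.X * ∏ i, xVar i) ^ (lastCoord a + lastCoord b - lastCoord (a + b)) *
      fanMonomial (a + b) := by
  have h := lastCoord_add_le a b
  obtain ⟨k, hk⟩ := Nat.exists_eq_add_of_le h
  have h1 : (∏ i, (xVar i : PolyRing N) ^ (a i + lastCoord a).toNat) *
      ∏ i, xVar i ^ (b i + lastCoord b).toNat =
      (∏ i, xVar i ^ k) * ∏ i, xVar i ^ ((a + b) i + lastCoord (a + b)).toNat := by
    rw [← Finset.prod_mul_distrib, ← Finset.prod_mul_distrib]
    refine Finset.prod_congr rfl fun i _ => ?_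
    have h2 := neg_le_lastCoord a i
    have h3 := neg_le_lastCoord b i
    have h4 := neg_le_lastCoord (a + b) i
    rw [← pow_add, ← pow_add]
    congr 1
    simp only [Pi.add_apply] at h4 ⊢
    omega
  have h2 : (Polynomial.X : PolyRing N) ^ lastCoord a * Polynomial.X ^ lastCoord b =
      Polynomial.X ^ k * Polynomial.X ^ lastCoord (a + b) := by
    rw [← pow_add, ← pow_add, hk, add_comm]
  rw [hk, Nat.add_sub_cancel_left, fanMonomial, fanMonomial, fanMonomial, mul_pow,
    ← Finset.prod_pow, mul_mul_mul_comm, h1, h2]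
  ring

/-- Modulo the relation, the monomials multiply as the deformed group ring does. -/
theorem fanRelation_dvd (q : ℂ) (a b : Fin N → ℤ) :
    fanRelation N q ∣ fanMonomial a * fanMonomial b -
      Polynomial.C (C (q ^ (ht a + ht b - ht (a + b)).toNat)) * fanMonomial (a + b) := by
  rw [fanMonomial_mul, ← sub_mul, ht_defect, pow_mul, map_pow, map_pow]
  exact (sub_dvd_pow_sub_pow _ _ _).mul_right _

theorem lastCoord_single (i : Fin N) : lastCoord (Pi.single i (1 : ℤ)) = 0 := by
  refine Nat.le_zero.mp (lastCoord_le _ _ fun j => ?_)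
  by_cases h : j = i
  · subst h; simp
  · simp [Pi.single_eq_of_ne h]

theorem lastCoord_neg_one (hN : 1 ≤ N) : lastCoord (fun _ : Fin N => (-1 : ℤ)) = 1 := by
  refine le_antisymm (lastCoord_le _ _ fun j => by simp) ?_
  have h := neg_le_lastCoord (fun _ : Fin N => (-1 : ℤ)) ⟨0, hN⟩
  omega

theorem ht_single (i : Fin N) : ht (Pi.single i (1 : ℤ)) = 1 := by
  rw [ht_eq_sum, lastCoord_single]
  simp

theorem ht_neg_one (hN : 1 ≤ N) : ht (fun _ : Fin N => (-1 : ℤ)) = 1 := by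
  rw [ht_eq_sum, lastCoord_neg_one hN]
  simp

theorem fanMonomial_single (i : Fin N) : fanMonomial (Pi.single i (1 : ℤ)) = xVar i := by
  rw [fanMonomial, lastCoord_single, pow_zero, mul_one, Finset.prod_eq_single i]
  · simp
  · intro j _ hj
    simp [Pi.single_eq_of_ne hj]
  · simp

theorem fanMonomial_neg_one (hN : 1 ≤ N) :
    fanMonomial (fun _ : Fin N => (-1 : ℤ)) = Polynomial.X := by
  rw [fanMonomial, lastCoord_neg_one hN]
  simp

/-! ### The action of the deformed group ring on the zero modes -/

/-- The image of the polynomial ring is generated by the images of the scalars and the variables. -/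
theorem polynomialAction_induction {W : Type*} [AddCommGroup W] [Module ℂ W]
    {M : PolyRing N →+* Module.End ℂ W} (hM : ∀ c : ℂ, M (Polynomial.C (C c)) = c • 1)
    {p : Module.End ℂ W → Prop} (hX : p (M Polynomial.X)) (hY : ∀ i, p (M (Polynomial.C (X i))))
    (hone : p 1) (hsmul : ∀ (c : ℂ) S, p S → p (c • S)) (hadd : ∀ S T, p S → p T → p (S + T))
    (hmul : ∀ S T, p S → p T → p (S * T)) (f : PolyRing N) : p (M f) := by
  have hC : ∀ g : MvPolynomial (Fin N) ℂ, p (M (Polynomial.C g)) := by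
    intro g
    induction g using MvPolynomial.induction_on with
    | C c => rw [hM]; exact hsmul c 1 hone
    | add g h hg hh => rw [map_add, map_add]; exact hadd _ _ hg hh
    | mul_X g i hg => rw [map_mul, map_mul]; exact hmul _ _ hg (hY i)
  induction f using Polynomial.induction_on' with
  | add f g hf hg => rw [map_add]; exact hadd _ _ hf hg
  | monomial n g =>
    rw [← Polynomial.C_mul_X_pow_eq_monomial, map_mul, map_pow]
    refine hmul _ _ (hC g) ?_
    induction n with
    | zero => rw [pow_zero]; exact hone
    | succ n ih => rw [pow_succ]; exact hmul _ _ ih hX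

/-- The operator `e^{Aⁱ} - e^{-A¹-⋯-Aᴺ}` on zero modes. -/
def diffOp (ε : Lat N → Lat N → ℤˣ) (q : ℂ) (i : Fin N) : Module.End ℂ (V N) :=
  shiftOp ε q (Pi.single i 1) - shiftOp ε q fun _ => -1

theorem diffOp_apply (ε : Lat N → Lat N → ℤˣ) (q : ℂ) (i : Fin N) (v : V N) :
    diffOp ε q i v = shiftOp ε q (Pi.single i 1) v - shiftOp ε q (fun _ => -1) v := rfl

theorem exists_polyAction {ε : Lat N → Lat N → ℤˣ} (hε : IsTwist ε) (q : ℂ) :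
    ∃ M : PolyRing N →+* Module.End ℂ (V N),
      M Polynomial.X = (shiftOp ε q fun _ => -1) ∧
        (∀ i, M (Polynomial.C (X i)) = diffOp ε q i) ∧
        ∀ c : ℂ, M (Polynomial.C (C c)) = c • 1 := by
  refine exists_polynomialAction _ _ (fun i => LinearMap.ext fun v => ?_)
    (fun i j => LinearMap.ext fun v => ?_)
  · simp only [Module.End.mul_apply, diffOp_apply, map_sub]
    rw [shiftOp_comm hε q]
  · simp only [Module.End.mul_apply, diffOp_apply, map_sub]
    rw [shiftOp_comm hε q, shiftOp_comm hε q _ (fun _ => -1), shiftOp_comm hε q (fun _ => -1)]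
    abel

/-- The action of `ℂ[y₁, …, y_N][T]` for which `T` acts as `e^{-A¹-⋯-Aᴺ}` and `yᵢ` as
`e^{Aⁱ} - e^{-A¹-⋯-Aᴺ}`. -/
def polyAction {ε : Lat N → Lat N → ℤˣ} (hε : IsTwist ε) (q : ℂ) :
    PolyRing N →+* Module.End ℂ (V N) := (exists_polyAction hε q).choose

section

variable {ε : Lat N → Lat N → ℤˣ} (hε : IsTwist ε) (q : ℂ)

theorem polyAction_X : polyAction hε q Polynomial.X = shiftOp ε q fun _ => -1 :=
  (exists_polyAction hε q).choose_spec.1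

theorem polyAction_C_X (i : Fin N) : polyAction hε q (Polynomial.C (X i)) = diffOp ε q i :=
  (exists_polyAction hε q).choose_spec.2.1 i

theorem polyAction_C_C (c : ℂ) : polyAction hε q (Polynomial.C (C c)) = c • 1 :=
  (exists_polyAction hε q).choose_spec.2.2 c

theorem polyAction_mul (f g : PolyRing N) (v : V N) :
    polyAction hε q (f * g) v = polyAction hε q f (polyAction hε q g v) := by
  rw [map_mul, Module.End.mul_apply]

theorem polyAction_add (f g : PolyRing N) (v : V N) :
    polyAction hε q (f + g) v = polyAction hε q f v + polyAction hε q g v := by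
  rw [map_add, LinearMap.add_apply]

theorem polyAction_sub (f g : PolyRing N) (v : V N) :
    polyAction hε q (f - g) v = polyAction hε q f v - polyAction hε q g v := by
  rw [map_sub, LinearMap.sub_apply]

theorem polyAction_C_C_mul (c : ℂ) (f : PolyRing N) (v : V N) :
    polyAction hε q (Polynomial.C (C c) * f) v = c • polyAction hε q f v := by
  rw [polyAction_mul, polyAction_C_C]
  rfl

theorem polyAction_xVar (i : Fin N) :
    polyAction hε q (xVar i) = shiftOp ε q (Pi.single i 1) := by
  refine LinearMap.ext fun v => ?_
  rw [xVar, polyAction_add, polyAction_X, polyAction_C_X, diffOp_apply]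
  abel

theorem polyAction_fD (f : PolyRing N) (m : FMode N) (v : V N) :
    polyAction hε q f (Fock.fD m v) = Fock.fD m (polyAction hε q f v) := by
  revert v
  refine polynomialAction_induction (polyAction_C_C hε q)
    (p := fun T => ∀ v, T (Fock.fD m v) = Fock.fD m (T v)) ?_ ?_ ?_ ?_ ?_ ?_ f
  · rw [polyAction_X]; exact shiftOp_fD ε q _ m
  · intro i v
    rw [polyAction_C_X, diffOp_apply, diffOp_apply, shiftOp_fD, shiftOp_fD, map_sub]
  · exact fun v => rfl
  · intro c S hS v
    rw [LinearMap.smul_apply, LinearMap.smul_apply, hS, map_smul]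
  · intro S T hS hT v
    rw [LinearMap.add_apply, LinearMap.add_apply, hS, hT, map_add]
  · intro S T hS hT v
    rw [Module.End.mul_apply, Module.End.mul_apply, hT, hS]

theorem polyAction_mem_zeroModes (f : PolyRing N) {v : V N} (hv : v ∈ zeroModes N) :
    polyAction hε q f v ∈ zeroModes N := by
  revert v
  refine polynomialAction_induction (polyAction_C_C hε q)
    (p := fun T => ∀ {v}, v ∈ zeroModes N → T v ∈ zeroModes N) ?_ ?_ ?_ ?_ ?_ ?_ f
  · rw [polyAction_X]; exact fun hv => shiftOp_mem_zeroModes hε q _ hv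
  · intro i v hv
    rw [polyAction_C_X]
    exact sub_mem (shiftOp_mem_zeroModes hε q _ hv) (shiftOp_mem_zeroModes hε q _ hv)
  · exact fun hv => hv
  · exact fun c S hS v hv => Submodule.smul_mem _ c (hS hv)
  · exact fun S T hS hT v hv => add_mem (hS hv) (hT hv)
  · exact fun S T hS hT v hv => hS (hT hv)

/-- The product of zero modes is linear over the deformed group ring. -/
theorem qProd_polyAction (f : PolyRing N) {x y : V N} (hx : x ∈ zeroModes N)
    (hy : y ∈ zeroModes N) : qProd ε q (-1) (polyAction hε q f x) y =
      polyAction hε q f (qProd ε q (-1) x y) := by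
  suffices h : (∀ x, x ∈ zeroModes N → polyAction hε q f x ∈ zeroModes N ∧
      qProd ε q (-1) (polyAction hε q f x) y = polyAction hε q f (qProd ε q (-1) x y)) from
    (h x hx).2
  refine polynomialAction_induction (polyAction_C_C hε q)
    (p := fun T => ∀ x, x ∈ zeroModes N → T x ∈ zeroModes N ∧
      qProd ε q (-1) (T x) y = T (qProd ε q (-1) x y)) ?_ ?_ ?_ ?_ ?_ ?_ f
  · rw [polyAction_X]
    exact fun x hx => ⟨shiftOp_mem_zeroModes hε q _ hx, qProd_shiftOp hε q _ hx hy⟩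
  · intro i x hx
    rw [polyAction_C_X]
    refine ⟨sub_mem (shiftOp_mem_zeroModes hε q _ hx) (shiftOp_mem_zeroModes hε q _ hx), ?_⟩
    rw [diffOp_apply, diffOp_apply, map_sub, LinearMap.sub_apply, qProd_shiftOp hε q _ hx hy,
      qProd_shiftOp hε q _ hx hy]
  · exact fun x hx => ⟨hx, rfl⟩
  · intro c S hS x hx
    refine ⟨Submodule.smul_mem _ c (hS x hx).1, ?_⟩
    rw [LinearMap.smul_apply, LinearMap.smul_apply, map_smul, LinearMap.smul_apply, (hS x hx).2]
  · intro S T hS hT x hx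
    refine ⟨add_mem (hS x hx).1 (hT x hx).1, ?_⟩
    rw [LinearMap.add_apply, LinearMap.add_apply, map_add, LinearMap.add_apply, (hS x hx).2,
      (hT x hx).2]
  · intro S T hS hT x hx
    refine ⟨(hS _ (hT x hx).1).1, ?_⟩
    rw [Module.End.mul_apply, Module.End.mul_apply, (hS _ (hT x hx).1).2, (hT x hx).2]

theorem D_eq_sum_polyAction {v : V N} (hv : v ∈ zeroModes N) : D ε q v =
    ∑ i, polyAction hε q (Polynomial.C (X i)) (Fock.fD (phiMode i 0) v) := by
  rw [D_zeroModes ε q hv]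
  exact Finset.sum_congr rfl fun i _ => by rw [polyAction_C_X, diffOp_apply]

theorem D_polyAction (f : PolyRing N) {v : V N} (hv : v ∈ zeroModes N) :
    D ε q (polyAction hε q f v) = polyAction hε q f (D ε q v) := by
  rw [D_eq_sum_polyAction hε q (polyAction_mem_zeroModes hε q f hv),
    D_eq_sum_polyAction hε q hv, map_sum]
  refine Finset.sum_congr rfl fun i _ => ?_
  rw [← polyAction_fD, ← polyAction_mul, ← polyAction_mul, mul_comm]

/-- The polynomial `f` acts on zero modes as `e^c` up to a power of `q`, where `l` is the sum of the
heights of the factors of `f`. -/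
def ActsAsShift (f : PolyRing N) (c : Fin N → ℤ) (l : ℤ) : Prop :=
  ∀ b S, ht (c + b) ≤ l + ht b ∧
    polyAction hε q f (zeroMode b S) = q ^ (l + ht b - ht (c + b)).toNat • zeroMode (c + b) S

variable {hε q}

theorem ActsAsShift.one : ActsAsShift hε q 1 0 0 := by
  intro b S
  rw [map_one, zero_add]
  simp

theorem ActsAsShift.mul {f g : PolyRing N} {c d : Fin N → ℤ} {k l : ℤ}
    (hf : ActsAsShift hε q f c k) (hg : ActsAsShift hε q g d l) :
    ActsAsShift hε q (f * g) (c + d) (k + l) := by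
  intro b S
  have h1 := hg b S
  have h2 := hf (d + b) S
  rw [polyAction_mul, h1.2, map_smul, h2.2, smul_smul, ← pow_add, add_assoc]
  refine ⟨by linarith [h1.1, h2.1], ?_⟩
  congr 2
  have := h1.1
  have := h2.1
  omega

theorem ActsAsShift.pow {f : PolyRing N} {c : Fin N → ℤ} {l : ℤ}
    (hf : ActsAsShift hε q f c l) (n : ℕ) : ActsAsShift hε q (f ^ n) (n • c) (n * l) := by
  induction n with
  | zero => simpa using ActsAsShift.one
  | succ n ih =>
    have h := ih.mul hf
    rw [pow_succ, succ_nsmul]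
    convert h using 1
    push_cast
    ring

theorem ActsAsShift.prod {f : Fin N → PolyRing N} {c : Fin N → Fin N → ℤ} {l : Fin N → ℤ}
    (hf : ∀ i, ActsAsShift hε q (f i) (c i) (l i)) (t : Finset (Fin N)) :
    ActsAsShift hε q (∏ i ∈ t, f i) (∑ i ∈ t, c i) (∑ i ∈ t, l i) := by
  induction t using Finset.cons_induction with
  | empty => exact ActsAsShift.one
  | cons i t hi ih =>
    rw [Finset.prod_cons, Finset.sum_cons, Finset.sum_cons]
    exact (hf i).mul ih

theorem actsAsShift_of_shiftOp {f : PolyRing N} {c : Fin N → ℤ}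
    (hf : polyAction hε q f = shiftOp ε q c) : ActsAsShift hε q f c (ht c) := by
  intro b S
  rw [hf, shiftOp_zeroMode hε]
  exact ⟨ht_add_le c b, rfl⟩

theorem actsAsShift_xVar (i : Fin N) : ActsAsShift hε q (xVar i) (Pi.single i 1) 1 := by
  have h := actsAsShift_of_shiftOp (polyAction_xVar hε q i)
  rwa [ht_single] at h

theorem actsAsShift_X (hN : 1 ≤ N) : ActsAsShift hε q Polynomial.X (fun _ => -1) 1 := by
  have h := actsAsShift_of_shiftOp (polyAction_X hε q)
  rwa [ht_neg_one hN] at h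

theorem sum_smul_single (n : Fin N → ℕ) :
    ∑ i, n i • (Pi.single i (1 : ℤ) : Fin N → ℤ) = fun i => (n i : ℤ) := by
  funext j
  rw [Finset.sum_apply, Finset.sum_eq_single j]
  · simp
  · intro i _ hi
    simp [Pi.single_eq_of_ne hi.symm]
  · simp

/-- No powers of `q` occur, as at most `N` of the exponents in the monomial are positive, so that
all its factors lie in one cone of the fan. -/
theorem polyAction_fanMonomial (hN : 1 ≤ N) (a : Fin N → ℤ) (S : Finset (Fin N)) :
    polyAction hε q (fanMonomial a) (zeroMode 0 S) = zeroMode a S := by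
  have h := (ActsAsShift.prod (fun i => (actsAsShift_xVar (hε := hε) (q := q) i).pow
    (a i + lastCoord a).toNat) Finset.univ).mul ((actsAsShift_X hN).pow (lastCoord a))
  have h1 : ∑ i, (a i + lastCoord a).toNat • (Pi.single i (1 : ℤ) : Fin N → ℤ) +
      lastCoord a • (fun _ => -1) = a := by
    rw [sum_smul_single]
    funext i
    have := neg_le_lastCoord a i
    rw [Pi.add_apply, Pi.smul_apply, smul_neg, nsmul_one]
    omega
  have h2 : ∑ i, (((a i + lastCoord a).toNat : ℕ) : ℤ) * 1 + (lastCoord a : ℤ) * 1 = ht a := by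
    rw [ht, mul_one]
    congr 1
    refine Finset.sum_congr rfl fun i _ => ?_
    have := neg_le_lastCoord a i
    omega
  rw [h1, h2] at h
  have h3 := (h 0 S).2
  rw [add_zero, ht_zero, add_zero, sub_self] at h3
  rw [fanMonomial, h3]
  simp

/-- `e^{-A¹-⋯-Aᴺ} e^{A¹} ⋯ e^{Aᴺ} = q^{N+1} e⁰` in the deformed group ring. -/
theorem polyAction_fanRelation (hN : 1 ≤ N) {v : V N} (hv : v ∈ zeroModes N) :
    polyAction hε q (fanRelation N q) v = 0 := by
  induction hv using Submodule.span_induction with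
  | mem w hw =>
    obtain ⟨⟨a, S⟩, rfl⟩ := hw
    have h := (actsAsShift_X (hε := hε) (q := q) hN).mul
      (ActsAsShift.prod (fun i => actsAsShift_xVar (hε := hε) (q := q) i) Finset.univ)
    have h1 : (fun _ => -1) + ∑ i, (Pi.single i (1 : ℤ) : Fin N → ℤ) = 0 := by
      have := sum_smul_single (fun _ : Fin N => 1)
      simp only [one_smul] at this
      rw [this]
      funext i
      simp
    rw [h1] at h
    have h2 := (h a S).2
    rw [zero_add, add_sub_cancel_right] at h2
    rw [fanRelation, polyAction_sub, h2, polyAction_C_C]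
    have h3 : ((1 : ℤ) + ∑ i : Fin N, 1).toNat = N + 1 := by
      simp
      omega
    rw [h3]
    exact sub_self _
  | zero => exact map_zero _
  | add x y _ _ hx hy => rw [map_add, hx, hy, add_zero]
  | smul c x _ hx => rw [map_smul, hx, smul_zero]

/-- As the relation is monic in `T`, every polynomial may be replaced by its remainder. -/
theorem polyAction_modByMonic (hN : 1 ≤ N) (f : PolyRing N) {v : V N} (hv : v ∈ zeroModes N) :
    polyAction hε q (f %ₘ fanRelation N q) v = polyAction hε q f v := by
  conv_rhs => rw [← Polynomial.modByMonic_add_div f (fanRelation N q)]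
  rw [polyAction_add, mul_comm, polyAction_mul, polyAction_fanRelation hN hv, map_zero, add_zero]

end

/-! ### The Koszul complex -/

/-- The Koszul complex of `y₁, …, y_N` on `ℂ[y₁, …, y_N][T]`: the copy with index `k` is spanned
by the multiples of `T^k`. -/
abbrev KoszulSpace (N : ℕ) : Type := Fock.Space ℕ (Fin N) (Fin N)

/-- The differential of the Koszul complex. -/
def koszulD (N : ℕ) : Module.End ℂ (KoszulSpace N) := ∑ i, Fock.bC i * Fock.fD i

/-- The de Rham differential, which is a homotopy operator for the Koszul complex. -/
def deRham (N : ℕ) : Module.End ℂ (KoszulSpace N) := ∑ i, Fock.fC i * Fock.bD i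

/-- The total degree in the Koszul complex, where `yᵢ` and the odd generators have degree one. -/
def koszulDegree (S : Finset (Fin N)) (m : Fin N →₀ ℕ) : ℕ :=
  ∑ i, (m i + if i ∈ S then 1 else 0)

theorem Bracket.mul_self_eq_zero {W : Type*} [AddCommGroup W] [Module ℂ W] {X : Module.End ℂ W}
    (h : Bracket (-1) X X 0) : X * X = 0 := by
  rw [Bracket, neg_one_smul, add_zero] at h
  have h2 : (2 : ℂ) • (X * X) = 0 := by
    rw [two_smul]
    exact add_eq_zero_iff_eq_neg.mpr h
  exact (smul_eq_zero.mp h2).resolve_left two_ne_zero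

theorem Bracket.sum_mul_left {E ι : Type*} [Ring E] [Algebra ℂ E] [Fintype ι] {s t : ℂ}
    {X X' Z Z' : ι → E} {Y : E} (h : ∀ i, Bracket s (X i) Y (Z i))
    (h' : ∀ i, Bracket t (X' i) Y (Z' i)) :
    Bracket (s * t) (∑ i, X i * X' i) Y (∑ i, (t • (Z i * X' i) + X i * Z' i)) :=
  Bracket.sum_left _ fun i _ => (h i).mul_left (h' i)

theorem bracket_koszulD_bC (j : Fin N) : Bracket 1 (koszulD N) (Fock.bC j) 0 :=
  (Bracket.sum_mul_left (fun i => Fock.bracket_bC_bC i j)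
    fun i => Fock.bracket_fD_bC i j).congr (one_mul 1)
    (Finset.sum_eq_zero fun i _ => by rw [zero_mul, smul_zero, mul_zero, add_zero])

theorem bracket_koszulD_fD (j : Fin N) : Bracket (-1) (koszulD N) (Fock.fD j) 0 :=
  (Bracket.sum_mul_left (fun i => Fock.bracket_bC_fD j i)
    fun i => Fock.bracket_fD_fD i j).congr (one_mul _)
    (Finset.sum_eq_zero fun i _ => by rw [zero_mul, smul_zero, mul_zero, add_zero])

theorem bracket_koszulD_fC (j : Fin N) : Bracket (-1) (koszulD N) (Fock.fC j) (Fock.bC j) := by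
  refine (Bracket.sum_mul_left (fun i => Fock.bracket_bC_fC j i)
    fun i => Fock.bracket_fD_fC i j).congr (one_mul _) ?_
  rw [Finset.sum_eq_single j]
  · rw [if_pos rfl, zero_mul, smul_zero, mul_one, zero_add]
  · intro i _ hi
    rw [if_neg hi, zero_mul, smul_zero, mul_zero, add_zero]
  · exact fun h => absurd (Finset.mem_univ j) h

theorem bracket_koszulD_bD (j : Fin N) : Bracket 1 (koszulD N) (Fock.bD j) (-Fock.fD j) := by
  refine (Bracket.sum_mul_left (fun i => Fock.bracket_bC_bD i j)
    fun i => Fock.bracket_fD_bD i j).congr (one_mul _) ?_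
  rw [Finset.sum_eq_single j]
  · rw [if_pos rfl, one_smul, mul_zero, add_zero]
    exact LinearMap.ext fun v => rfl
  · intro i _ hi
    rw [if_neg hi, zero_mul, smul_zero, mul_zero, add_zero]
  · exact fun h => absurd (Finset.mem_univ j) h

theorem koszulD_mul_koszulD : koszulD N * koszulD N = 0 := by
  have h : ∀ j, Bracket (-1) (koszulD N) (Fock.bC j * Fock.fD j) 0 := fun j =>
    ((bracket_koszulD_bC j).mul_right (bracket_koszulD_fD j)).congr (one_mul _)
      (by rw [zero_mul, mul_zero, smul_zero, add_zero])
  exact ((Bracket.sum_right Finset.univ fun j (_ : j ∈ Finset.univ) => h j).congr rfl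
    Finset.sum_const_zero).mul_self_eq_zero

/-- The Lie derivative along the Euler vector field is the multiplication by the degree. -/
theorem koszulD_anticomm_deRham : koszulD N * deRham N + deRham N * koszulD N =
    Fock.diag fun _ S m => (koszulDegree S m : ℂ) := by
  have h3 : ∀ j, Bracket (-1) (koszulD N) (Fock.fC j * Fock.bD j)
      (Fock.diag fun _ S m => (m j : ℂ) + if j ∈ S then 1 else 0) := by
    intro j
    refine ((bracket_koszulD_fC j).mul_right (bracket_koszulD_bD j)).congr (mul_one _) ?_
    rw [neg_one_smul_mul_neg, Fock.bC_mul_bD_self, Fock.fC_mul_fD_self, Fock.diag_add]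
  have h := (Bracket.sum_right Finset.univ fun j (_ : j ∈ Finset.univ) => h3 j).anticomm
  rw [deRham, h, Fock.sum_diag]
  refine congrArg Fock.diag ?_
  funext _ S m
  rw [koszulDegree]
  push_cast
  rfl

/-- The element of the Koszul complex given by a polynomial and a product of odd generators. -/
def koszulVec (S : Finset (Fin N)) : PolyRing N →ₗ[ℂ] KoszulSpace N :=
  Polynomial.lsum fun k => Finsupp.lsingle (k, S)

theorem koszulVec_monomial (S : Finset (Fin N)) (k : ℕ) (p : MvPolynomial (Fin N) ℂ) :
    koszulVec S (Polynomial.monomial k p) = Finsupp.single (k, S) p := by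
  rw [koszulVec, Polynomial.lsum_apply, Polynomial.sum_monomial_index]
  · rfl
  · exact map_zero _

theorem bC_koszulVec (i : Fin N) (S : Finset (Fin N)) (f : PolyRing N) :
    Fock.bC i (koszulVec S f) = koszulVec S (Polynomial.C (X i) * f) := by
  induction f using Polynomial.induction_on' with
  | add f g hf hg => rw [map_add, map_add, hf, hg, mul_add, map_add]
  | monomial k p =>
    rw [Polynomial.C_mul_monomial, koszulVec_monomial, koszulVec_monomial, Fock.bC_single]

theorem fD_koszulVec (i : Fin N) (S : Finset (Fin N)) (f : PolyRing N) :
    Fock.fD i (koszulVec S f) =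
      if i ∈ S then Fock.sgn i S • koszulVec (S.erase i) f else 0 := by
  induction f using Polynomial.induction_on' with
  | add f g hf hg =>
    rw [map_add, map_add, hf, hg, map_add]
    split_ifs
    · rw [smul_add]
    · rw [add_zero]
  | monomial k p =>
    rw [koszulVec_monomial, koszulVec_monomial, Fock.fD_single]

theorem koszulD_koszulVec (S : Finset (Fin N)) (f : PolyRing N) :
    koszulD N (koszulVec S f) = ∑ i, if i ∈ S then
      Fock.sgn i S • koszulVec (S.erase i) (Polynomial.C (X i) * f) else 0 := by
  rw [koszulD, LinearMap.sum_apply]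
  refine Finset.sum_congr rfl fun i _ => ?_
  rw [Module.End.mul_apply, fD_koszulVec]
  split_ifs
  · rw [map_smul, bC_koszulVec]
  · exact map_zero _

theorem C_mul_modByMonic {R : Type*} [CommRing R] {P : Polynomial R} (c : R)
    (f : Polynomial R) : (Polynomial.C c * f) %ₘ P = Polynomial.C c * (f %ₘ P) := by
  rw [← Polynomial.smul_eq_C_mul, ← Polynomial.smul_eq_C_mul, Polynomial.smul_modByMonic]

/-- The element of the Koszul complex given by the remainder of a polynomial modulo
`T x₁ ⋯ x_N = q^{N+1}` and a product of odd generators. -/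
def koszulRem (q : ℂ) (S : Finset (Fin N)) : PolyRing N →ₗ[ℂ] KoszulSpace N :=
  koszulVec S ∘ₗ (Polynomial.modByMonicHom (fanRelation N q)).restrictScalars ℂ

theorem koszulRem_apply (q : ℂ) (S : Finset (Fin N)) (f : PolyRing N) :
    koszulRem q S f = koszulVec S (f %ₘ fanRelation N q) := rfl

theorem koszulRem_congr {q : ℂ} (S : Finset (Fin N)) {f g : PolyRing N}
    (h : fanRelation N q ∣ f - g) : koszulRem q S f = koszulRem q S g := by
  rw [← sub_eq_zero, ← map_sub, koszulRem_apply,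
    (Polynomial.modByMonic_eq_zero_iff_dvd (monic_fanRelation q)).mpr h, map_zero]

theorem C_C_mul_eq_smul (c : ℂ) (f : PolyRing N) : Polynomial.C (C c) * f = c • f := by
  refine Polynomial.ext fun k => ?_
  rw [Polynomial.coeff_C_mul, Polynomial.coeff_smul, MvPolynomial.smul_eq_C_mul]

theorem koszulD_koszulRem (q : ℂ) (S : Finset (Fin N)) (f : PolyRing N) :
    koszulD N (koszulRem q S f) = ∑ i, if i ∈ S then
      Fock.sgn i S • koszulRem q (S.erase i) (Polynomial.C (X i) * f) else 0 := by
  simp only [koszulRem_apply, koszulD_koszulVec, C_mul_modByMonic]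

/-- The map from the zero modes to the Koszul complex, extended by zero to the other modes. -/
def toKoszul (q : ℂ) : V N →ₗ[ℂ] KoszulSpace N :=
  Finsupp.lsum ℂ fun x =>
    (LinearMap.toSpanSingleton ℂ (KoszulSpace N)
      (koszulRem q (Finset.univ.filter fun i => phiMode i 0 ∈ x.2) (fanMonomial x.1.1))) ∘ₗ
        (MvPolynomial.lcoeff ℂ 0)

theorem toKoszul_zeroMode (q : ℂ) (a : Fin N → ℤ) (S : Finset (Fin N)) :
    toKoszul q (zeroMode a S) = koszulRem q S (fanMonomial a) := by
  have h : (Finset.univ.filter fun i => phiMode i 0 ∈ S.map phiZero) = S := by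
    ext i
    simp only [phiMode_mem_map_phiZero, and_true, Finset.mem_filter_univ]
  rw [toKoszul, zeroMode, Finsupp.lsum_single, LinearMap.comp_apply, h,
    LinearMap.toSpanSingleton_apply, lcoeff_apply, coeff_zero_one, one_smul]

section

variable {ε : Lat N → Lat N → ℤˣ} (hε : IsTwist ε) (q : ℂ)

include hε in
theorem toKoszul_shiftOp (a b : Fin N → ℤ) (S : Finset (Fin N)) :
    toKoszul q (shiftOp ε q a (zeroMode b S)) = koszulRem q S (fanMonomial a * fanMonomial b) := by
  rw [shiftOp_zeroMode hε, map_smul, toKoszul_zeroMode, ← map_smul, ← C_C_mul_eq_smul]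
  exact (koszulRem_congr S (fanRelation_dvd q a b)).symm

include hε in
/-- `toKoszul` is a morphism of complexes. Dividing by the relation commutes with the `yᵢ`, since
these have degree zero in `T`. -/
theorem toKoszul_D (hN : 1 ≤ N) {v : V N} (hv : v ∈ zeroModes N) :
    toKoszul q (D ε q v) = koszulD N (toKoszul q v) := by
  induction hv using Submodule.span_induction with
  | mem w hw =>
    obtain ⟨⟨a, S⟩, rfl⟩ := hw
    rw [D_zeroModes ε q (zeroMode_mem a S), toKoszul_zeroMode, koszulD_koszulRem, map_sum]
    refine Finset.sum_congr rfl fun i _ => ?_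
    rw [fD_zeroMode]
    split_ifs
    · rw [map_smul, map_smul, map_sub, map_smul, map_smul, toKoszul_shiftOp hε,
        toKoszul_shiftOp hε, ← smul_sub, ← map_sub, ← sub_mul, fanMonomial_single,
        fanMonomial_neg_one hN, xVar, add_sub_cancel_left]
    · simp only [map_zero, sub_self]
  | zero => simp only [map_zero]
  | add x y _ _ hx hy => rw [map_add, map_add, map_add, map_add, hx, hy]
  | smul c x _ hx => rw [map_smul, map_smul, map_smul, map_smul, hx]

/-- The action of polynomials on a fixed vector. -/
def polyVec (v : V N) : PolyRing N →ₗ[ℂ] V N where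
  toFun f := polyAction hε q f v
  map_add' f g := polyAction_add hε q f g v
  map_smul' c f := by rw [← C_C_mul_eq_smul, polyAction_C_C_mul]; rfl

/-- The map from the Koszul complex to the zero modes. -/
def ofKoszul : KoszulSpace N →ₗ[ℂ] V N :=
  Finsupp.lsum ℂ fun x =>
    polyVec hε q (zeroMode 0 x.2) ∘ₗ (Polynomial.monomial x.1).restrictScalars ℂ

theorem ofKoszul_single (k : ℕ) (S : Finset (Fin N)) (p : MvPolynomial (Fin N) ℂ) :
    ofKoszul hε q (Finsupp.single (k, S) p) =
      polyAction hε q (Polynomial.monomial k p) (zeroMode 0 S) := by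
  rw [ofKoszul, Finsupp.lsum_single]
  rfl

theorem ofKoszul_koszulVec (S : Finset (Fin N)) (f : PolyRing N) :
    ofKoszul hε q (koszulVec S f) = polyAction hε q f (zeroMode 0 S) := by
  induction f using Polynomial.induction_on' with
  | add f g hf hg => rw [map_add, map_add, hf, hg, polyAction_add]
  | monomial k p => rw [koszulVec_monomial, ofKoszul_single]

theorem ofKoszul_mem (u : KoszulSpace N) : ofKoszul hε q u ∈ zeroModes N := by
  induction u using Finsupp.induction_linear with
  | zero => rw [map_zero]; exact zero_mem _
  | add u v hu hv => rw [map_add]; exact add_mem hu hv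
  | single x p =>
    obtain ⟨k, S⟩ := x
    rw [ofKoszul_single]
    exact polyAction_mem_zeroModes hε q _ (zeroMode_mem 0 S)

/-- `ofKoszul` is a morphism of complexes. -/
theorem ofKoszul_koszulD (u : KoszulSpace N) :
    ofKoszul hε q (koszulD N u) = D ε q (ofKoszul hε q u) := by
  induction u using Finsupp.induction_linear with
  | zero => simp only [map_zero]
  | add u v hu hv => rw [map_add, map_add, map_add, map_add, hu, hv]
  | single x p =>
    obtain ⟨k, S⟩ := x
    rw [← koszulVec_monomial, koszulD_koszulVec, ofKoszul_koszulVec,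
      D_polyAction hε q _ (zeroMode_mem 0 S), D_eq_sum_polyAction hε q (zeroMode_mem 0 S),
      map_sum, map_sum]
    refine Finset.sum_congr rfl fun i _ => ?_
    rw [fD_zeroMode]
    split_ifs
    · rw [map_smul, map_smul, map_smul, ofKoszul_koszulVec, ← polyAction_mul, mul_comm]
    · simp only [map_zero]

/-- The complex of the zero modes is a direct summand of the Koszul complex. -/
theorem ofKoszul_toKoszul (hN : 1 ≤ N) {v : V N} (hv : v ∈ zeroModes N) :
    ofKoszul hε q (toKoszul q v) = v := by
  induction hv using Submodule.span_induction with
  | mem w hw =>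
    obtain ⟨⟨a, S⟩, rfl⟩ := hw
    rw [toKoszul_zeroMode, koszulRem_apply, ofKoszul_koszulVec,
      polyAction_modByMonic hN _ (zeroMode_mem 0 S), polyAction_fanMonomial hN]
  | zero => simp only [map_zero]
  | add x y _ _ hx hy => rw [map_add, map_add, hx, hy]
  | smul c x _ hx => rw [map_smul, map_smul, hx]

/-- The action of `ℂ[T]` on `e⁰`. -/
def powVec : Polynomial ℂ →ₗ[ℂ] V N where
  toFun f := polyAction hε q (f.map C) (expVec 0)
  map_add' f g := by rw [Polynomial.map_add, polyAction_add]
  map_smul' c f := by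
    rw [Polynomial.smul_eq_C_mul, Polynomial.map_mul, Polynomial.map_C, polyAction_C_C_mul]
    rfl

theorem powVec_apply (f : Polynomial ℂ) :
    powVec hε q f = polyAction hε q (f.map C) (expVec 0) := rfl

theorem powVec_mem_zeroModes (f : Polynomial ℂ) : powVec hε q f ∈ zeroModes N :=
  polyAction_mem_zeroModes hε q _ (zeroMode_mem 0 ∅)

theorem koszulDegree_eq_zero {S : Finset (Fin N)} {m : Fin N →₀ ℕ} :
    koszulDegree S m = 0 ↔ S = ∅ ∧ m = 0 := by
  simp only [koszulDegree, Finset.sum_eq_zero_iff, Finset.mem_univ, true_implies,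
    Nat.add_eq_zero_iff, ite_eq_right_iff, one_ne_zero, imp_false, forall_and]
  rw [Finset.eq_empty_iff_forall_notMem, DFunLike.ext_iff, and_comm]
  rfl

/-- The part of degree zero of the Koszul complex consists of the polynomials in `T` alone. -/
theorem ofKoszul_diagKer (u : KoszulSpace N) :
    ∃ f, ofKoszul hε q (Fock.diagKer (fun _ S m => (koszulDegree S m : ℂ)) u) = powVec hε q f := by
  suffices h : (LinearMap.range (powVec hε q)).mkQ ∘ₗ ofKoszul hε q ∘ₗ
      Fock.diagKer (fun _ S m => (koszulDegree S m : ℂ)) = 0 by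
    have h1 := LinearMap.congr_fun h u
    rw [LinearMap.zero_apply, LinearMap.comp_apply, Submodule.mkQ_apply,
      Submodule.Quotient.mk_eq_zero] at h1
    obtain ⟨f, hf⟩ := h1
    exact ⟨f, hf.symm⟩
  refine Fock.ext_monomial fun k S m => ?_
  rw [LinearMap.zero_apply, LinearMap.comp_apply, Submodule.mkQ_apply,
    Submodule.Quotient.mk_eq_zero, LinearMap.comp_apply, Fock.diagKer, Fock.diag_single, map_smul]
  split_ifs with h
  · obtain ⟨rfl, rfl⟩ := koszulDegree_eq_zero.mp (Nat.cast_eq_zero.mp h)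
    rw [one_smul, ofKoszul_single]
    refine ⟨Polynomial.monomial k 1, ?_⟩
    rw [powVec_apply, Polynomial.map_monomial]
    rfl
  · rw [zero_smul]
    exact zero_mem _

/-- Every zero mode closed under `D` is cohomologous to a vector obtained from `e⁰` by the action of
`ℂ[T]`. -/
theorem exists_powVec_add (hN : 1 ≤ N) {v : V N} (hv : v ∈ zeroModes N) (hD : D ε q v = 0) :
    ∃ f, ∃ w ∈ zeroModes N, v = powVec hε q f + D ε q w := by
  have h1 : koszulD N (toKoszul q v) = 0 := by rw [← toKoszul_D hε q hN hv, hD, map_zero]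
  have h2 := Fock.eq_diagKer_add koszulD_mul_koszulD koszulD_anticomm_deRham h1
  obtain ⟨f, hf⟩ := ofKoszul_diagKer hε q (toKoszul q v)
  refine ⟨f, _, ofKoszul_mem hε q (Fock.diag (fun _ S m => (koszulDegree S m : ℂ)⁻¹)
    (deRham N (toKoszul q v))), ?_⟩
  rw [← hf, ← ofKoszul_koszulD, ← map_add, ← h2, ofKoszul_toKoszul hε q hN hv]

end

/-! ### The relation in the cohomology -/

/-- The ideal of the relation `T^{N+1} = q^{N+1}`. -/
abbrev quantumIdeal (N : ℕ) (q : ℂ) : Ideal (Polynomial ℂ) :=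
  Ideal.span {(Polynomial.X ^ (N + 1) - Polynomial.C (q ^ (N + 1)) : Polynomial ℂ)}

/-- The specialization `y₁ = ⋯ = y_N = 0`. -/
def specialize (N : ℕ) (q : ℂ) : PolyRing N →+* Polynomial ℂ ⧸ quantumIdeal N q :=
  (Ideal.Quotient.mk _).comp (Polynomial.mapRingHom constantCoeff)

theorem specialize_map_C (q : ℂ) (f : Polynomial ℂ) :
    specialize N q (f.map C) = Ideal.Quotient.mk _ f := by
  rw [specialize, RingHom.comp_apply, Polynomial.coe_mapRingHom, Polynomial.map_map]
  congr 1
  have h : (constantCoeff : MvPolynomial (Fin N) ℂ →+* ℂ).comp C = RingHom.id ℂ :=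
    RingHom.ext fun c => constantCoeff_C _ c
  rw [h, Polynomial.map_id]

theorem specialize_C_X (q : ℂ) (i : Fin N) : specialize N q (Polynomial.C (X i)) = 0 := by
  rw [specialize, RingHom.comp_apply, Polynomial.coe_mapRingHom, Polynomial.map_C, constantCoeff_X,
    map_zero, map_zero]

theorem specialize_smul (q c : ℂ) (f : PolyRing N) :
    specialize N q (c • f) = c • specialize N q f := by
  rw [specialize, RingHom.comp_apply, RingHom.comp_apply, Polynomial.coe_mapRingHom,
    ← C_C_mul_eq_smul, Polynomial.map_mul, Polynomial.map_C, constantCoeff_C,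
    ← Polynomial.smul_eq_C_mul]
  rfl

theorem specialize_fanRelation (q : ℂ) : specialize N q (fanRelation N q) = 0 := by
  have h : (fanRelation N q).map constantCoeff =
      (Polynomial.X ^ (N + 1) - Polynomial.C (q ^ (N + 1)) : Polynomial ℂ) := by
    simp only [fanRelation, xVar, Polynomial.map_sub, Polynomial.map_mul, Polynomial.map_X,
      Polynomial.map_prod, Polynomial.map_add, Polynomial.map_C, constantCoeff_X, constantCoeff_C,
      map_zero, add_zero, Finset.prod_const, Finset.card_univ, Fintype.card_fin, pow_succ']
  rw [specialize, RingHom.comp_apply, Polynomial.coe_mapRingHom, h,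
    Ideal.Quotient.eq_zero_iff_mem]
  exact Ideal.mem_span_singleton_self _

theorem specialize_congr {q : ℂ} {f g : PolyRing N} (h : fanRelation N q ∣ f - g) :
    specialize N q f = specialize N q g := by
  obtain ⟨k, hk⟩ := h
  rw [← sub_eq_zero, ← map_sub, hk, map_mul, specialize_fanRelation, zero_mul]

/-- The augmentation of the Koszul complex: all `yᵢ` are set to zero, all forms of positive exterior
degree are sent to zero, and the copy with index `k` to the multiples of `T^k`. -/
def koszulAug (N : ℕ) (q : ℂ) : KoszulSpace N →ₗ[ℂ] Polynomial ℂ ⧸ quantumIdeal N q :=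
  Finsupp.lsum ℂ fun x =>
    { toFun p := if x.2 = ∅ then specialize N q (Polynomial.monomial x.1 p) else 0
      map_add' p p' := by
        split_ifs
        · rw [map_add, map_add]
        · rw [add_zero]
      map_smul' c p := by
        split_ifs
        · rw [← Polynomial.smul_monomial, specialize_smul]; rfl
        · rw [smul_zero] }

theorem koszulAug_koszulVec (q : ℂ) (S : Finset (Fin N)) (f : PolyRing N) :
    koszulAug N q (koszulVec S f) = if S = ∅ then specialize N q f else 0 := by
  induction f using Polynomial.induction_on' with
  | add f g hf hg =>
    rw [map_add, map_add, hf, hg, map_add]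
    split_ifs
    · rfl
    · rw [add_zero]
  | monomial k p =>
    rw [koszulVec_monomial, koszulAug, Finsupp.lsum_single]
    rfl

theorem koszulAug_koszulRem (q : ℂ) (f : PolyRing N) :
    koszulAug N q (koszulRem q ∅ f) = specialize N q f := by
  rw [koszulRem_apply, koszulAug_koszulVec, if_pos rfl]
  refine specialize_congr ?_
  rw [Polynomial.modByMonic_eq_sub_mul_div, sub_sub_cancel_left]
  exact (dvd_mul_right _ _).neg_right

/-- The augmentation sets every `yᵢ` to zero, so it kills the coboundaries. -/
theorem koszulAug_koszulD (q : ℂ) (u : KoszulSpace N) : koszulAug N q (koszulD N u) = 0 := by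
  induction u using Finsupp.induction_linear with
  | zero => simp only [map_zero]
  | add u v hu hv => rw [map_add, map_add, hu, hv, add_zero]
  | single x p =>
    obtain ⟨k, S⟩ := x
    rw [← koszulVec_monomial, koszulD_koszulVec, map_sum]
    refine Finset.sum_eq_zero fun i _ => ?_
    split_ifs
    · rw [map_smul, koszulAug_koszulVec, map_mul, specialize_C_X, zero_mul, ite_self, smul_zero]
    · exact map_zero _

section

variable {ε : Lat N → Lat N → ℤˣ} (hε : IsTwist ε) (q : ℂ)

theorem koszulAug_polyAction_X_pow (hN : 1 ≤ N) (k : ℕ) (a : Fin N → ℤ) :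
    koszulAug N q (toKoszul q (polyAction hε q (Polynomial.X ^ k) (zeroMode a ∅))) =
      specialize N q (Polynomial.X ^ k * fanMonomial a) := by
  induction k generalizing a with
  | zero =>
    rw [pow_zero, map_one, Module.End.one_apply, one_mul, toKoszul_zeroMode, koszulAug_koszulRem]
  | succ k ih =>
    rw [pow_succ, polyAction_mul, polyAction_X, shiftOp_zeroMode hε, map_smul, map_smul, map_smul,
      ih, ← specialize_smul, mul_assoc, ← mul_smul_comm, ← C_C_mul_eq_smul, map_mul,
      ← specialize_congr (fanRelation_dvd q (fun _ => -1) a), fanMonomial_neg_one hN, ← map_mul]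

theorem koszulAug_powVec (hN : 1 ≤ N) (f : Polynomial ℂ) :
    koszulAug N q (toKoszul q (powVec hε q f)) = Ideal.Quotient.mk (quantumIdeal N q) f := by
  induction f using Polynomial.induction_on' with
  | add f g hf hg => rw [map_add, map_add, map_add, hf, hg, map_add]
  | monomial k c =>
    have h := koszulAug_polyAction_X_pow hε q hN k 0
    have h0 : (fanMonomial 0 : PolyRing N) = 1 := by
      have : lastCoord (0 : Fin N → ℤ) = 0 := Nat.le_zero.mp (lastCoord_le _ _ fun j => by simp)
      simp [fanMonomial, this]
    rw [h0, mul_one] at h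
    rw [← Polynomial.C_mul_X_pow_eq_monomial, ← Polynomial.smul_eq_C_mul, map_smul, map_smul,
      map_smul, powVec_apply, Polynomial.map_pow, Polynomial.map_X]
    refine (congrArg (c • ·) h).trans ?_
    rw [← Polynomial.map_X (C : ℂ →+* MvPolynomial (Fin N) ℂ), ← Polynomial.map_pow,
      specialize_map_C]
    rfl

/-- The augmentation of a coboundary vanishes, and that of `f(T) e⁰` is the class of `f`. -/
theorem mem_quantumIdeal_of_D (hN : 1 ≤ N) {f : Polynomial ℂ} {w : V N} (hw : w ∈ zeroModes N)
    (h : powVec hε q f = D ε q w) : f ∈ quantumIdeal N q := by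
  rw [← Ideal.Quotient.eq_zero_iff_mem, ← koszulAug_powVec hε q hN, h, toKoszul_D hε q hN hw,
    koszulAug_koszulD]

theorem D_expVec_zero : D ε q (expVec 0) = 0 := by
  have h := D_zeroModes ε q (zeroMode_mem 0 ∅)
  simp only [fD_zeroMode, Finset.notMem_empty, if_false, map_zero, sub_self,
    Finset.sum_const_zero] at h
  exact h

/-- Polynomials in the ideal of the `yᵢ` send `e⁰` to boundaries. -/
theorem exists_D_eq_polyAction {g : PolyRing N}
    (hg : g ∈ Ideal.span (Set.range fun i : Fin N => (Polynomial.C (X i) : PolyRing N))) :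
    ∃ w ∈ zeroModes N, polyAction hε q g (expVec 0) = D ε q w := by
  induction hg using Submodule.span_induction with
  | mem g hg =>
    obtain ⟨i, rfl⟩ := hg
    refine ⟨Fock.fC (phiMode i 0) (expVec 0), fC_mem_zeroModes i (zeroMode_mem 0 ∅), ?_⟩
    have h := D_fC ε q (zeroMode_mem 0 ∅) i
    rw [zeroMode_empty] at h
    refine Eq.trans ?_ h.symm
    have h0 := D_expVec_zero (ε := ε) q
    rw [polyAction_C_X, diffOp_apply]
    refine ((congrArg₂ (· + ·) ?_ rfl).trans (zero_add _)).symm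
    exact (congrArg (fun v => -Fock.fC (phiMode i 0) v) h0).trans (by rw [map_zero, neg_zero])
  | zero => exact ⟨0, zero_mem _, by rw [map_zero, map_zero]; rfl⟩
  | add f g _ _ hf hg =>
    obtain ⟨w, hw, h⟩ := hf
    obtain ⟨w', hw', h'⟩ := hg
    exact ⟨w + w', add_mem hw hw', by rw [polyAction_add, h, h', map_add]⟩
  | smul f g _ hg =>
    obtain ⟨w, hw, h⟩ := hg
    exact ⟨polyAction hε q f w, polyAction_mem_zeroModes hε q f hw, by
      rw [smul_eq_mul, polyAction_mul, h, D_polyAction hε q f hw]⟩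

/-- `T^{N+1} - T x₁ ⋯ x_N` lies in the ideal of the `yᵢ`, since `xᵢ = T + yᵢ`, and the multiples of
`yᵢ` map `e⁰` to coboundaries; moreover `T x₁ ⋯ x_N` acts as `q^{N+1}`. -/
theorem exists_D_eq_of_mem_quantumIdeal (hN : 1 ≤ N) {f : Polynomial ℂ}
    (hf : f ∈ quantumIdeal N q) : ∃ w ∈ zeroModes N, powVec hε q f = D ε q w := by
  obtain ⟨g, rfl⟩ := Ideal.mem_span_singleton'.mp hf
  have h : (Polynomial.X ^ (N + 1) - Polynomial.X * ∏ i, xVar i : PolyRing N) ∈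
      Ideal.span (Set.range fun i : Fin N => (Polynomial.C (X i) : PolyRing N)) := by
    have hx : ∀ i, Ideal.Quotient.mk (Ideal.span (Set.range fun i : Fin N =>
        (Polynomial.C (X i) : PolyRing N))) (xVar i) = Ideal.Quotient.mk _ Polynomial.X := by
      intro i
      rw [xVar, map_add, add_eq_left, Ideal.Quotient.eq_zero_iff_mem]
      exact Ideal.subset_span ⟨i, rfl⟩
    rw [← Ideal.Quotient.eq_zero_iff_mem, map_sub, map_mul, map_prod, map_pow]
    simp only [hx, Finset.prod_const, Finset.card_univ, Fintype.card_fin]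
    rw [pow_succ', sub_self]
  obtain ⟨w, hw, h1⟩ := exists_D_eq_polyAction hε q h
  have h2 : polyAction hε q (Polynomial.X ^ (N + 1) - Polynomial.C (C (q ^ (N + 1))))
      (expVec 0) = D ε q w := by
    have h3 : (Polynomial.X ^ (N + 1) - Polynomial.C (C (q ^ (N + 1))) : PolyRing N) =
        (Polynomial.X ^ (N + 1) - Polynomial.X * ∏ i, xVar i) + fanRelation N q := by
      rw [fanRelation, sub_add_sub_cancel]
    have h4 := polyAction_fanRelation (hε := hε) (q := q) hN (zeroMode_mem 0 ∅)
    rw [zeroMode_empty] at h4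
    rw [h3, polyAction_add, h1]
    exact (congrArg (D ε q w + ·) h4).trans (add_zero _)
  refine ⟨polyAction hε q (g.map C) w, polyAction_mem_zeroModes hε q _ hw, ?_⟩
  rw [D_polyAction hε q _ hw, ← h2, ← polyAction_mul, powVec_apply, Polynomial.map_mul,
    Polynomial.map_sub, Polynomial.map_pow, Polynomial.map_X, Polynomial.map_C]

theorem qProd_powVec (f : Polynomial ℂ) {v : V N} (hv : v ∈ zeroModes N) :
    qProd ε q (-1) (powVec hε q f) v = polyAction hε q (f.map C) v := by
  rw [powVec_apply hε q f, qProd_polyAction hε q _ (x := expVec 0) (zeroMode_mem 0 ∅) hv]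
  have h := qProd_expVec ε q 0 hv
  rw [shiftOp_zero hε q hv] at h
  exact congrArg (polyAction hε q (f.map C)) h

theorem qProd_powVec_powVec (f g : Polynomial ℂ) :
    qProd ε q (-1) (powVec hε q f) (powVec hε q g) = powVec hε q (f * g) := by
  rw [qProd_powVec hε q f (powVec_mem_zeroModes hε q g), powVec_apply, powVec_apply,
    Polynomial.map_mul, polyAction_mul]

theorem D_powVec (f : Polynomial ℂ) : D ε q (powVec hε q f) = 0 := by
  rw [powVec_apply hε q f, D_polyAction hε q _ (v := expVec 0) (zeroMode_mem 0 ∅), D_expVec_zero,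
    map_zero]

theorem powVec_one : powVec hε q 1 = expVec 0 := by
  rw [powVec_apply, Polynomial.map_one, map_one, Module.End.one_apply]

theorem powVec_X : powVec hε q Polynomial.X = expVec (xiLast N) := by
  rw [powVec_apply, Polynomial.map_X, polyAction_X]
  have h := shiftOp_zeroMode hε q (fun _ => -1) 0 ∅
  rw [add_zero, ht_zero, add_zero, sub_self, Int.toNat_zero, pow_zero, one_smul] at h
  exact h

end

/-! ### The iterated cohomology -/

section

variable {W : Type*} [AddCommGroup W] [Module ℂ W] {d δ : Module.End ℂ W}
  {h : δ * d = -(d * δ)} {a b w : W} {c : Cohomology (Cohomology.induced d δ h)}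

/-- A representative may be changed by coboundaries of both differentials. -/
theorem Represents.add (hd : d * d = 0) (hδ : δ * δ = 0) (hb : Represents h b c) (hw : d w = 0)
    (u : W) : Represents h (b + δ w + d u) c := by
  obtain ⟨hb1, hb2, rfl⟩ := hb
  have h1 : d (δ w) = 0 := Cohomology.mapsTo h w hw
  have h2 : d (d u) = 0 := LinearMap.congr_fun hd u
  have h3 : d (b + δ w + d u) = 0 := by rw [map_add, map_add, hb1, h1, h2, add_zero, add_zero]
  have h4 : Cohomology.mk d (b + δ w + d u) h3 =
      Cohomology.mk d b hb1 + Cohomology.induced d δ h (Cohomology.mk d w hw) := by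
    refine (Submodule.Quotient.eq _).mpr ⟨u, ?_⟩
    exact (add_sub_cancel_left (b + δ w) (d u)).symm
  have h5 : Cohomology.induced d δ h
      (Cohomology.induced d δ h (Cohomology.mk d w hw)) = 0 := by
    refine (Submodule.Quotient.mk_eq_zero _).mpr ⟨0, ?_⟩
    rw [map_zero]
    exact (LinearMap.congr_fun hδ w).symm
  refine ⟨h3, by rw [h4, map_add, hb2, h5, add_zero], ?_⟩
  refine (Submodule.Quotient.eq _).mpr ⟨Cohomology.mk d w hw, ?_⟩
  exact (sub_eq_of_eq_add' h4).symm

/-- Two representatives differ by coboundaries of both differentials. -/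
theorem Represents.exists_eq (ha : Represents h a c) (hb : Represents h b c) :
    ∃ w u, d w = 0 ∧ a = b + δ w + d u := by
  obtain ⟨ha1, ha2, rfl⟩ := ha
  obtain ⟨hb1, hb2, hab⟩ := hb
  obtain ⟨y, hy⟩ := (Submodule.Quotient.eq _).mp hab.symm
  obtain ⟨⟨w, hw⟩, rfl⟩ := Submodule.Quotient.mk_surjective _ y
  have h1 : Cohomology.mk d (a - b) (by rw [map_sub, ha1, hb1, sub_zero]) =
      Cohomology.mk d (δ w) (Cohomology.mapsTo h w hw) := hy.symm
  obtain ⟨u, hu⟩ := (Submodule.Quotient.eq _).mp h1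
  refine ⟨w, u, hw, ?_⟩
  have h2 : d u = a - b - δ w := hu
  rw [h2]
  abel

theorem Represents.unique {c' : Cohomology (Cohomology.induced d δ h)} (hc : Represents h a c)
    (hc' : Represents h a c') : c = c' := by
  obtain ⟨_, _, rfl⟩ := hc
  obtain ⟨_, _, rfl⟩ := hc'
  rfl

theorem exists_represents (c : Cohomology (Cohomology.induced d δ h)) : ∃ a, Represents h a c := by
  obtain ⟨⟨y, hy⟩, rfl⟩ := Submodule.Quotient.mk_surjective _ c
  obtain ⟨⟨a, ha⟩, rfl⟩ := Submodule.Quotient.mk_surjective _ y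
  exact ⟨a, ha, hy, rfl⟩

/-- The linear map to the iterated cohomology given by a linear family of cocycles. -/
theorem exists_linearMap_represents {M : Type*} [AddCommGroup M] [Module ℂ M] (ψ : M →ₗ[ℂ] W)
    (h1 : ∀ x, d (ψ x) = 0) (h2 : ∀ x, δ (ψ x) = 0) (h : δ * d = -(d * δ)) :
    ∃ Φ : M →ₗ[ℂ] Cohomology (Cohomology.induced d δ h), ∀ x, Represents h (ψ x) (Φ x) := by
  have h3 : ∀ x, Cohomology.induced d δ h (Cohomology.mk d (ψ x) (h1 x)) = 0 := fun x =>
    (Submodule.Quotient.mk_eq_zero _).mpr ⟨0, (map_zero d).trans (h2 x).symm⟩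
  let ψ₁ : M →ₗ[ℂ] Cohomology d := Submodule.mkQ _ ∘ₗ ψ.codRestrict (LinearMap.ker d) h1
  exact ⟨Submodule.mkQ _ ∘ₗ ψ₁.codRestrict (LinearMap.ker (Cohomology.induced d δ h)) h3,
    fun x => ⟨h1 x, h3 x, rfl⟩⟩

end

section

variable {ε : Lat N → Lat N → ℤˣ} (hε : IsTwist ε) (q : ℂ)

/-- The vectors that differ from the polynomial `f` in `e^{-A¹-⋯-Aᴺ}` by a boundary. -/
def IsPowVec (f : Polynomial ℂ) (a : V N) : Prop :=
  ∃ w ∈ zeroModes N, ∃ u, a = powVec hε q f + D ε q w + Q0 ε q u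

include hε in
theorem exists_D_eq_D_zeroModes_add {w : V N} (hw : Q0 ε q w = 0) :
    ∃ w' ∈ zeroModes N, ∃ u, D ε q w = D ε q w' + Q0 ε q u := by
  obtain ⟨w', hw', u, rfl⟩ := exists_zeroModes_add hε q hw
  refine ⟨w', hw', -D ε q u, ?_⟩
  rw [map_add, map_neg, Q0_D hε q, neg_neg]

theorem mem_quantumIdeal_iff_isPowVec_zero (hN : 1 ≤ N) {f : Polynomial ℂ} :
    IsPowVec hε q 0 (powVec hε q f) ↔ f ∈ quantumIdeal N q := by
  constructor
  · rintro ⟨w, hw, u, h⟩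
    rw [map_zero, zero_add] at h
    have h1 : Q0 ε q u ∈ zeroModes N := by
      rw [← sub_eq_iff_eq_add'.mpr h]
      exact sub_mem (powVec_mem_zeroModes hε q f) (D_mem_zeroModes hε q hw)
    rw [eq_zero_of_mem_zeroModes hε q h1, add_zero] at h
    exact mem_quantumIdeal_of_D hε q hN hw h
  · intro hf
    obtain ⟨w, hw, h⟩ := exists_D_eq_of_mem_quantumIdeal hε q hN hf
    exact ⟨w, hw, 0, by rw [map_zero, map_zero, zero_add, add_zero, h]⟩

theorem exists_isPowVec (hN : 1 ≤ N) {a : V N} (ha : Q0 ε q a = 0)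
    (hD : ∃ u, Q0 ε q u = D ε q a) : ∃ f, IsPowVec hε q f a := by
  obtain ⟨v, hv, u, rfl⟩ := exists_zeroModes_add hε q ha
  obtain ⟨u', hu'⟩ := hD
  have h : Q0 ε q (u' + D ε q u) = D ε q v := by
    rw [map_add, Q0_D hε q, hu', map_add, add_assoc, add_neg_cancel, add_zero]
  have h1 := eq_zero_of_mem_zeroModes hε q (h.symm ▸ D_mem_zeroModes hε q hv)
  obtain ⟨f, w, hw, rfl⟩ := exists_powVec_add hε q hN hv (h.symm.trans h1)
  exact ⟨f, w, hw, u, rfl⟩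

variable {hε q}

theorem IsPowVec.Q0_eq_zero {f : Polynomial ℂ} {a : V N} (ha : IsPowVec hε q f a) :
    Q0 ε q a = 0 := by
  obtain ⟨w, hw, u, rfl⟩ := ha
  have h := LinearMap.congr_fun (Q0_mul_Q0 hε q) u
  rw [Module.End.mul_apply, LinearMap.zero_apply] at h
  rw [map_add, map_add, h, Q0_zeroModes hε q (powVec_mem_zeroModes hε q f),
    Q0_zeroModes hε q (D_mem_zeroModes hε q hw), add_zero, add_zero]

theorem qProd_Q0_left (hε : IsTwist ε) {b : V N} (hb : Q0 ε q b = 0) (u : V N) :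
    qProd ε q (-1) (Q0 ε q u) b = Q0 ε q (qProd ε q (-1) u b) := by
  rw [Q0_qProd hε, hb, map_zero, add_zero]

/-- The sign in the derivation rule is absorbed in the parity involution. -/
theorem qProd_Q0_right (hε : IsTwist ε) {a : V N} (ha : Q0 ε q a = 0) (u : V N) :
    qProd ε q (-1) a (Q0 ε q u) = Q0 ε q (qProd ε q (-1) (Fock.parity a) u) := by
  have h : Fock.parity (Fock.parity a) = a := LinearMap.congr_fun Fock.parity_mul_parity a
  rw [Q0_qProd hε, Q0_parity hε, ha, map_zero, neg_zero, map_zero, LinearMap.zero_apply, zero_add,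
    h]

theorem qProd_D_left (hε : IsTwist ε) {w v : V N} (hw : w ∈ zeroModes N) (hv : v ∈ zeroModes N)
    (hD : D ε q v = 0) : qProd ε q (-1) (D ε q w) v = D ε q (qProd ε q (-1) w v) := by
  rw [D_qProd hε q hw hv, hD, map_zero, add_zero]

/-- The product of cocycles representing `f` and `g` represents `f g`. -/
theorem isPowVec_qProd {f g : Polynomial ℂ} {a b : V N} (ha : IsPowVec hε q f a)
    (hb : IsPowVec hε q g b) : IsPowVec hε q (f * g) (qProd ε q (-1) a b) := by
  have hQb := hb.Q0_eq_zero
  obtain ⟨w, hw, u, rfl⟩ := ha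
  obtain ⟨w', hw', u', hb'⟩ := hb
  have hDw' := D_mem_zeroModes hε q hw'
  obtain ⟨v, hv⟩ : ∃ v, v = powVec hε q g + D ε q w' := ⟨_, rfl⟩
  have hvW : v ∈ zeroModes N := hv ▸ add_mem (powVec_mem_zeroModes hε q g) hDw'
  have hvD : D ε q v = 0 := by
    rw [hv, map_add, D_powVec hε, zero_add]
    exact LinearMap.congr_fun (D_mul_D hε q) w'
  have hQ : Q0 ε q (powVec hε q f + D ε q w) = 0 :=
    Q0_zeroModes hε q (add_mem (powVec_mem_zeroModes hε q f) (D_mem_zeroModes hε q hw))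
  have h : qProd ε q (-1) (powVec hε q f) v =
      powVec hε q (f * g) + D ε q (polyAction hε q (f.map C) w') := by
    rw [hv, map_add, qProd_powVec_powVec, qProd_powVec hε q f hDw', D_polyAction hε q _ hw']
  refine ⟨polyAction hε q (f.map C) w' + qProd ε q (-1) w v,
    add_mem (polyAction_mem_zeroModes hε q _ hw') (qProd_mem_zeroModes hε q hw hvW),
    qProd ε q (-1) (Fock.parity (powVec hε q f + D ε q w)) u' + qProd ε q (-1) u b, ?_⟩
  rw [← hv] at hb'
  rw [map_add (qProd ε q (-1)), LinearMap.add_apply, qProd_Q0_left hε hQb,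
    map_add (Q0 ε q) _ (qProd ε q (-1) u b), ← qProd_Q0_right hε hQ, hb', map_add, map_add (D ε q),
    map_add (qProd ε q (-1)) (powVec hε q f), LinearMap.add_apply _ _ v, h,
    qProd_D_left hε hw hvW hvD]
  abel

variable (hε q)

/-- Polynomials in `T` represent all classes of the iterated cohomology, and those that represent
zero form the ideal. -/
theorem exists_represents_powVec (hN : 1 ≤ N) (h : D ε q * Q0 ε q = -(Q0 ε q * D ε q)) :
    ∃ Φ : Polynomial ℂ →ₗ[ℂ] Cohomology (Cohomology.induced (Q0 ε q) (D ε q) h),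
      (∀ f a, Represents h a (Φ f) ↔ IsPowVec hε q f a) ∧
        LinearMap.ker Φ = (quantumIdeal N q).restrictScalars ℂ ∧ Function.Surjective Φ := by
  obtain ⟨Φ, hΦ⟩ := exists_linearMap_represents (powVec hε q)
    (fun f => Q0_zeroModes hε q (powVec_mem_zeroModes hε q f)) (D_powVec hε q) h
  have hiff : ∀ f a, Represents h a (Φ f) ↔ IsPowVec hε q f a := by
    intro f a
    constructor
    · intro ha
      obtain ⟨w, u, hw, rfl⟩ := ha.exists_eq (hΦ f)
      obtain ⟨w', hw', u', hu'⟩ := exists_D_eq_D_zeroModes_add hε q hw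
      exact ⟨w', hw', u' + u, by rw [hu', map_add, add_assoc, add_assoc, add_assoc]⟩
    · rintro ⟨w, hw, u, rfl⟩
      exact (hΦ f).add (Q0_mul_Q0 hε q) (D_mul_D hε q) (Q0_zeroModes hε q hw) u
  refine ⟨Φ, hiff, Submodule.ext fun f => ?_, fun c => ?_⟩
  · rw [Submodule.restrictScalars_mem, ← mem_quantumIdeal_iff_isPowVec_zero hε q hN, ← hiff,
      map_zero, LinearMap.mem_ker]
    exact ⟨fun h0 => h0 ▸ hΦ f, fun h0 => (hΦ f).unique h0⟩
  · obtain ⟨a, ha⟩ := exists_represents c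
    obtain ⟨ha1, ha2, -⟩ := id ha
    obtain ⟨f, hf⟩ := exists_isPowVec hε q hN ha1 ((Submodule.Quotient.mk_eq_zero _).mp ha2)
    exact ⟨f, ((hiff f a).mpr hf).unique ha⟩

end

end LatticeVA

end

theorem theorem2p3 (N : ℕ) (hN : 1 ≤ N) (q : ℂ)
    (ε : LatticeVA.Lat N → LatticeVA.Lat N → ℤˣ) (hε : LatticeVA.IsTwist ε) :
    LatticeVA.Q0 ε q * LatticeVA.Q0 ε q = 0 ∧
    LatticeVA.D ε q * LatticeVA.D ε q = 0 ∧
    ∃ h : LatticeVA.D ε q * LatticeVA.Q0 ε q = -(LatticeVA.Q0 ε q * LatticeVA.D ε q),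
    ∃ φ : (Polynomial ℂ ⧸ Ideal.span
          {(Polynomial.X ^ (N + 1) - Polynomial.C (q ^ (N + 1)) : Polynomial ℂ)}) ≃ₗ[ℂ]
        LatticeVA.Cohomology
          (LatticeVA.Cohomology.induced (LatticeVA.Q0 ε q) (LatticeVA.D ε q) h),
      LatticeVA.Represents h (LatticeVA.expVec 0) (φ 1) ∧
      LatticeVA.Represents h (LatticeVA.expVec (LatticeVA.xiLast N))
        (φ (Ideal.Quotient.mk _ Polynomial.X)) ∧
      ∀ f g a b, LatticeVA.Represents h a (φ f) → LatticeVA.Represents h b (φ g) →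
        LatticeVA.Represents h (LatticeVA.qProd ε q (-1) a b) (φ (f * g)) := by
  refine ⟨LatticeVA.Q0_mul_Q0 hε q, LatticeVA.D_mul_D hε q, LatticeVA.D_mul_Q0 hε q, ?_⟩
  obtain ⟨Φ, hΦ, hker, hsurj⟩ :=
    LatticeVA.exists_represents_powVec hε q hN (LatticeVA.D_mul_Q0 hε q)
  let φ := ((Submodule.Quotient.restrictScalarsEquiv ℂ (LatticeVA.quantumIdeal N q)).symm.trans
    (Submodule.quotEquivOfEq _ _ hker.symm)).trans (Φ.quotKerEquivOfSurjective hsurj)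
  have hφ : ∀ f, φ (Ideal.Quotient.mk _ f) = Φ f := fun f => rfl
  have hrep : ∀ f, LatticeVA.IsPowVec hε q f (LatticeVA.powVec hε q f) := fun f =>
    ⟨0, zero_mem _, 0, by rw [map_zero, map_zero, add_zero, add_zero]⟩
  refine ⟨φ, ?_, ?_, fun f g a b ha hb => ?_⟩
  · rw [← map_one (Ideal.Quotient.mk _), hφ, hΦ, ← LatticeVA.powVec_one hε q]
    exact hrep 1
  · rw [hφ, hΦ, ← LatticeVA.powVec_X hε q]
    exact hrep _
  · obtain ⟨f, rfl⟩ := Ideal.Quotient.mk_surjective f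
    obtain ⟨g, rfl⟩ := Ideal.Quotient.mk_surjective g
    rw [hφ, hΦ] at ha hb
    rw [← map_mul, hφ, hΦ]
    exact LatticeVA.isPowVec_qProd ha hb
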